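/- Let $d,k\ge 1$ be integers and let $G$ be a probability measure on $\mathbb{R}^d$ that has a density $g$ with respect to Lebesgue measure. Let $Y_1,Y_2,\dots$ be i.i.d. with law $G$ and, for every $a>0$ and $N\ge 1$, let $(J_{1,N},\dots,J_{N,N})\sim\mathrm{Dirichlet}(a/N,\dots,a/N)$ be independent of $(Y_1,\dots,Y_N)$, so that $P_N=\sum_{i=1}^N J_{i,N}\delta_{Y_i}$ is the finite Dirichlet approximation of the Dirichlet process $DP(a,G)$. For $N\ge k+1$ let $R_{i,k,N-1}$ be the Euclidean distance between $Y_i$ and its $k$-th closest neighbour among $\{Y_j: 1\le j\le N,\ j\ne i\}$, and define the $k$-NN BNP prior entropy $$H^{pri}_{N,a,k}=\sum_{i=1}^N J_{i,N}\,\log\frac{(N-1)\,\pi^{d/2}\,R_{i,k,N-1}^d}{k\,\Gamma(\frac d2+1)}-L_{k-1}+\gamma+\log k,$$ where $L_{j}=\sum_{r=1}^{j}\frac1r$, $L_0=0$, and $\gamma$ is Euler's constant. Let $H(G)=-\int g\log g\,dx$ and $Q_k=\sum_{j=k}^\infty j^{-2}$. (i) Suppose that $\int |\log g|\,dG<\infty$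 and $\int\log(1+\|x\|)\,G(dx)<\infty$. Then for every $a>0$, $H^{pri}_{N,a,k}$ is integrable for all $N\ge k+1$ and $E(H^{pri}_{N,a,k})\to H(G)$ as $N\to\infty$. (ii) Suppose moreover that $\int (\log g)^2\,dG<\infty$ and $\int(\log(1+\|x\|))^2\,G(dx)<\infty$. Then for every $a>0$, $H^{pri}_{N,a,k}$ is square integrable for all $N\ge k+1$ and, with $Y\sim G$, $$\mathrm{Var}(H^{pri}_{N,a,k})\to\frac{Q_k+\mathrm{Var}(\log g(Y))}{a+1}\qquad\text{as } N\to\infty .$$ This limit tends to $0$ as $a\to\infty$; moreover $\mathrm{Var}(H^{pri}_{N,a,k})\to 0$ as $N\to\infty$ and $a\to\infty$ jointly. -/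

import Mathlib

open MeasureTheory ProbabilityTheory Filter Topology

/-- The (Lebesgue) probability density function of a law `G` on `ℝ^d`. -/
noncomputable def pdfOf {d : ℕ} (G : Measure (EuclideanSpace ℝ (Fin d)))
    (x : EuclideanSpace ℝ (Fin d)) : ℝ :=
  (G.rnDeriv volume x).toReal

/-- The differential entropy `H(G) = -∫ g log g` of a law `G` on `ℝ^d` with density `g`
(with `0 log 0 = 0`). -/
noncomputable def entropyOf {d : ℕ} (G : Measure (EuclideanSpace ℝ (Fin d))) : ℝ :=
  -∫ x, pdfOf G x * Real.log (pdfOf G x)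

/-- The Dirichlet distribution with parameters `α i > 0`: the law of `(X i / ∑ j, X j)_i` for
independent `X i ∼ gamma(α i, 1)`. -/
noncomputable def dirichletLaw {ι : Type*} [Fintype ι] (α : ι → ℝ) : Measure (ι → ℝ) :=
  (Measure.pi fun i => gammaMeasure (α i) 1).map fun x i => x i / ∑ j, x j

/-- The Euclidean distance between `y i` and its `k`-th closest neighbour among the other points:
the least radius `r` such that at least `k` of the points `y j`, `j ≠ i`, are within distance `r`
of `y i`. It is used for `1 ≤ k ≤ N - 1`. -/
noncomputable def knnDist {d N : ℕ} (k : ℕ) (y : Fin N → EuclideanSpace ℝ (Fin d))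
    (i : Fin N) : ℝ :=
  sInf {r : ℝ | k ≤ (Finset.univ.filter fun j => j ≠ i ∧ dist (y j) (y i) ≤ r).card}

/-- The logarithmic `k`-nearest-neighbour statistic
`T_i = log ((N - 1) π^(d/2) R_i^d / (k Γ(d/2 + 1)))`. -/
noncomputable def knnLogVol {d N : ℕ} (k : ℕ) (y : Fin N → EuclideanSpace ℝ (Fin d))
    (i : Fin N) : ℝ :=
  Real.log (((N : ℝ) - 1) * Real.pi ^ ((d : ℝ) / 2) * knnDist k y i ^ d /
    ((k : ℝ) * Real.Gamma ((d : ℝ) / 2 + 1)))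

/-- The `k`-nearest-neighbour Bayesian nonparametric prior of the entropy, for weights `w` and
atoms `y`: `∑ w_i T_i - L_{k-1} + γ + log k` with `L_j = ∑_{r=1}^j 1/r`. -/
noncomputable def priorEntropy {d N : ℕ} (k : ℕ) (w : Fin N → ℝ)
    (y : Fin N → EuclideanSpace ℝ (Fin d)) : ℝ :=
  ∑ i, w i * knnLogVol k y i - (harmonic (k - 1) : ℝ) + Real.eulerMascheroniConstant
    + Real.log k

/-! Write `T i` for `knnLogVol k y i`. The weights are independent of the points, sum to one and
satisfy `∑ E[J i ^ 2] = (a / N + 1) / (a + 1)`, while the `T i` are exchangeable. So the weighted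
sum has mean `E[T 0]`, and its second moment is the average of `E[T 0 ^ 2]` and `E[T 0 * T 1]` with
that number and its complement as coefficients (`integral_sq_sum_weight_mul`). Everything reduces to
the limits of these three moments.

Limit in law: `s < T 0` means that fewer than `k` other points lie in the ball of volume `k * exp s
/ (N - 1)` around `Y 0`. By Lebesgue differentiation the expected count tends to `k * exp s * g (Y
0)`, the count becomes Poisson, and the Poisson-gamma duality identifies the limit as `log (Z / (k *
g Y))` with `Z` of law gamma(k, 1) independent of `Y`. Balls around two distinct centres are
eventually disjoint, so `T 0` and `T 1` become independent (`tendsto_pi_lt_knnLogVol_and`).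

From law to moments: `pi_tail_le_tailMeasure` dominates the tails of every `T i`, for every `N`, by
one finite measure with as many moments as the logarithmic hypotheses allow. For the lower tail, a
very close neighbour needs a high density at the centre or is improbable. For the upper tail,
isolated points in a bounded region are few by a grid argument, and for huge levels the point or
most of the sample must be far out. A layer-cake formula and dominated convergence then give the
moments (`tendsto_integral_of_tail`, `tendsto_integral_mul_of_tail`).

Constants: `E[log Z] = L_{k-1} - γ` (`integral_log_gammaMeasure`) and `Var[log Z] = Q_k`
(`variance_log_gammaMeasure`). If `V` and `m` are the limit variance and mean, the variance of the
prior tends to `(V + m²) / (a + 1) + (a / (a + 1)) * m² - m² = V / (a + 1)`. -/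

/-- The number of points `y j`, `j ≠ i`, within distance `r` of `y i`. -/
noncomputable def nearCount {d N : ℕ} (y : Fin N → EuclideanSpace ℝ (Fin d)) (i : Fin N) (r : ℝ) :
    ℕ :=
  (Finset.univ.filter fun j => j ≠ i ∧ dist (y j) (y i) ≤ r).card

/-! ### Nearest-neighbour distances expressed through counts of points in balls. -/

section KNN

variable {d N k : ℕ}

lemma nearCount_mono (y : Fin N → EuclideanSpace ℝ (Fin d)) (i : Fin N) :
    Monotone (nearCount y i) := fun r s hrs => by
  refine Finset.card_le_card fun j hj => ?_
  simp only [Finset.mem_filter, Finset.mem_univ, true_and] at hj ⊢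
  exact ⟨hj.1, hj.2.trans hrs⟩

/-- A union, over the finitely many possible sets of neighbours, of closed half-lines. Closedness
makes the infimum in `knnDist` attained, so comparisons of `knnDist` with a radius become
comparisons of `nearCount` with `k`. -/
lemma isClosed_setOf_le_nearCount (y : Fin N → EuclideanSpace ℝ (Fin d)) (i : Fin N) (k : ℕ) :
    IsClosed {r : ℝ | k ≤ nearCount y i r} := by
  have h : {r : ℝ | k ≤ nearCount y i r} =
      ⋃ A ∈ (Finset.univ.filter fun A : Finset (Fin N) => i ∉ A ∧ k ≤ A.card),
        ⋂ j ∈ A, Set.Ici (dist (y j) (y i)) := by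
    ext r
    simp only [Set.mem_ofPred_eq, Finset.mem_filter, Finset.mem_univ, true_and, Set.mem_iUnion,
      Set.mem_iInter, Set.mem_Ici, exists_prop]
    constructor
    · intro h
      exact ⟨_, ⟨by simp, h⟩, fun j hj => (Finset.mem_filter.1 hj).2.2⟩
    · rintro ⟨A, ⟨hi, hA⟩, h⟩
      refine hA.trans (Finset.card_le_card fun j hj => ?_)
      simp only [Finset.mem_filter, Finset.mem_univ, true_and]
      exact ⟨fun hji => hi (hji ▸ hj), h j hj⟩
  rw [h]
  exact Set.Finite.isClosed_biUnion (Finset.finite_toSet _)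
    fun A _ => isClosed_biInter fun j _ => isClosed_Ici

lemma nearCount_of_neg (y : Fin N → EuclideanSpace ℝ (Fin d)) (i : Fin N) {r : ℝ} (hr : r < 0) :
    nearCount y i r = 0 := by
  rw [nearCount, Finset.card_eq_zero, Finset.filter_eq_empty_iff]
  rintro j - ⟨-, h⟩
  exact absurd (dist_nonneg.trans h) (not_le.2 hr)

lemma exists_le_nearCount (hkN : k + 1 ≤ N) (y : Fin N → EuclideanSpace ℝ (Fin d)) (i : Fin N) :
    ∃ r, k ≤ nearCount y i r := by
  refine ⟨∑ j, dist (y j) (y i), ?_⟩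
  have h : (Finset.univ.filter fun j => j ≠ i ∧ dist (y j) (y i) ≤ ∑ j, dist (y j) (y i)) =
      Finset.univ.erase i := by
    ext j
    simp only [Finset.mem_filter, Finset.mem_univ, true_and, Finset.mem_erase, and_true,
      and_iff_left_iff_imp]
    exact fun _ => Finset.single_le_sum (f := fun j => dist (y j) (y i))
      (fun _ _ => dist_nonneg) (Finset.mem_univ j)
  rw [nearCount, h, Finset.card_erase_of_mem (Finset.mem_univ _), Finset.card_univ,
    Fintype.card_fin]
  omega

lemma knnDist_le_iff (hk : 1 ≤ k) (hkN : k + 1 ≤ N) (y : Fin N → EuclideanSpace ℝ (Fin d))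
    (i : Fin N) (r : ℝ) : knnDist k y i ≤ r ↔ k ≤ nearCount y i r := by
  have hne : {r : ℝ | k ≤ nearCount y i r}.Nonempty := exists_le_nearCount hkN y i
  have hbdd : BddBelow {r : ℝ | k ≤ nearCount y i r} := by
    refine ⟨0, fun r hr => ?_⟩
    by_contra! h
    have : k ≤ nearCount y i r := hr
    rw [nearCount_of_neg y i h] at this
    omega
  have hmem : k ≤ nearCount y i (knnDist k y i) :=
    (isClosed_setOf_le_nearCount y i k).csInf_mem hne hbdd
  exact ⟨fun h => hmem.trans (nearCount_mono y i h), fun h => csInf_le hbdd h⟩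

lemma lt_knnDist_iff (hk : 1 ≤ k) (hkN : k + 1 ≤ N) (y : Fin N → EuclideanSpace ℝ (Fin d))
    (i : Fin N) (r : ℝ) : r < knnDist k y i ↔ nearCount y i r < k := by
  rw [← not_le, knnDist_le_iff hk hkN, not_le]

lemma knnDist_nonneg (hk : 1 ≤ k) (hkN : k + 1 ≤ N) (y : Fin N → EuclideanSpace ℝ (Fin d))
    (i : Fin N) : 0 ≤ knnDist k y i := by
  by_contra! h
  have := (knnDist_le_iff hk hkN y i (knnDist k y i)).1 le_rfl
  rw [nearCount_of_neg y i h] at this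
  omega

lemma nearCount_eq_sum (y : Fin N → EuclideanSpace ℝ (Fin d)) (i : Fin N) (r : ℝ) :
    nearCount y i r = ∑ j, if j ≠ i ∧ dist (y j) (y i) ≤ r then 1 else 0 := by
  rw [nearCount, Finset.card_filter]

lemma measurable_nearCount (i : Fin N) (r : ℝ) :
    Measurable fun y : Fin N → EuclideanSpace ℝ (Fin d) => nearCount y i r := by
  simp only [nearCount_eq_sum]
  refine Finset.measurable_sum _ fun j _ => Measurable.ite ?_ measurable_const measurable_const
  by_cases h : j = i
  · simp [h]
  · simp only [ne_eq, h, not_false_eq_true, true_and]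
    exact measurableSet_le (by fun_prop) measurable_const

lemma measurable_knnDist (hk : 1 ≤ k) (hkN : k + 1 ≤ N) (i : Fin N) :
    Measurable fun y : Fin N → EuclideanSpace ℝ (Fin d) => knnDist k y i := by
  refine measurable_of_Iic fun r => ?_
  have : (fun y : Fin N → EuclideanSpace ℝ (Fin d) => knnDist k y i) ⁻¹' Set.Iic r =
      (fun y => nearCount y i r) ⁻¹' Set.Ici k := by
    ext y
    simp [knnDist_le_iff hk hkN]
  rw [this]
  exact measurable_nearCount i r measurableSet_Ici

lemma measurable_knnLogVol (hk : 1 ≤ k) (hkN : k + 1 ≤ N) (i : Fin N) :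
    Measurable fun y : Fin N → EuclideanSpace ℝ (Fin d) => knnLogVol k y i := by
  have := measurable_knnDist (d := d) hk hkN i
  unfold knnLogVol
  fun_prop

/-- The volume of the Euclidean unit ball in dimension `d`. -/
noncomputable def unitBallVol (d : ℕ) : ℝ :=
  Real.pi ^ ((d : ℝ) / 2) / Real.Gamma ((d : ℝ) / 2 + 1)

lemma unitBallVol_pos (d : ℕ) : 0 < unitBallVol d :=
  div_pos (Real.rpow_pos_of_pos Real.pi_pos _) (Real.Gamma_pos_of_pos (by positivity))

/-- The radius of a ball of volume `k * exp s / (N - 1)`. -/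
noncomputable def knnRadius (d k N : ℕ) (s : ℝ) : ℝ :=
  (k * Real.exp s / (((N : ℝ) - 1) * unitBallVol d)) ^ ((d : ℝ)⁻¹)

lemma cast_sub_one_pos (hk : 1 ≤ k) (hkN : k + 1 ≤ N) : (0 : ℝ) < (N : ℝ) - 1 := by
  have : (2 : ℝ) ≤ N := by exact_mod_cast (by omega : 2 ≤ N)
  linarith

lemma knnRadius_pos (hk : 1 ≤ k) (hkN : k + 1 ≤ N) (s : ℝ) : 0 < knnRadius d k N s := by
  have := cast_sub_one_pos hk hkN
  have := unitBallVol_pos d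
  have : (0 : ℝ) < k := by exact_mod_cast hk
  exact Real.rpow_pos_of_pos (by positivity) _

lemma knnRadius_pow (hd : 1 ≤ d) (hk : 1 ≤ k) (hkN : k + 1 ≤ N) (s : ℝ) :
    knnRadius d k N s ^ d = k * Real.exp s / (((N : ℝ) - 1) * unitBallVol d) := by
  have := cast_sub_one_pos hk hkN
  have := unitBallVol_pos d
  have : (0 : ℝ) < k := by exact_mod_cast hk
  exact Real.rpow_inv_natCast_pow (by positivity) (by omega)

lemma volume_closedBall_knnRadius (hd : 1 ≤ d) (hk : 1 ≤ k) (hkN : k + 1 ≤ N) (s : ℝ)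
    (x : EuclideanSpace ℝ (Fin d)) :
    volume (Metric.closedBall x (knnRadius d k N s)) =
      ENNReal.ofReal (k * Real.exp s / ((N : ℝ) - 1)) := by
  have : Nonempty (Fin d) := ⟨⟨0, hd⟩⟩
  have h1 := cast_sub_one_pos hk hkN
  have h2 := unitBallVol_pos d
  have h3 : √Real.pi ^ d = Real.pi ^ ((d : ℝ) / 2) := by
    rw [Real.sqrt_eq_rpow, ← Real.rpow_natCast, ← Real.rpow_mul Real.pi_pos.le]
    congr 1
    ring
  rw [EuclideanSpace.volume_closedBall, Fintype.card_fin,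
    ← ENNReal.ofReal_pow (knnRadius_pos hk hkN s).le, knnRadius_pow hd hk hkN, h3,
    ← ENNReal.ofReal_mul (by positivity)]
  change ENNReal.ofReal (_ * unitBallVol d) = _
  congr 1
  field_simp

/-- All probabilistic estimates start from this translation to counts. A positive distance is
required because `Real.log 0 = 0` would give tied points the wrong sign; ties are null when `G` has
a density. -/
lemma lt_knnLogVol_iff (hd : 1 ≤ d) (hk : 1 ≤ k) (hkN : k + 1 ≤ N)
    {y : Fin N → EuclideanSpace ℝ (Fin d)} {i : Fin N} (hR : 0 < knnDist k y i) (s : ℝ) :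
    s < knnLogVol k y i ↔ nearCount y i (knnRadius d k N s) < k := by
  have h1 := cast_sub_one_pos hk hkN
  have h2 := unitBallVol_pos d
  have h3 : (0 : ℝ) < k := by exact_mod_cast hk
  have hT : knnLogVol k y i =
      Real.log (knnDist k y i ^ d / (k / (((N : ℝ) - 1) * unitBallVol d))) := by
    rw [knnLogVol, unitBallVol]
    have : 0 < Real.Gamma ((d : ℝ) / 2 + 1) := Real.Gamma_pos_of_pos (by positivity)
    congr 1
    field_simp
  rw [← lt_knnDist_iff hk hkN, hT, Real.lt_log_iff_exp_lt (by positivity), lt_div_iff₀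
    (by positivity), ← pow_lt_pow_iff_left₀ (knnRadius_pos hk hkN s).le hR.le (by omega : d ≠ 0),
    knnRadius_pow hd hk hkN]
  apply iff_of_eq
  congr 1
  ring

lemma exists_eq_of_knnDist_eq_zero (hk : 1 ≤ k) (hkN : k + 1 ≤ N)
    {y : Fin N → EuclideanSpace ℝ (Fin d)} {i : Fin N} (hR : knnDist k y i = 0) :
    ∃ j, j ≠ i ∧ y j = y i := by
  have h := (knnDist_le_iff hk hkN y i 0).1 hR.le
  obtain ⟨j, hj⟩ := Finset.card_pos.1 (show 0 < _ from lt_of_lt_of_le hk h)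
  simp only [Finset.mem_filter, Finset.mem_univ, true_and] at hj
  exact ⟨j, hj.1, dist_le_zero.1 hj.2⟩

lemma nearCount_comp_perm (y : Fin N → EuclideanSpace ℝ (Fin d)) (σ : Equiv.Perm (Fin N))
    (i : Fin N) (r : ℝ) : nearCount (fun j => y (σ j)) i r = nearCount y (σ i) r := by
  rw [nearCount, nearCount]
  refine Finset.card_bij (fun j _ => σ j) ?_ (fun a _ b _ h => σ.injective h) ?_
  · intro j hj
    simpa using hj
  · intro j hj
    exact ⟨σ.symm j, by simpa [Equiv.symm_apply_eq] using hj, by simp⟩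

lemma knnLogVol_comp_perm (y : Fin N → EuclideanSpace ℝ (Fin d)) (σ : Equiv.Perm (Fin N))
    (i : Fin N) : knnLogVol k (fun j => y (σ j)) i = knnLogVol k y (σ i) := by
  have : knnDist k (fun j => y (σ j)) i = knnDist k y (σ i) := by
    change sInf {r | k ≤ nearCount (fun j => y (σ j)) i r} = sInf {r | k ≤ nearCount y (σ i) r}
    simp only [nearCount_comp_perm]
  rw [knnLogVol, knnLogVol, this]

end KNN

/-! ### Symmetry and two-coordinate marginals of the product law. -/

section ProductLaw

variable {E : Type*} [MeasurableSpace E] {N : ℕ} (G : Measure E) [IsProbabilityMeasure G]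

lemma measurePreserving_pi_perm (σ : Equiv.Perm (Fin N)) :
    MeasurePreserving (fun (y : Fin N → E) j => y (σ j)) (Measure.pi fun _ => G)
      (Measure.pi fun _ => G) := by
  have hm : Measurable fun (y : Fin N → E) j => y (σ j) := by fun_prop
  refine ⟨hm, (Measure.pi_eq fun s hs => ?_).symm⟩
  rw [Measure.map_apply hm (MeasurableSet.univ_pi hs)]
  have : (fun (y : Fin N → E) j => y (σ j)) ⁻¹' Set.univ.pi s =
      Set.univ.pi fun j => s (σ.symm j) := by
    ext y
    simp only [Set.mem_preimage, Set.mem_pi, Set.mem_univ, true_implies]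
    exact ⟨fun h j => by simpa using h (σ.symm j), fun h j => by simpa using h (σ j)⟩
  rw [this, Measure.pi_pi]
  exact Equiv.prod_comp σ.symm fun j => G (s j)

lemma measurePreserving_pi_pair {i j : Fin N} (hij : i ≠ j) :
    MeasurePreserving (fun y : Fin N → E => (y i, y j)) (Measure.pi fun _ => G) (G.prod G) := by
  refine ⟨by fun_prop, ?_⟩
  have h := (iIndepFun_pi (μ := fun _ : Fin N => G) (X := fun _ x => x)
    fun _ => aemeasurable_id).indepFun hij
  rw [indepFun_iff_map_prod_eq_prod_map_map (measurable_pi_apply i).aemeasurable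
    (measurable_pi_apply j).aemeasurable] at h
  have he : ∀ l : Fin N, (Measure.pi fun _ : Fin N => G).map (fun y => y l) = G := fun l =>
    (measurePreserving_eval (fun _ : Fin N => G) l).map_eq
  rw [h, he, he]

lemma pi_apply_eval (i : Fin N) {s : Set E} (hs : MeasurableSet s) :
    (Measure.pi fun _ : Fin N => G) {y | y i ∈ s} = G s :=
  (measurePreserving_eval (fun _ : Fin N => G) i).measure_preimage hs.nullMeasurableSet

end ProductLaw

/-! ### Tail bounds for the statistic, uniform in the sample size. -/

section Tails

lemma measurable_pdfOf {d : ℕ} (G : Measure (EuclideanSpace ℝ (Fin d))) :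
    Measurable (pdfOf G) :=
  (Measure.measurable_rnDeriv G volume).ennreal_toReal

variable {d N k : ℕ} (G : Measure (EuclideanSpace ℝ (Fin d))) [IsProbabilityMeasure G]

lemma ae_knnDist_pos (hd : 1 ≤ d) (hk : 1 ≤ k) (hkN : k + 1 ≤ N) (hG : G ≪ volume) (i : Fin N) :
    ∀ᵐ y ∂(Measure.pi fun _ : Fin N => G), 0 < knnDist k y i := by
  have : Nonempty (Fin d) := ⟨⟨0, hd⟩⟩
  have hne : ∀ j : Fin N, j ≠ i → ∀ᵐ y ∂(Measure.pi fun _ : Fin N => G), y j ≠ y i := by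
    intro j hj
    have hdiag : MeasurableSet {p : EuclideanSpace ℝ (Fin d) × EuclideanSpace ℝ (Fin d) |
        p.1 = p.2} := measurableSet_eq_fun measurable_fst measurable_snd
    have h0 : (G.prod G) {p | p.1 = p.2} = 0 := by
      rw [Measure.prod_apply hdiag]
      have : ∀ x, G (Prod.mk x ⁻¹' {p | p.1 = p.2}) = 0 := by
        intro x
        refine hG ?_
        have : Prod.mk x ⁻¹' {p : EuclideanSpace ℝ (Fin d) × EuclideanSpace ℝ (Fin d) |
          p.1 = p.2} = {x} := by
          ext z
          simp [eq_comm]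
        rw [this, measure_singleton]
      rw [lintegral_congr this, lintegral_zero]
    have h1 := (measurePreserving_pi_pair G hj).measure_preimage hdiag.nullMeasurableSet
    rw [h0] at h1
    exact measure_mono_null (fun y hy => by simpa using hy) h1
  have hall : ∀ᵐ y ∂(Measure.pi fun _ : Fin N => G), ∀ j, j ≠ i → y j ≠ y i := by
    rw [ae_all_iff]
    intro j
    by_cases hj : j = i
    · simp [hj]
    · filter_upwards [hne j hj] with y hy _ using hy
  filter_upwards [hall] with y hy
  refine lt_of_le_of_ne (knnDist_nonneg hk hkN y i) fun h => ?_
  obtain ⟨j, hj, hji⟩ := exists_eq_of_knnDist_eq_zero hk hkN h.symm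
  exact hy j hj hji

lemma measure_inter_le_of_log_pdf_le (hG : G ≪ volume) {A : Set (EuclideanSpace ℝ (Fin d))}
    {c : ℝ} (hA : ∀ x ∈ A, Real.log (pdfOf G x) ≤ c)
    (B : Set (EuclideanSpace ℝ (Fin d))) :
    G (A ∩ B) ≤ ENNReal.ofReal (Real.exp c) * volume B := by
  rw [← Measure.setLIntegral_rnDeriv hG]
  calc ∫⁻ x in A ∩ B, G.rnDeriv volume x
      ≤ ∫⁻ _ in A ∩ B, ENNReal.ofReal (Real.exp c) := by
        refine setLIntegral_mono_ae aemeasurable_const ?_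
        filter_upwards [Measure.rnDeriv_lt_top G volume] with x hx hxA
        rw [← ENNReal.ofReal_toReal hx.ne]
        refine ENNReal.ofReal_le_ofReal ?_
        have h := hA x hxA.1
        -- The bound on the logarithm is informative only where the density is positive; a zero
        -- density is below `exp c` anyway.
        rcases (ENNReal.toReal_nonneg (a := G.rnDeriv volume x)).eq_or_lt with h0 | h0
        · rw [← h0]
          exact (Real.exp_pos c).le
        · exact (Real.log_le_iff_le_exp h0).1 h
    _ ≤ _ := by
        rw [setLIntegral_const]
        gcongr
        exact Set.inter_subset_right

/-- If the statistic is below `-t`, some neighbour lies in a ball of volume `k * exp (-t) / (N -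
1)`. Where the density at the centre is at most `exp (t / 2)`, each neighbour does so with
probability at most `k * exp (-t / 2) / (N - 1)`, and there are `N - 1` of them. -/
lemma knnLogVol_lower_tail (hd : 1 ≤ d) (hk : 1 ≤ k) (hkN : k + 1 ≤ N) (hG : G ≪ volume)
    (i : Fin N) (t : ℝ) :
    (Measure.pi fun _ : Fin N => G) {y | knnLogVol k y i ≤ -t} ≤
      G {x | t / 2 < Real.log (pdfOf G x)} + ENNReal.ofReal (k * Real.exp (-t / 2)) := by
  have hN := cast_sub_one_pos hk hkN
  set ρ := knnRadius d k N (-t) with hρ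
  set A := {x | t / 2 < Real.log (pdfOf G x)} with hA
  have hAm : MeasurableSet A := measurableSet_lt measurable_const (measurable_pdfOf G).log
  have hpair : ∀ j : Fin N, j ≠ i →
      (Measure.pi fun _ : Fin N => G) {y | y i ∉ A ∧ dist (y j) (y i) ≤ ρ} ≤
        ENNReal.ofReal (k * Real.exp (-t / 2) / ((N : ℝ) - 1)) := by
    intro j hj
    have hS : MeasurableSet {p : EuclideanSpace ℝ (Fin d) × EuclideanSpace ℝ (Fin d) |
        p.1 ∉ A ∧ dist p.2 p.1 ≤ ρ} :=
      (measurable_fst hAm.compl).inter (measurableSet_le (measurable_snd.dist measurable_fst)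
        measurable_const)
    have h1 := (measurePreserving_pi_pair G hj.symm).measure_preimage hS.nullMeasurableSet
    refine (le_of_eq h1).trans ?_
    -- The neighbour is fixed and the centre integrated out, so that the density has to be bounded
    -- only at centres outside `A`; no maximal function is needed.
    rw [Measure.prod_apply_symm hS]
    calc _ ≤ ∫⁻ _, ENNReal.ofReal (k * Real.exp (-t / 2) / ((N : ℝ) - 1)) ∂G := by
          refine lintegral_mono fun z => ?_
          have hset : (fun x => (x, z)) ⁻¹' {p : EuclideanSpace ℝ (Fin d) ×
              EuclideanSpace ℝ (Fin d) | p.1 ∉ A ∧ dist p.2 p.1 ≤ ρ} =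
              Aᶜ ∩ Metric.closedBall z ρ := by
            ext x
            simp [dist_comm]
          rw [hset]
          refine (measure_inter_le_of_log_pdf_le G hG (c := t / 2)
            (fun x hx => not_lt.1 hx) _).trans (le_of_eq ?_)
          rw [hρ, volume_closedBall_knnRadius hd hk hkN, ← ENNReal.ofReal_mul (Real.exp_pos _).le]
          congr 1
          rw [show Real.exp (-t / 2) = Real.exp (t / 2) * Real.exp (-t) by
            rw [← Real.exp_add]; ring_nf]
          ring
      _ = _ := by simp
  calc (Measure.pi fun _ : Fin N => G) {y | knnLogVol k y i ≤ -t}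
      ≤ (Measure.pi fun _ : Fin N => G) ({y | y i ∈ A} ∪
          ⋃ j ∈ Finset.univ.erase i, {y | y i ∉ A ∧ dist (y j) (y i) ≤ ρ}) := by
        refine measure_mono_ae ?_
        filter_upwards [ae_knnDist_pos G hd hk hkN hG i] with y hy hT
        have hT' : knnLogVol k y i ≤ -t := hT
        have h := (lt_knnLogVol_iff hd hk hkN hy (-t)).not.1 (not_lt.2 hT')
        obtain ⟨j, hj⟩ := Finset.card_pos.1 (show 0 < _ from lt_of_lt_of_le hk (not_lt.1 h))
        simp only [Finset.mem_filter, Finset.mem_univ, true_and] at hj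
        by_cases hyA : y i ∈ A
        · exact Or.inl hyA
        · refine Or.inr (Set.mem_biUnion (x := j) (by simp [hj.1]) ⟨hyA, hj.2⟩)
    _ ≤ G A + ∑ j ∈ Finset.univ.erase i,
          ENNReal.ofReal (k * Real.exp (-t / 2) / ((N : ℝ) - 1)) := by
        refine (measure_union_le _ _).trans ?_
        rw [pi_apply_eval G i hAm]
        gcongr
        refine (measure_biUnion_finset_le _ _).trans (Finset.sum_le_sum fun j hj => ?_)
        exact hpair j (Finset.ne_of_mem_erase hj)
    _ = _ := by
        rw [Finset.sum_const, Finset.card_erase_of_mem (Finset.mem_univ _), Finset.card_univ,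
          Fintype.card_fin, nsmul_eq_mul, ← ENNReal.ofReal_natCast, ← ENNReal.ofReal_mul
          (by positivity), Nat.cast_sub (by omega), Nat.cast_one]
        congr 2
        field_simp

lemma pi_lt_knnLogVol_eq (i j : Fin N) (t : ℝ) (hk : 1 ≤ k) (hkN : k + 1 ≤ N) :
    (Measure.pi fun _ : Fin N => G) {y | t < knnLogVol k y i} =
      (Measure.pi fun _ : Fin N => G) {y | t < knnLogVol k y j} := by
  have h := (measurePreserving_pi_perm G (Equiv.swap i j)).measure_preimage
    (measurableSet_lt measurable_const (measurable_knnLogVol (k := k) hk hkN i)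
      (f := fun _ => t)).nullMeasurableSet
  rw [← h]
  congr 1
  ext y
  simp [knnLogVol_comp_perm]

/-- Grid argument: cells of side `ρ / √d` have diameter at most `ρ`, so all points of a cell are
neighbours of each other. A cell containing a point with fewer than `k` neighbours thus holds at
most `k` points, and the number of cells meeting the ball of radius `A` is bounded. -/
lemma card_near_lt_le (y : Fin N → EuclideanSpace ℝ (Fin d)) {A ρ : ℝ} (hρ : 0 < ρ)
    (hd : 1 ≤ d) :
    (Finset.univ.filter fun i => nearCount y i ρ < k ∧ ‖y i‖ ≤ A).card ≤
      k * (2 * ⌈A * √d / ρ⌉₊ + 1) ^ d := by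
  set m := ⌈A * √d / ρ⌉₊ with hm
  set S := Finset.univ.filter fun i => nearCount y i ρ < k ∧ ‖y i‖ ≤ A with hS
  let cell : Fin N → Fin d → ℤ := fun i l => ⌊y i l * √d / ρ⌋
  have hd0 : (0 : ℝ) < d := by exact_mod_cast hd
  have hsd : 0 < √(d : ℝ) := Real.sqrt_pos.2 hd0
  have hfib : ∀ b ∈ S.image cell, (S.filter fun i => cell i = b).card ≤ k := by
    intro b hb
    obtain ⟨i, hi, rfl⟩ := Finset.mem_image.1 hb
    have hi' : nearCount y i ρ < k := (Finset.mem_filter.1 hi).2.1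
    have hsub : (S.filter fun j => cell j = cell i) ⊆
        insert i (Finset.univ.filter fun j => j ≠ i ∧ dist (y j) (y i) ≤ ρ) := by
      intro j hj
      have hj' : cell j = cell i := (Finset.mem_filter.1 hj).2
      by_cases hji : j = i
      · simp [hji]
      · refine Finset.mem_insert_of_mem ?_
        simp only [Finset.mem_filter, Finset.mem_univ, true_and]
        refine ⟨hji, ?_⟩
        rw [EuclideanSpace.dist_eq]
        refine Real.sqrt_le_iff.2 ⟨hρ.le, ?_⟩
        have hcoord : ∀ l, dist (y j l) (y i l) ^ 2 ≤ ρ ^ 2 / d := by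
          intro l
          have h1 : |y j l * √d / ρ - y i l * √d / ρ| < 1 :=
            Int.abs_sub_lt_one_of_floor_eq_floor (congrFun hj' l)
          rw [show y j l * √d / ρ - y i l * √d / ρ = (y j l - y i l) * (√d / ρ) by ring, abs_mul,
            abs_of_pos (div_pos hsd hρ)] at h1
          rw [Real.dist_eq]
          have h2 : |y j l - y i l| ≤ ρ / √d := by
            rw [le_div_iff₀ hsd]
            have := mul_le_mul_of_nonneg_right h1.le hρ.le
            rw [mul_assoc, div_mul_cancel₀ _ hρ.ne'] at this
            linarith
          calc |y j l - y i l| ^ 2 ≤ (ρ / √d) ^ 2 := by gcongr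
            _ = ρ ^ 2 / d := by rw [div_pow, Real.sq_sqrt hd0.le]
        calc ∑ l, dist (y j l) (y i l) ^ 2 ≤ ∑ _l : Fin d, ρ ^ 2 / d :=
              Finset.sum_le_sum fun l _ => hcoord l
          _ = ρ ^ 2 := by
              rw [Finset.sum_const, Finset.card_univ, Fintype.card_fin, nsmul_eq_mul]
              field_simp
    refine (Finset.card_le_card hsub).trans ((Finset.card_insert_le _ _).trans ?_)
    exact hi'
  refine (Finset.card_le_mul_card_image S k hfib).trans (Nat.mul_le_mul_left k ?_)
  have himg : S.image cell ⊆ Fintype.piFinset fun _ : Fin d => Finset.Icc (-(m : ℤ)) m := by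
    intro b hb
    obtain ⟨i, hi, rfl⟩ := Finset.mem_image.1 hb
    have hiA : ‖y i‖ ≤ A := (Finset.mem_filter.1 hi).2.2
    rw [Fintype.mem_piFinset]
    intro l
    have hl : |y i l| ≤ A := by
      have := (PiLp.norm_apply_le (y i) l).trans hiA
      rwa [Real.norm_eq_abs] at this
    have hle : |y i l * √d / ρ| ≤ m := by
      rw [abs_div, abs_mul, abs_of_pos hsd, abs_of_pos hρ]
      refine le_trans ?_ (Nat.le_ceil _)
      gcongr
    rw [abs_le] at hle
    rw [Finset.mem_Icc]
    constructor
    · rw [Int.le_floor]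
      push_cast
      exact hle.1
    · have : (cell i l : ℝ) ≤ m := (Int.floor_le _).trans hle.2
      exact_mod_cast this
  refine (Finset.card_le_card himg).trans (le_of_eq ?_)
  rw [Fintype.card_piFinset]
  simp only [Int.card_Icc, Finset.prod_const, Finset.card_univ, Fintype.card_fin]
  congr 1
  omega

/-- By exchangeability the left side is the expected number of indices whose statistic exceeds `t`.
Those with centre outside the ball of radius `A` give the first term; the others obey the
deterministic count of `card_near_lt_le`. -/
lemma natCast_mul_pi_lt_knnLogVol_le (hd : 1 ≤ d) (hk : 1 ≤ k) (hkN : k + 1 ≤ N)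
    (hG : G ≪ volume) (i : Fin N) (t A : ℝ) :
    N * (Measure.pi fun _ : Fin N => G) {y | t < knnLogVol k y i} ≤
      N * G {x | A < ‖x‖} +
        ((k * (2 * ⌈A * √d / knnRadius d k N t⌉₊ + 1) ^ d : ℕ) : ENNReal) := by
  set ρ := knnRadius d k N t with hρ
  have hball : MeasurableSet {x : EuclideanSpace ℝ (Fin d) | A < ‖x‖} :=
    measurableSet_lt measurable_const measurable_norm
  have hbad : ∀ j : Fin N, MeasurableSet {y : Fin N → EuclideanSpace ℝ (Fin d) |
      nearCount y j ρ < k ∧ ‖y j‖ ≤ A} := fun j =>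
    (measurableSet_lt (measurable_nearCount j ρ) measurable_const).inter
      (measurableSet_le (measurable_pi_apply j).norm measurable_const)
  have hone : ∀ j : Fin N, (Measure.pi fun _ : Fin N => G) {y | t < knnLogVol k y i} ≤
      G {x | A < ‖x‖} + (Measure.pi fun _ : Fin N => G)
        {y | nearCount y j ρ < k ∧ ‖y j‖ ≤ A} := by
    intro j
    rw [pi_lt_knnLogVol_eq G i j t hk hkN, ← pi_apply_eval G j hball]
    refine le_trans (measure_mono_ae ?_) (measure_union_le _ _)
    filter_upwards [ae_knnDist_pos G hd hk hkN hG j] with y hy hT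
    have h := (lt_knnLogVol_iff hd hk hkN hy t).1 hT
    by_cases hyA : A < ‖y j‖
    · exact Or.inl hyA
    · exact Or.inr ⟨h, not_lt.1 hyA⟩
  have hsum := Finset.sum_le_sum fun j (_ : j ∈ Finset.univ) => hone j
  rw [Finset.sum_const, Finset.sum_add_distrib, Finset.sum_const, Finset.card_univ,
    Fintype.card_fin, nsmul_eq_mul, nsmul_eq_mul] at hsum
  refine hsum.trans ?_
  gcongr
  calc ∑ j, (Measure.pi fun _ : Fin N => G) {y | nearCount y j ρ < k ∧ ‖y j‖ ≤ A}
      = ∫⁻ y, ∑ j, {y | nearCount y j ρ < k ∧ ‖y j‖ ≤ A}.indicator 1 y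
          ∂(Measure.pi fun _ : Fin N => G) := by
        rw [lintegral_finsetSum _ fun j _ => measurable_one.indicator (hbad j)]
        simp_rw [lintegral_indicator_one (hbad _)]
    _ ≤ ∫⁻ _, ((k * (2 * ⌈A * √d / ρ⌉₊ + 1) ^ d : ℕ) : ENNReal)
          ∂(Measure.pi fun _ : Fin N => G) := by
        refine lintegral_mono fun y => ?_
        have h := card_near_lt_le (k := k) y (A := A) (knnRadius_pos (d := d) hk hkN t) hd
        refine le_trans (le_of_eq ?_) (Nat.cast_le.2 h)
        rw [Finset.card_filter]
        push_cast
        refine Finset.sum_congr rfl fun j _ => ?_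
        simp only [Set.indicator_apply, Set.mem_ofPred_eq, Pi.one_apply]
        rfl
    _ = _ := by simp

lemma knnLogVol_upper_tail_of_le (hd : 1 ≤ d) (hk : 1 ≤ k) (hkN : k + 1 ≤ N)
    (hG : G ≪ volume) (i : Fin N) {t : ℝ} (htN : Real.exp (t / 2) ≤ N) :
    (Measure.pi fun _ : Fin N => G) {y | t < knnLogVol k y i} ≤
      G {x | Real.exp (t / (2 * d)) < ‖x‖} +
        ENNReal.ofReal (2 ^ (d - 1) * ((2 * √d) ^ d * unitBallVol d + k * 3 ^ d) *
          Real.exp (-t / 2)) := by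
  have hN1 := cast_sub_one_pos hk hkN
  have hN0 : (0 : ℝ) < N := by linarith
  have hk0 : (0 : ℝ) < k := by exact_mod_cast hk
  have hd0 : (0 : ℝ) < d := by exact_mod_cast hd
  have hv := unitBallVol_pos d
  have hρ := knnRadius_pos (d := d) hk hkN t
  set ρ := knnRadius d k N t with hρdef
  -- With this radius `A ^ d = exp (t / 2)`, while `ρ ^ d` is of order `exp t / N`; the number of
  -- cells is then of order `N * exp (-t / 2)` plus a constant.
  set A := Real.exp (t / (2 * d)) with hA
  have hA0 : 0 < A := Real.exp_pos _
  have hAd : A ^ d = Real.exp (t / 2) := by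
    rw [hA, ← Real.exp_nat_mul]
    congr 1
    field_simp
  have hexp : Real.exp (t / 2) * Real.exp (-t / 2) = 1 := by
    rw [← Real.exp_add]
    simp [neg_div]
  have hee : Real.exp t = Real.exp (t / 2) * Real.exp (t / 2) := by
    rw [← Real.exp_add]
    ring_nf
  have hcard : (((k * (2 * ⌈A * √d / ρ⌉₊ + 1) ^ d : ℕ) : ℝ)) ≤
      N * (2 ^ (d - 1) * ((2 * √d) ^ d * unitBallVol d + k * 3 ^ d) * Real.exp (-t / 2)) := by
    have h1 : (2 * (⌈A * √d / ρ⌉₊ : ℝ) + 1) ≤ 2 * √d * (A / ρ) + 3 := by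
      have := (Nat.ceil_lt_add_one (a := A * √d / ρ) (by positivity)).le
      calc 2 * (⌈A * √d / ρ⌉₊ : ℝ) + 1 ≤ 2 * (A * √d / ρ + 1) + 1 := by gcongr
        _ = _ := by ring
    have h2 : (A / ρ) ^ d ≤ N * unitBallVol d * Real.exp (-t / 2) / k := by
      rw [div_pow, hAd, hρdef, knnRadius_pow hd hk hkN, hee]
      have : Real.exp (-t / 2) = 1 / Real.exp (t / 2) := by
        rw [eq_div_iff (Real.exp_pos _).ne', mul_comm, hexp]
      rw [this]
      have he := Real.exp_pos (t / 2)
      rw [div_div_eq_mul_div, div_le_div_iff₀ (by positivity) hk0]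
      have : Real.exp (t / 2) * (((N : ℝ) - 1) * unitBallVol d) * k ≤
          Real.exp (t / 2) * (N * unitBallVol d) * k := by
        gcongr
        linarith
      refine this.trans (le_of_eq ?_)
      field_simp
    -- The assumption `exp (t / 2) ≤ N` enters only here, to absorb the additive constant in the
    -- number of cells.
    have h3 : 1 ≤ N * Real.exp (-t / 2) := by
      rw [← hexp]
      gcongr
    push_cast
    calc (k : ℝ) * (2 * (⌈A * √d / ρ⌉₊ : ℝ) + 1) ^ d
        ≤ k * (2 * √d * (A / ρ) + 3) ^ d := by gcongr
      _ ≤ k * (2 ^ (d - 1) * ((2 * √d * (A / ρ)) ^ d + 3 ^ d)) := by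
          gcongr
          exact add_pow_le (by positivity) (by norm_num) d
      _ = k * (2 ^ (d - 1) * ((2 * √d) ^ d * (A / ρ) ^ d + 3 ^ d * 1)) := by
          rw [mul_pow, mul_one]
      _ ≤ k * (2 ^ (d - 1) * ((2 * √d) ^ d * (N * unitBallVol d * Real.exp (-t / 2) / k) +
            3 ^ d * (N * Real.exp (-t / 2)))) := by gcongr
      _ = _ := by
          field_simp
  have h := natCast_mul_pi_lt_knnLogVol_le G hd hk hkN hG i t A
  have hNe : (N : ENNReal) ≠ 0 := by
    have : N ≠ 0 := by omega
    exact_mod_cast this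
  rw [← ENNReal.mul_le_mul_iff_right hNe (ENNReal.natCast_ne_top N), mul_add]
  refine h.trans ?_
  gcongr
  rw [← ENNReal.ofReal_natCast, ← ENNReal.ofReal_natCast N, ← ENNReal.ofReal_mul hN0.le]
  exact ENNReal.ofReal_le_ofReal hcard

/-- Two points of the ball of radius `ρ / 2` about the origin are within `ρ` of each other. So a
centre in that ball with fewer than `k` neighbours forces at least `N - k` other points outside it,
and Markov's inequality applies to their number. -/
lemma knnLogVol_upper_tail_of_norm (hd : 1 ≤ d) (hk : 1 ≤ k) (hkN : k + 1 ≤ N)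
    (hG : G ≪ volume) (i : Fin N) (t : ℝ) :
    (Measure.pi fun _ : Fin N => G) {y | t < knnLogVol k y i} ≤
      (1 + k) * G {x | knnRadius d k N t / 2 < ‖x‖} := by
  set ρ := knnRadius d k N t with hρ
  set B := {x : EuclideanSpace ℝ (Fin d) | ρ / 2 < ‖x‖} with hB
  have hBm : MeasurableSet B := measurableSet_lt measurable_const measurable_norm
  classical
  let f : (Fin N → EuclideanSpace ℝ (Fin d)) → ENNReal := fun y =>
    ∑ j ∈ Finset.univ.erase i, {y : Fin N → EuclideanSpace ℝ (Fin d) | y j ∈ B}.indicator 1 y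
  have hjm : ∀ j, MeasurableSet {y : Fin N → EuclideanSpace ℝ (Fin d) | y j ∈ B} := fun j =>
    measurable_pi_apply j hBm
  have hfm : Measurable f := Finset.measurable_sum _ fun j _ => measurable_one.indicator (hjm j)
  have hf : ∫⁻ y, f y ∂(Measure.pi fun _ : Fin N => G) = ((N - 1 : ℕ) : ENNReal) * G B := by
    rw [lintegral_finsetSum _ fun j _ => measurable_one.indicator (hjm j)]
    simp_rw [lintegral_indicator_one (hjm _), pi_apply_eval G _ hBm]
    rw [Finset.sum_const, Finset.card_erase_of_mem (Finset.mem_univ _), Finset.card_univ,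
      Fintype.card_fin, nsmul_eq_mul]
  have hmk : (Measure.pi fun _ : Fin N => G) {y | ((N - k : ℕ) : ENNReal) ≤ f y} ≤ k * G B := by
    have h := mul_meas_ge_le_lintegral (μ := Measure.pi fun _ : Fin N => G) hfm ((N - k : ℕ))
    rw [hf] at h
    have hne : ((N - k : ℕ) : ENNReal) ≠ 0 := by
      have : N - k ≠ 0 := by omega
      exact_mod_cast this
    rw [← ENNReal.mul_le_mul_iff_right hne (ENNReal.natCast_ne_top _)]
    refine h.trans ?_
    rw [← mul_assoc]
    gcongr
    norm_cast
    -- The Markov ratio is bounded uniformly in `N`: `N - 1 ≤ k * (N - k)` reads `k + c ≤ k * (1 +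
    -- c)`.
    obtain ⟨c, rfl⟩ : ∃ c, N = k + 1 + c := ⟨N - (k + 1), by omega⟩
    rw [show k + 1 + c - 1 = k + c by omega, show k + 1 + c - k = 1 + c by omega]
    nlinarith
  calc (Measure.pi fun _ : Fin N => G) {y | t < knnLogVol k y i}
      ≤ (Measure.pi fun _ : Fin N => G) ({y | y i ∈ B} ∪ {y | ((N - k : ℕ) : ENNReal) ≤ f y}) := by
        refine measure_mono_ae ?_
        filter_upwards [ae_knnDist_pos G hd hk hkN hG i] with y hy hT
        have h := (lt_knnLogVol_iff hd hk hkN hy t).1 hT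
        by_cases hyB : y i ∈ B
        · exact Or.inl hyB
        refine Or.inr ?_
        change ((N - k : ℕ) : ENNReal) ≤ f y
        have hfy : f y = (((Finset.univ.erase i).filter fun j => y j ∈ B).card : ENNReal) := by
          rw [Finset.card_filter]
          push_cast
          rfl
        rw [hfy, Nat.cast_le]
        have hsub : Finset.univ.erase i ⊆ ((Finset.univ.erase i).filter fun j => y j ∈ B) ∪
            (Finset.univ.filter fun j => j ≠ i ∧ dist (y j) (y i) ≤ ρ) := by
          intro j hj
          by_cases hjB : y j ∈ B
          · exact Finset.mem_union_left _ (Finset.mem_filter.2 ⟨hj, hjB⟩)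
          · refine Finset.mem_union_right _ ?_
            simp only [Finset.mem_filter, Finset.mem_univ, true_and]
            refine ⟨Finset.ne_of_mem_erase hj, (dist_le_norm_add_norm _ _).trans ?_⟩
            have h1 : ‖y j‖ ≤ ρ / 2 := not_lt.1 hjB
            have h2 : ‖y i‖ ≤ ρ / 2 := not_lt.1 hyB
            linarith
        have hc := (Finset.card_le_card hsub).trans (Finset.card_union_le _ _)
        rw [Finset.card_erase_of_mem (Finset.mem_univ _), Finset.card_univ,
          Fintype.card_fin] at hc
        have : (Finset.univ.filter fun j => j ≠ i ∧ dist (y j) (y i) ≤ ρ).card < k := h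
        omega
    _ ≤ G B + k * G B := (measure_union_le _ _).trans
        (add_le_add (pi_apply_eval G i hBm).le hmk)
    _ = _ := by ring

end Tails

/-! ### Signed layer-cake formulas: survival functions and tail bounds determine moments. -/

section LayerCake

/-- The signed layer function, with `∫ s, layer x s = x`. -/
noncomputable def layer (x s : ℝ) : ℝ := (if s < x then 1 else 0) - (if s < 0 then 1 else 0)

lemma layer_of_nonneg {x : ℝ} (hx : 0 ≤ x) : layer x = (Set.Ico 0 x).indicator 1 := by
  ext s
  simp only [layer, Set.indicator_apply, Set.mem_Ico, Pi.one_apply]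
  split_ifs <;> grind

lemma layer_of_neg {x : ℝ} (hx : x < 0) : layer x = -(Set.Ico x 0).indicator 1 := by
  ext s
  simp only [layer, Set.indicator_apply, Set.mem_Ico, Pi.one_apply, Pi.neg_apply]
  split_ifs <;> grind

lemma integral_layer (x : ℝ) : ∫ s, layer x s = x := by
  rcases le_or_gt 0 x with hx | hx
  · rw [layer_of_nonneg hx, integral_indicator_one measurableSet_Ico]
    simp [hx]
  · rw [layer_of_neg hx]
    simp only [Pi.neg_apply]
    rw [integral_neg, integral_indicator_one measurableSet_Ico]
    simp [hx.le]

lemma lintegral_enorm_layer (x : ℝ) : ∫⁻ s, ‖layer x s‖ₑ = ‖x‖ₑ := by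
  have h (a b : ℝ) : ∫⁻ s, ‖(Set.Ico a b).indicator (1 : ℝ → ℝ) s‖ₑ = ENNReal.ofReal (b - a) := by
    have : ∀ s, ‖(Set.Ico a b).indicator (1 : ℝ → ℝ) s‖ₑ =
        (Set.Ico a b).indicator (1 : ℝ → ENNReal) s := by
      intro s
      by_cases hs : s ∈ Set.Ico a b <;> simp [hs]
    simp_rw [this]
    rw [lintegral_indicator_one measurableSet_Ico, Real.volume_Ico]
  rcases le_or_gt 0 x with hx | hx
  · rw [layer_of_nonneg hx, h, sub_zero, Real.enorm_eq_ofReal hx]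
  · rw [layer_of_neg hx]
    simp only [Pi.neg_apply, enorm_neg]
    rw [h, zero_sub, ← enorm_neg, Real.enorm_eq_ofReal (by linarith)]

lemma measurable_layer : Measurable (Function.uncurry layer) := by
  unfold layer Function.uncurry
  refine Measurable.sub ?_ ?_
  · exact Measurable.ite (measurableSet_lt measurable_snd measurable_fst) measurable_const
      measurable_const
  · exact Measurable.ite (measurableSet_lt measurable_snd measurable_const) measurable_const
      measurable_const

/-- For `s ≥ 0` the layer is the indicator of `s < x`, for `s < 0` minus that of `x ≤ s`. The
two-sided tail event at level `|s|` covers both. -/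
lemma enorm_layer_le (x s : ℝ) :
    ‖layer x s‖ₑ ≤ {x : ℝ | |s| < x ∨ x ≤ -|s|}.indicator 1 x := by
  simp only [layer, Set.indicator_apply, Set.mem_ofPred_eq, Pi.one_apply]
  rcases le_or_gt 0 s with hs | hs
  · rw [abs_of_nonneg hs, if_neg (not_lt.2 hs)]
    split_ifs with h1 h2 <;> simp_all
  · rw [abs_of_neg hs, if_pos hs]
    split_ifs with h1 h2 <;> simp_all

lemma volume_setOf_abs_le (x : ℝ) : volume {s : ℝ | |s| ≤ x} = 2 * ENNReal.ofReal x := by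
  have : {s : ℝ | |s| ≤ x} = Set.Icc (-x) x := by
    ext s
    simp [abs_le]
  rw [this, Real.volume_Icc, sub_neg_eq_add, ← two_mul, ENNReal.ofReal_mul (by norm_num)]
  simp

variable {Ω : Type*} [MeasurableSpace Ω] {μ : Measure Ω} {ν : Measure ℝ}

lemma measurable_measure_Ici [SFinite ν] : Measurable fun t : ℝ => ν (Set.Ici t) := by
  have h : MeasurableSet {p : ℝ × ℝ | p.1 ≤ p.2} := measurableSet_le measurable_fst measurable_snd
  exact measurable_measure_prodMk_left h

lemma lintegral_measure_Ici_abs [SFinite ν] :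
    ∫⁻ s, ν (Set.Ici |s|) = ∫⁻ x, 2 * ENNReal.ofReal x ∂ν := by
  have h : MeasurableSet {p : ℝ × ℝ | |p.1| ≤ p.2} :=
    measurableSet_le measurable_fst.abs measurable_snd
  have h1 := Measure.prod_apply (μ := volume) (ν := ν) h
  have h2 := Measure.prod_apply_symm (μ := volume) (ν := ν) h
  rw [h1] at h2
  calc _ = _ := h2
    _ = _ := lintegral_congr fun x => volume_setOf_abs_le x

/-- Tonelli, with `4 * x ^ 2` the area of the square `[-x, x]²`. A finite second moment of `ν` thus
makes the dominating function of the product layers integrable. -/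
lemma lintegral_measure_Ici_max_abs [SFinite ν] :
    ∫⁻ p : ℝ × ℝ, ν (Set.Ici (max |p.1| |p.2|)) = ∫⁻ x, 4 * ENNReal.ofReal x ^ 2 ∂ν := by
  have h : MeasurableSet {p : (ℝ × ℝ) × ℝ | max |p.1.1| |p.1.2| ≤ p.2} :=
    measurableSet_le (measurable_fst.fst.abs.max measurable_fst.snd.abs) measurable_snd
  have h1 := Measure.prod_apply (μ := volume) (ν := ν) h
  have h2 := Measure.prod_apply_symm (μ := volume) (ν := ν) h
  rw [h1] at h2
  calc _ = _ := h2
    _ = _ := lintegral_congr fun x => by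
      have : (fun p : ℝ × ℝ => (p, x)) ⁻¹' {p : (ℝ × ℝ) × ℝ | max |p.1.1| |p.1.2| ≤ p.2} =
          {s : ℝ | |s| ≤ x} ×ˢ {s : ℝ | |s| ≤ x} := by
        ext p
        simp
      rw [this, Measure.volume_eq_prod, Measure.prod_prod, volume_setOf_abs_le]
      ring

lemma integrable_of_tail [SFinite μ] [SFinite ν] {X : Ω → ℝ} (hX : Measurable X)
    (hν : ∫⁻ x, ENNReal.ofReal x ∂ν ≠ ⊤)
    (htail : ∀ t, 0 ≤ t → μ {ω | t < X ω ∨ X ω ≤ -t} ≤ ν (Set.Ici t)) : Integrable X μ := by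
  refine ⟨hX.aestronglyMeasurable, ?_⟩
  have hm : Measurable fun p : Ω × ℝ => ‖layer (X p.1) p.2‖ₑ :=
    (measurable_layer.comp ((hX.comp measurable_fst).prodMk measurable_snd)).enorm
  calc ∫⁻ ω, ‖X ω‖ₑ ∂μ = ∫⁻ ω, (∫⁻ s, ‖layer (X ω) s‖ₑ) ∂μ := by
        simp_rw [lintegral_enorm_layer]
    _ = ∫⁻ s, ∫⁻ ω, ‖layer (X ω) s‖ₑ ∂μ := lintegral_lintegral_swap hm.aemeasurable
    _ ≤ ∫⁻ s, ν (Set.Ici |s|) := by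
        refine lintegral_mono fun s => le_trans ?_ (htail |s| (abs_nonneg s))
        have hs : MeasurableSet {ω | |s| < X ω ∨ X ω ≤ -|s|} :=
          (measurableSet_lt measurable_const hX).union (measurableSet_le hX measurable_const)
        rw [← lintegral_indicator_one hs]
        exact lintegral_mono fun ω => enorm_layer_le (X ω) s
    _ < ⊤ := by
        rw [lintegral_measure_Ici_abs, lintegral_const_mul _ ENNReal.measurable_ofReal]
        exact ENNReal.mul_lt_top (by simp) hν.lt_top

/-- Each layer is bounded by 1, so the factor with the lower level is discarded and only marginal
tails are needed, whatever the dependence of `X` and `Y`. -/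
lemma lintegral_enorm_layer_mul_le {X Y : Ω → ℝ} (hX : Measurable X) (hY : Measurable Y)
    (hXt : ∀ t, 0 ≤ t → μ {ω | t < X ω ∨ X ω ≤ -t} ≤ ν (Set.Ici t))
    (hYt : ∀ t, 0 ≤ t → μ {ω | t < Y ω ∨ Y ω ≤ -t} ≤ ν (Set.Ici t)) (s t : ℝ) :
    ∫⁻ ω, ‖layer (X ω) s * layer (Y ω) t‖ₑ ∂μ ≤ ν (Set.Ici (max |s| |t|)) := by
  have key : ∀ {Z : Ω → ℝ} (_ : Measurable Z) (r : ℝ),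
      ∫⁻ ω, {x : ℝ | |r| < x ∨ x ≤ -|r|}.indicator (1 : ℝ → ENNReal) (Z ω) ∂μ =
        μ {ω | |r| < Z ω ∨ Z ω ≤ -|r|} := fun {Z} hZ r => by
    have hs : MeasurableSet {ω | |r| < Z ω ∨ Z ω ≤ -|r|} :=
      (measurableSet_lt measurable_const hZ).union (measurableSet_le hZ measurable_const)
    rw [← lintegral_indicator_one hs]
    rfl
  have hle1 : ∀ x r, ‖layer x r‖ₑ ≤ 1 := fun x r =>
    (enorm_layer_le x r).trans (Set.indicator_le_self' (fun _ _ => zero_le) _)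
  rcases le_total |s| |t| with h | h
  · rw [max_eq_right h]
    refine le_trans ?_ (hYt |t| (abs_nonneg t))
    rw [← key hY t]
    refine lintegral_mono fun ω => ?_
    rw [enorm_mul]
    exact (mul_le_mul' (hle1 _ _) (enorm_layer_le (Y ω) t)).trans (by rw [one_mul])
  · rw [max_eq_left h]
    refine le_trans ?_ (hXt |s| (abs_nonneg s))
    rw [← key hX s]
    refine lintegral_mono fun ω => ?_
    rw [enorm_mul]
    exact (mul_le_mul' (enorm_layer_le (X ω) s) (hle1 _ _)).trans (by rw [mul_one])

lemma lintegral_enorm_layer_prod (x y : ℝ) :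
    ∫⁻ p : ℝ × ℝ, ‖layer x p.1 * layer y p.2‖ₑ = ‖x‖ₑ * ‖y‖ₑ := by
  have hm : ∀ x, Measurable fun s => ‖layer x s‖ₑ := fun x =>
    (measurable_layer.comp (measurable_const.prodMk measurable_id)).enorm
  simp_rw [enorm_mul]
  rw [Measure.volume_eq_prod, lintegral_prod_mul (hm x).aemeasurable (hm y).aemeasurable,
    lintegral_enorm_layer, lintegral_enorm_layer]

lemma measurable_layer_mul {X Y : Ω → ℝ} (hX : Measurable X) (hY : Measurable Y) :
    Measurable fun q : Ω × (ℝ × ℝ) => layer (X q.1) q.2.1 * layer (Y q.1) q.2.2 :=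
  (measurable_layer.comp ((hX.comp measurable_fst).prodMk measurable_snd.fst)).mul
    (measurable_layer.comp ((hY.comp measurable_fst).prodMk measurable_snd.snd))

lemma memLp_two_of_tail [SFinite μ] [SFinite ν] {X : Ω → ℝ} (hX : Measurable X)
    (hν : ∫⁻ x, ENNReal.ofReal x ^ 2 ∂ν ≠ ⊤)
    (htail : ∀ t, 0 ≤ t → μ {ω | t < X ω ∨ X ω ≤ -t} ≤ ν (Set.Ici t)) : MemLp X 2 μ := by
  rw [memLp_two_iff_integrable_sq hX.aestronglyMeasurable]
  refine ⟨(hX.pow_const 2).aestronglyMeasurable, ?_⟩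
  calc ∫⁻ ω, ‖X ω ^ 2‖ₑ ∂μ
      = ∫⁻ ω, (∫⁻ p : ℝ × ℝ, ‖layer (X ω) p.1 * layer (X ω) p.2‖ₑ) ∂μ := by
        simp_rw [lintegral_enorm_layer_prod, pow_two, enorm_mul]
    _ = ∫⁻ p : ℝ × ℝ, ∫⁻ ω, ‖layer (X ω) p.1 * layer (X ω) p.2‖ₑ ∂μ :=
        lintegral_lintegral_swap (measurable_layer_mul hX hX).enorm.aemeasurable
    _ ≤ ∫⁻ p : ℝ × ℝ, ν (Set.Ici (max |p.1| |p.2|)) :=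
        lintegral_mono fun p => lintegral_enorm_layer_mul_le hX hX htail htail p.1 p.2
    _ < ⊤ := by
        rw [lintegral_measure_Ici_max_abs,
          lintegral_const_mul _ (ENNReal.measurable_ofReal.pow_const 2)]
        exact ENNReal.mul_lt_top (by simp) hν.lt_top

lemma integral_eq_integral_layer [IsFiniteMeasure μ] {X : Ω → ℝ} (hX : Measurable X)
    (hXi : Integrable X μ) : ∫ ω, X ω ∂μ = ∫ s, ∫ ω, layer (X ω) s ∂μ := by
  rw [integral_integral_swap]
  · simp_rw [integral_layer]
  · have hm : Measurable fun p : ℝ × Ω => layer (X p.2) p.1 :=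
      measurable_layer.comp ((hX.comp measurable_snd).prodMk measurable_fst)
    refine ⟨hm.aestronglyMeasurable, ?_⟩
    change ∫⁻ p : ℝ × Ω, ‖layer (X p.2) p.1‖ₑ ∂(volume.prod μ) < ⊤
    rw [lintegral_prod_symm _ hm.enorm.aemeasurable]
    simp_rw [lintegral_enorm_layer]
    exact hXi.2

lemma integral_mul_eq_integral_layer [IsFiniteMeasure μ] {X Y : Ω → ℝ} (hX : Measurable X)
    (hY : Measurable Y) (hXi : MemLp X 2 μ) (hYi : MemLp Y 2 μ) :
    ∫ ω, X ω * Y ω ∂μ = ∫ p : ℝ × ℝ, ∫ ω, layer (X ω) p.1 * layer (Y ω) p.2 ∂μ := by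
  rw [integral_integral_swap]
  · refine integral_congr_ae (ae_of_all _ fun ω => ?_)
    change X ω * Y ω = ∫ p : ℝ × ℝ, layer (X ω) p.1 * layer (Y ω) p.2
    rw [Measure.volume_eq_prod, integral_prod_mul, integral_layer, integral_layer]
  · have hm : Measurable fun q : (ℝ × ℝ) × Ω => layer (X q.2) q.1.1 * layer (Y q.2) q.1.2 :=
      (measurable_layer_mul hX hY).comp measurable_swap
    refine ⟨hm.aestronglyMeasurable, ?_⟩
    change ∫⁻ q : (ℝ × ℝ) × Ω, ‖layer (X q.2) q.1.1 * layer (Y q.2) q.1.2‖ₑ ∂(volume.prod μ) < ⊤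
    rw [lintegral_prod_symm _ hm.enorm.aemeasurable]
    simp_rw [lintegral_enorm_layer_prod, ← enorm_mul]
    exact (hXi.integrable_mul hYi).2

lemma measurableSet_lt_const {X : Ω → ℝ} (hX : Measurable X) (s : ℝ) :
    MeasurableSet {ω | s < X ω} := measurableSet_lt measurable_const hX

lemma integral_layer_apply [IsProbabilityMeasure μ] {X : Ω → ℝ} (hX : Measurable X) (s : ℝ) :
    ∫ ω, layer (X ω) s ∂μ = μ.real {ω | s < X ω} - (if s < 0 then 1 else 0) := by
  have h : ∀ ω, layer (X ω) s = {ω | s < X ω}.indicator 1 ω - (if s < 0 then 1 else 0) :=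
    fun ω => rfl
  simp_rw [h]
  rw [integral_sub ((integrable_const 1).indicator (measurableSet_lt_const hX s))
    (integrable_const _), integral_indicator_one (measurableSet_lt_const hX s)]
  simp

lemma integral_layer_mul_apply [IsProbabilityMeasure μ] {X Y : Ω → ℝ} (hX : Measurable X)
    (hY : Measurable Y) (s t : ℝ) :
    ∫ ω, layer (X ω) s * layer (Y ω) t ∂μ = μ.real {ω | s < X ω ∧ t < Y ω}
      - (if t < 0 then 1 else 0) * μ.real {ω | s < X ω}
      - (if s < 0 then 1 else 0) * μ.real {ω | t < Y ω}
      + (if s < 0 then 1 else 0) * (if t < 0 then 1 else 0) := by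
  have hs := measurableSet_lt_const hX s
  have ht := measurableSet_lt_const hY t
  have hst : MeasurableSet {ω | s < X ω ∧ t < Y ω} := hs.inter ht
  have h : ∀ ω, layer (X ω) s * layer (Y ω) t =
      {ω | s < X ω ∧ t < Y ω}.indicator (1 : Ω → ℝ) ω
      - (if t < 0 then 1 else 0) * {ω | s < X ω}.indicator (1 : Ω → ℝ) ω
      - (if s < 0 then 1 else 0) * {ω | t < Y ω}.indicator (1 : Ω → ℝ) ω
      + (if s < 0 then 1 else 0) * (if t < 0 then 1 else 0) := by
    intro ω
    simp only [layer, Set.indicator_apply, Set.mem_ofPred_eq, Pi.one_apply]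
    split_ifs <;> simp_all
  have i1 : Integrable ({ω | s < X ω ∧ t < Y ω}.indicator (1 : Ω → ℝ)) μ :=
    (integrable_const 1).indicator hst
  have i2 : Integrable ({ω | s < X ω}.indicator (1 : Ω → ℝ)) μ := (integrable_const 1).indicator hs
  have i3 : Integrable ({ω | t < Y ω}.indicator (1 : Ω → ℝ)) μ := (integrable_const 1).indicator ht
  simp_rw [h]
  have j1 : Integrable (fun ω => {ω | s < X ω ∧ t < Y ω}.indicator (1 : Ω → ℝ) ω
      - (if t < 0 then 1 else 0) * {ω | s < X ω}.indicator (1 : Ω → ℝ) ω) μ :=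
    i1.sub (i2.const_mul _)
  have j2 : Integrable (fun ω => {ω | s < X ω ∧ t < Y ω}.indicator (1 : Ω → ℝ) ω
      - (if t < 0 then 1 else 0) * {ω | s < X ω}.indicator (1 : Ω → ℝ) ω
      - (if s < 0 then 1 else 0) * {ω | t < Y ω}.indicator (1 : Ω → ℝ) ω) μ :=
    j1.sub (i3.const_mul _)
  rw [integral_add j2 (integrable_const _), integral_sub j1 (i3.const_mul _),
    integral_sub i1 (i2.const_mul _), integral_const_mul, integral_const_mul, integral_indicator_one hst, integral_indicator_one hs,
    integral_indicator_one ht]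
  simp

/-- Both expectations are integrals over `s` of differences of survival functions, so dominated
convergence takes place on the line, with `ν (Set.Ici |s|)` as bound. The probability spaces may
therefore vary with `n`. -/
lemma tendsto_integral_of_tail [IsFiniteMeasure ν] {Ω' : ℕ → Type*}
    [∀ n, MeasurableSpace (Ω' n)] {P : ∀ n, Measure (Ω' n)} [∀ n, IsProbabilityMeasure (P n)]
    [IsProbabilityMeasure μ] {X : ∀ n, Ω' n → ℝ} {X' : Ω → ℝ}
    (hν : ∫⁻ x, ENNReal.ofReal x ∂ν ≠ ⊤) (hX' : Measurable X') (hX'i : Integrable X' μ)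
    (hX : ∀ᶠ n in atTop, Measurable (X n) ∧
      ∀ t, 0 ≤ t → P n {ω | t < X n ω ∨ X n ω ≤ -t} ≤ ν (Set.Ici t))
    (hlim : ∀ s, Tendsto (fun n => (P n).real {ω | s < X n ω}) atTop
      (𝓝 (μ.real {ω | s < X' ω}))) :
    Tendsto (fun n => ∫ ω, X n ω ∂(P n)) atTop (𝓝 (∫ ω, X' ω ∂μ)) := by
  rw [integral_eq_integral_layer hX' hX'i]
  have h : Tendsto (fun n => ∫ s, ((P n).real {ω | s < X n ω} - (if s < 0 then 1 else 0))) atTop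
      (𝓝 (∫ s, (μ.real {ω | s < X' ω} - (if s < 0 then 1 else 0)))) := by
    refine tendsto_integral_filter_of_dominated_convergence
      (fun s => (ν (Set.Ici |s|)).toReal) ?_ ?_ ?_ ?_
    · filter_upwards [hX] with n hn
      have hm : Measurable fun s => (P n).real {ω | s < X n ω} :=
        (measurable_measure_prodMk_left (ν := P n)
          (measurableSet_lt measurable_fst (hn.1.comp measurable_snd))).ennreal_toReal
      exact (hm.sub (Measurable.ite measurableSet_Iio measurable_const
        measurable_const)).aestronglyMeasurable
    · filter_upwards [hX] with n hn
      refine ae_of_all _ fun s => ?_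
      rw [← integral_layer_apply hn.1]
      refine (norm_integral_le_lintegral_norm _).trans ?_
      refine ENNReal.toReal_mono (measure_ne_top _ _) (le_trans ?_ (hn.2 |s| (abs_nonneg s)))
      have hs : MeasurableSet {ω | |s| < X n ω ∨ X n ω ≤ -|s|} :=
        (measurableSet_lt measurable_const hn.1).union (measurableSet_le hn.1 measurable_const)
      rw [← lintegral_indicator_one hs]
      refine lintegral_mono fun ω => ?_
      rw [ofReal_norm]
      exact enorm_layer_le (X n ω) s
    · refine integrable_toReal_of_lintegral_ne_top
        (measurable_measure_Ici.comp measurable_norm).aemeasurable ?_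
      change ∫⁻ s, ν (Set.Ici |s|) ≠ ⊤
      rw [lintegral_measure_Ici_abs, lintegral_const_mul _ ENNReal.measurable_ofReal]
      exact ENNReal.mul_ne_top (by simp) hν
    · exact ae_of_all _ fun s => (hlim s).sub tendsto_const_nhds
  simp_rw [integral_layer_apply hX']
  refine h.congr' ?_
  filter_upwards [hX] with n hn
  rw [integral_eq_integral_layer hn.1 (integrable_of_tail hn.1 hν hn.2)]
  simp_rw [integral_layer_apply hn.1]

/-- The same scheme in the plane of pairs of levels: the mean of a product of layers is a
combination of the joint and the two marginal survival functions. -/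
lemma tendsto_integral_mul_of_tail [IsFiniteMeasure ν] {Ω' : ℕ → Type*}
    [∀ n, MeasurableSpace (Ω' n)] {P : ∀ n, Measure (Ω' n)} [∀ n, IsProbabilityMeasure (P n)]
    [IsProbabilityMeasure μ] {X Y : ∀ n, Ω' n → ℝ} {X' Y' : Ω → ℝ}
    (hν : ∫⁻ x, ENNReal.ofReal x ^ 2 ∂ν ≠ ⊤) (hX' : Measurable X') (hX'i : MemLp X' 2 μ)
    (hY' : Measurable Y') (hY'i : MemLp Y' 2 μ)
    (hX : ∀ᶠ n in atTop, Measurable (X n) ∧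
      ∀ t, 0 ≤ t → P n {ω | t < X n ω ∨ X n ω ≤ -t} ≤ ν (Set.Ici t))
    (hY : ∀ᶠ n in atTop, Measurable (Y n) ∧
      ∀ t, 0 ≤ t → P n {ω | t < Y n ω ∨ Y n ω ≤ -t} ≤ ν (Set.Ici t))
    (hlimX : ∀ s, Tendsto (fun n => (P n).real {ω | s < X n ω}) atTop
      (𝓝 (μ.real {ω | s < X' ω})))
    (hlimY : ∀ s, Tendsto (fun n => (P n).real {ω | s < Y n ω}) atTop
      (𝓝 (μ.real {ω | s < Y' ω})))
    (hlim : ∀ s t, Tendsto (fun n => (P n).real {ω | s < X n ω ∧ t < Y n ω}) atTop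
      (𝓝 (μ.real {ω | s < X' ω ∧ t < Y' ω}))) :
    Tendsto (fun n => ∫ ω, X n ω * Y n ω ∂(P n)) atTop (𝓝 (∫ ω, X' ω * Y' ω ∂μ)) := by
  rw [integral_mul_eq_integral_layer hX' hY' hX'i hY'i]
  have h : Tendsto (fun n => ∫ p : ℝ × ℝ, ∫ ω, layer (X n ω) p.1 * layer (Y n ω) p.2 ∂(P n)) atTop
      (𝓝 (∫ p : ℝ × ℝ, ∫ ω, layer (X' ω) p.1 * layer (Y' ω) p.2 ∂μ)) := by
    refine tendsto_integral_filter_of_dominated_convergence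
      (fun p => (ν (Set.Ici (max |p.1| |p.2|))).toReal) ?_ ?_ ?_ ?_
    · filter_upwards [hX, hY] with n hn hn'
      have hm : Measurable fun q : (ℝ × ℝ) × Ω' n =>
          layer (X n q.2) q.1.1 * layer (Y n q.2) q.1.2 :=
        (measurable_layer_mul hn.1 hn'.1).comp measurable_swap
      exact hm.stronglyMeasurable.integral_prod_right.aestronglyMeasurable
    · filter_upwards [hX, hY] with n hn hn'
      refine ae_of_all _ fun p => ?_
      refine (norm_integral_le_lintegral_norm _).trans ?_
      refine ENNReal.toReal_mono (measure_ne_top _ _) ?_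
      simp_rw [ofReal_norm]
      exact lintegral_enorm_layer_mul_le hn.1 hn'.1 hn.2 hn'.2 p.1 p.2
    · refine integrable_toReal_of_lintegral_ne_top
        (measurable_measure_Ici.comp (measurable_fst.abs.max measurable_snd.abs)).aemeasurable ?_
      rw [lintegral_measure_Ici_max_abs,
        lintegral_const_mul _ (ENNReal.measurable_ofReal.pow_const 2)]
      exact ENNReal.mul_ne_top (by simp) hν
    · refine ae_of_all _ fun p => ?_
      rw [integral_layer_mul_apply hX' hY']
      refine Tendsto.congr' ?_ ((((hlim p.1 p.2).sub ((hlimX p.1).const_mul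
        (if p.2 < 0 then 1 else 0))).sub ((hlimY p.2).const_mul
        (if p.1 < 0 then 1 else 0))).add_const _)
      filter_upwards [hX, hY] with n hn hn'
      rw [integral_layer_mul_apply hn.1 hn'.1]
  refine h.congr' ?_
  filter_upwards [hX, hY] with n hn hn'
  rw [integral_mul_eq_integral_layer hn.1 hn'.1 (memLp_two_of_tail hn.1 hν hn.2)
    (memLp_two_of_tail hn'.1 hν hn'.2)]

end LayerCake

/-! ### A single measure on the line that dominates the tails for every sample size. -/

section TailMeasure

lemma integrable_gammaMeasure_iff {a r : ℝ} (ha : 0 < a) (hr : 0 < r) {f : ℝ → ℝ} :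
    Integrable f (gammaMeasure a r) ↔
      IntegrableOn (fun x => x ^ (a - 1) * Real.exp (-(r * x)) * f x) (Set.Ioi 0) := by
  have hc : 0 < r ^ a / Real.Gamma a := div_pos (Real.rpow_pos_of_pos hr a) (Real.Gamma_pos_of_pos ha)
  have hm : Measurable (gammaPDF a r) := (measurable_gammaPDFReal a r).ennreal_ofReal
  rw [gammaMeasure, integrable_withDensity_iff_integrable_smul' hm
    (ae_of_all _ fun x => ENNReal.ofReal_lt_top)]
  have h1 : (fun x => (gammaPDF a r x).toReal • f x) =
      (Set.Ici 0).indicator fun x => r ^ a / Real.Gamma a *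
        (x ^ (a - 1) * Real.exp (-(r * x)) * f x) := by
    ext x
    rw [gammaPDF, ENNReal.toReal_ofReal (gammaPDFReal_nonneg ha hr x), gammaPDFReal]
    by_cases hx : 0 ≤ x
    · simp only [hx, if_true, Set.indicator_of_mem (show x ∈ Set.Ici (0 : ℝ) from hx), smul_eq_mul]
      ring
    · simp [hx]
  rw [h1, integrable_indicator_iff measurableSet_Ici, integrableOn_Ici_iff_integrableOn_Ioi]
  exact integrable_const_mul_iff (isUnit_iff_ne_zero.2 hc.ne') _

lemma integral_gammaMeasure {a r : ℝ} (ha : 0 < a) (hr : 0 < r) (f : ℝ → ℝ) :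
    ∫ x, f x ∂(gammaMeasure a r) =
      r ^ a / Real.Gamma a * ∫ x in Set.Ioi 0, x ^ (a - 1) * Real.exp (-(r * x)) * f x := by
  have hm : Measurable (gammaPDF a r) := (measurable_gammaPDFReal a r).ennreal_ofReal
  rw [gammaMeasure, integral_withDensity_eq_integral_toReal_smul hm
    (ae_of_all _ fun x => ENNReal.ofReal_lt_top)]
  have h1 : (fun x => (gammaPDF a r x).toReal • f x) =
      (Set.Ici 0).indicator fun x => r ^ a / Real.Gamma a *
        (x ^ (a - 1) * Real.exp (-(r * x)) * f x) := by
    ext x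
    rw [gammaPDF, ENNReal.toReal_ofReal (gammaPDFReal_nonneg ha hr x), gammaPDFReal]
    by_cases hx : 0 ≤ x
    · simp only [hx, if_true, Set.indicator_of_mem (show x ∈ Set.Ici (0 : ℝ) from hx), smul_eq_mul]
      ring
    · simp [hx]
  rw [h1, integral_indicator measurableSet_Ici, integral_Ici_eq_integral_Ioi, integral_const_mul]

lemma lintegral_ofReal_pow_expMeasure_ne_top {p : ℕ} :
    ∫⁻ x, ENNReal.ofReal x ^ p ∂(expMeasure (1 / 2)) ≠ ⊤ := by
  have hi : Integrable (fun x : ℝ => x ^ p) (expMeasure (1 / 2)) := by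
    rw [expMeasure, integrable_gammaMeasure_iff one_pos (by norm_num)]
    have h := integrableOn_rpow_mul_exp_neg_mul_rpow (p := 1) (s := p) (b := 1 / 2)
      (by linarith [(Nat.cast_nonneg p : (0 : ℝ) ≤ p)]) one_pos (by norm_num)
    refine h.congr_fun (fun x _ => ?_) measurableSet_Ioi
    simp only [Real.rpow_natCast, Real.rpow_one, sub_self, Real.rpow_zero, one_mul, neg_mul]
    ring
  refine (lt_of_le_of_lt (lintegral_mono fun x => ?_) hi.2).ne
  rw [enorm_pow]
  gcongr
  exact Real.ofReal_le_enorm x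

/-- The rate `1 / 2` is chosen to reproduce the term `exp (-t / 2)` of the tail bounds. -/
lemma ofReal_exp_le_expMeasure_Ici {t : ℝ} (ht : 0 ≤ t) :
    ENNReal.ofReal (Real.exp (-t / 2)) ≤ expMeasure (1 / 2) (Set.Ici t) := by
  have : IsProbabilityMeasure (expMeasure (1 / 2)) :=
    isProbabilityMeasure_expMeasure (by norm_num)
  have h := cdf_expMeasure_eq (r := 1 / 2) (by norm_num) t
  rw [if_pos ht, cdf_eq_real] at h
  refine le_trans ?_ (measure_mono Set.Ioi_subset_Ici_self)
  rw [← Set.compl_Iic, ← ofReal_measureReal, probReal_compl_eq_one_sub measurableSet_Iic, h]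
  refine ENNReal.ofReal_le_ofReal (le_of_eq ?_)
  ring_nf

lemma lintegral_ofReal_pow_map_ne_top {α : Type*} [MeasurableSpace α] {μ : Measure α} {f : α → ℝ}
    {p : ℕ} (hp : p ≠ 0) (hf : Measurable f) (hfp : MemLp f p μ) :
    ∫⁻ x, ENNReal.ofReal x ^ p ∂(μ.map f) ≠ ⊤ := by
  rw [lintegral_map (ENNReal.measurable_ofReal.pow_const p) hf]
  have h := (eLpNorm_lt_top_iff_lintegral_rpow_enorm_lt_top (by exact_mod_cast hp)
    (ENNReal.natCast_ne_top p)).1 hfp.2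
  refine (lt_of_le_of_lt (lintegral_mono fun x => ?_) h).ne
  rw [ENNReal.toReal_natCast, ENNReal.rpow_natCast]
  gcongr
  exact Real.ofReal_le_enorm (f x)

variable {d k : ℕ} (G : Measure (EuclideanSpace ℝ (Fin d))) [IsProbabilityMeasure G]

/-- Bound for the scaled logarithm of the norm that controls the upper tail of `knnLogVol`. -/
noncomputable def logNormBound (d : ℕ) (x : EuclideanSpace ℝ (Fin d)) : ℝ :=
  2 * d * Real.log (1 + ‖x‖) + (2 * d * Real.log 2 + 2 * |Real.log (unitBallVol d)|)

lemma measurable_logNormBound (d : ℕ) : Measurable (logNormBound d) := by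
  unfold logNormBound
  fun_prop

/-- A measure on the line whose tails dominate those of `knnLogVol`. -/
noncomputable def tailMeasure (k : ℕ) (G : Measure (EuclideanSpace ℝ (Fin d))) : Measure ℝ :=
  (2 + k : ENNReal) • G.map (logNormBound d) + G.map (fun x => 2 * Real.log (pdfOf G x)) +
    ENNReal.ofReal (2 ^ (d - 1) * ((2 * √d) ^ d * unitBallVol d + k * 3 ^ d) + k) •
      expMeasure (1 / 2)

lemma measurable_two_mul_log_pdfOf (G : Measure (EuclideanSpace ℝ (Fin d))) :
    Measurable fun x => 2 * Real.log (pdfOf G x) :=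
  (measurable_pdfOf G).log.const_mul 2

lemma isFiniteMeasure_tailMeasure : IsFiniteMeasure (tailMeasure k G) := by
  have : IsProbabilityMeasure (expMeasure (1 / 2)) :=
    isProbabilityMeasure_expMeasure (by norm_num)
  have h1 : IsFiniteMeasure ((2 + k : ENNReal) • G.map (logNormBound d)) :=
    Measure.smul_finite _ (by simp)
  have h2 : IsFiniteMeasure (ENNReal.ofReal (2 ^ (d - 1) * ((2 * √d) ^ d * unitBallVol d +
      k * 3 ^ d) + k) • expMeasure (1 / 2)) := Measure.smul_finite _ (by simp)
  unfold tailMeasure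
  infer_instance

lemma lintegral_tailMeasure_ne_top {p : ℕ} (hp : p ≠ 0)
    (hlog : MemLp (fun x => Real.log (pdfOf G x)) p G)
    (hnorm : MemLp (fun x => Real.log (1 + ‖x‖)) p G) :
    ∫⁻ x, ENNReal.ofReal x ^ p ∂(tailMeasure k G) ≠ ⊤ := by
  rw [tailMeasure, lintegral_add_measure, lintegral_add_measure, lintegral_smul_measure,
    lintegral_smul_measure, ENNReal.add_ne_top, ENNReal.add_ne_top]
  refine ⟨⟨ENNReal.mul_ne_top (by simp) ?_, ?_⟩,
    ENNReal.mul_ne_top (by simp) lintegral_ofReal_pow_expMeasure_ne_top⟩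
  · exact lintegral_ofReal_pow_map_ne_top hp (measurable_logNormBound d)
      ((hnorm.const_mul (2 * d)).add (memLp_const _))
  · exact lintegral_ofReal_pow_map_ne_top hp (measurable_two_mul_log_pdfOf G) (hlog.const_mul 2)

lemma le_logNormBound_of_exp_lt_norm (hd : 1 ≤ d) {t : ℝ} {x : EuclideanSpace ℝ (Fin d)}
    (hx : Real.exp (t / (2 * d)) < ‖x‖) : t ≤ logNormBound d x := by
  have hd0 : (0 : ℝ) < d := by exact_mod_cast hd
  have h : t / (2 * d) ≤ Real.log (1 + ‖x‖) := by
    rw [Real.le_log_iff_exp_le (by positivity)]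
    linarith
  rw [div_le_iff₀ (by positivity)] at h
  have h1 : 0 ≤ Real.log 2 := Real.log_nonneg (by norm_num)
  have : 0 ≤ 2 * d * Real.log 2 + 2 * |Real.log (unitBallVol d)| := by positivity
  rw [logNormBound]
  linarith

/-- When `N < exp (t / 2)`, the ball of radius `knnRadius d k N t` has volume above `exp (t / 2)`. A
norm exceeding half that radius has logarithm at least `t / (2 * d)` up to constants, which
`logNormBound` collects. -/
lemma le_logNormBound_of_knnRadius_lt {N : ℕ} (hd : 1 ≤ d) (hk : 1 ≤ k) (hkN : k + 1 ≤ N) {t : ℝ}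
    (ht : N < Real.exp (t / 2)) {x : EuclideanSpace ℝ (Fin d)}
    (hx : knnRadius d k N t / 2 < ‖x‖) : t ≤ logNormBound d x := by
  have hN1 := cast_sub_one_pos hk hkN
  have hv := unitBallVol_pos d
  have hk1 : (1 : ℝ) ≤ k := by exact_mod_cast hk
  have hρ := knnRadius_pos (d := d) hk hkN t
  have h1 : Real.exp (t / 2) / unitBallVol d ≤ (2 * (1 + ‖x‖)) ^ d := by
    calc Real.exp (t / 2) / unitBallVol d
        ≤ k * Real.exp t / (((N : ℝ) - 1) * unitBallVol d) := by
          rw [div_le_div_iff₀ hv (by positivity),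
            show Real.exp t = Real.exp (t / 2) * Real.exp (t / 2) by
              rw [← Real.exp_add]; ring_nf]
          have he := Real.exp_pos (t / 2)
          have : (N : ℝ) - 1 ≤ k * Real.exp (t / 2) := by nlinarith
          calc Real.exp (t / 2) * (((N : ℝ) - 1) * unitBallVol d)
              = (Real.exp (t / 2) * unitBallVol d) * ((N : ℝ) - 1) := by ring
            _ ≤ (Real.exp (t / 2) * unitBallVol d) * (k * Real.exp (t / 2)) := by gcongr
            _ = _ := by ring
      _ = knnRadius d k N t ^ d := (knnRadius_pow hd hk hkN t).symm
      _ ≤ _ := by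
          gcongr
          linarith
  have h2 := Real.log_le_log (by positivity) h1
  rw [Real.log_div (Real.exp_pos _).ne' hv.ne', Real.log_exp, Real.log_pow, Real.log_mul
    (by norm_num) (by positivity)] at h2
  have h3 := le_abs_self (Real.log (unitBallVol d))
  rw [logNormBound]
  linarith

/-- The right side does not depend on `N` or `i`, which is what dominated convergence requires. -/
lemma pi_tail_le_tailMeasure {N : ℕ} (hd : 1 ≤ d) (hk : 1 ≤ k) (hkN : k + 1 ≤ N)
    (hG : G ≪ volume) (i : Fin N) {t : ℝ} (ht : 0 ≤ t) :
    (Measure.pi fun _ : Fin N => G) {y | t < knnLogVol k y i ∨ knnLogVol k y i ≤ -t} ≤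
      tailMeasure k G (Set.Ici t) := by
  set A := G.map (logNormBound d) (Set.Ici t) with hA
  set B := G.map (fun x => 2 * Real.log (pdfOf G x)) (Set.Ici t) with hB
  set C : ℝ := 2 ^ (d - 1) * ((2 * √d) ^ d * unitBallVol d + k * 3 ^ d) with hC
  have hC0 : 0 ≤ C := by
    have := unitBallVol_pos d
    positivity
  have hAeq : A = G {x | t ≤ logNormBound d x} :=
    Measure.map_apply (measurable_logNormBound d) measurableSet_Ici
  have hBeq : B = G {x | t ≤ 2 * Real.log (pdfOf G x)} :=
    Measure.map_apply (measurable_two_mul_log_pdfOf G) measurableSet_Ici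
  have hup : (Measure.pi fun _ : Fin N => G) {y | t < knnLogVol k y i} ≤
      (2 + k) * A + ENNReal.ofReal (C * Real.exp (-t / 2)) := by
    -- The grid bound serves moderate levels, the Markov bound levels with `exp (t / 2) > N`. The
    -- coefficient `2 + k` covers both, which need `1` and `1 + k`.
    rcases le_or_gt (Real.exp (t / 2)) N with h | h
    · refine (knnLogVol_upper_tail_of_le G hd hk hkN hG i h).trans ?_
      gcongr
      calc G {x | Real.exp (t / (2 * d)) < ‖x‖} ≤ A := by
            rw [hAeq]
            exact measure_mono fun x hx => le_logNormBound_of_exp_lt_norm hd hx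
        _ = 1 * A := (one_mul _).symm
        _ ≤ (2 + k) * A := by
            gcongr
            exact le_add_right (by norm_num)
    · refine (knnLogVol_upper_tail_of_norm G hd hk hkN hG i t).trans (le_add_right ?_)
      gcongr
      · norm_num
      · rw [hAeq]
        exact measure_mono fun x hx => le_logNormBound_of_knnRadius_lt hd hk hkN h hx
  have hlow : (Measure.pi fun _ : Fin N => G) {y | knnLogVol k y i ≤ -t} ≤
      B + ENNReal.ofReal (k * Real.exp (-t / 2)) := by
    refine (knnLogVol_lower_tail G hd hk hkN hG i t).trans ?_
    gcongr
    rw [hBeq]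
    refine measure_mono fun x hx => ?_
    have : t / 2 < Real.log (pdfOf G x) := hx
    change t ≤ 2 * Real.log (pdfOf G x)
    linarith
  calc (Measure.pi fun _ : Fin N => G) {y | t < knnLogVol k y i ∨ knnLogVol k y i ≤ -t}
      ≤ ((2 + k) * A + ENNReal.ofReal (C * Real.exp (-t / 2))) +
          (B + ENNReal.ofReal (k * Real.exp (-t / 2))) :=
        (measure_union_le _ _).trans (add_le_add hup hlow)
    _ = (2 + k) * A + B + ENNReal.ofReal (C + k) * ENNReal.ofReal (Real.exp (-t / 2)) := by
        rw [← ENNReal.ofReal_mul (by positivity), add_mul C, ENNReal.ofReal_add (by positivity)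
          (by positivity)]
        ring
    _ ≤ (2 + k) * A + B + ENNReal.ofReal (C + k) * expMeasure (1 / 2) (Set.Ici t) := by
        gcongr
        exact ofReal_exp_le_expMeasure_Ici ht
    _ = tailMeasure k G (Set.Ici t) := by
        simp only [tailMeasure, Measure.coe_add, Measure.coe_smul, Pi.add_apply, Pi.smul_apply,
          smul_eq_mul, hA, hB, hC]

end TailMeasure

/-! ### Poisson limits of the numbers of sample points in shrinking sets. -/

section PoissonLimit

/-- The probability that a Poisson variable of mean `r` is less than `k`. -/
noncomputable def poissonBelow (k : ℕ) (r : ℝ) : ℝ :=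
  ∑ j ∈ Finset.range k, Real.exp (-r) * (r ^ j / j.factorial)

/-- The number of coordinates of `z` in `B`. -/
noncomputable def countIn {E : Type*} {n : ℕ} (B : Set E) (z : Fin n → E) : ℕ :=
  by classical exact (Finset.univ.filter fun l => z l ∈ B).card

lemma countIn_empty {E : Type*} {n : ℕ} (z : Fin n → E) : countIn (∅ : Set E) z = 0 := by
  simp [countIn]

variable {E : Type*} [MeasurableSpace E] (G : Measure E) [IsProbabilityMeasure G]

lemma measurable_countIn {n : ℕ} {B : Set E} (hB : MeasurableSet B) :
    Measurable fun z : Fin n → E => countIn B z := by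
  classical
  simp only [countIn, Finset.card_filter]
  exact Finset.measurable_sum _ fun l _ =>
    Measurable.ite (measurable_pi_apply l hB) measurable_const measurable_const

open scoped Classical in
-- The multinomial probability: the event splits according to which coordinates lie in `B` and which
-- in `C`, and each piece is a box. The truncated subtractions are harmless, since a binomial
-- coefficient vanishes when `i + j > n`.
lemma pi_countIn_eq_and_countIn_eq {n : ℕ} {B C : Set E} (hB : MeasurableSet B)
    (hC : MeasurableSet C) (hBC : Disjoint B C) (i j : ℕ) :
    (Measure.pi fun _ : Fin n => G).real {z | countIn B z = i ∧ countIn C z = j} =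
      (n.choose i * G.real B ^ i) * ((n - i).choose j * G.real C ^ j) *
        (1 - (G.real B + G.real C)) ^ (n - i - j) := by
  let φ : (Fin n → E) → (Σ _ : Finset (Fin n), Finset (Fin n)) := fun z =>
    ⟨Finset.univ.filter fun l => z l ∈ B, Finset.univ.filter fun l => z l ∈ C⟩
  let F : Finset (Σ _ : Finset (Fin n), Finset (Fin n)) :=
    (Finset.powersetCard i Finset.univ).sigma fun S => Finset.powersetCard j Sᶜ
  let W : (Σ _ : Finset (Fin n), Finset (Fin n)) → Fin n → Set E := fun p l =>
    if l ∈ p.1 then B else if l ∈ p.2 then C else (B ∪ C)ᶜ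
  have hfib : ∀ p ∈ F, φ ⁻¹' {p} = Set.univ.pi (W p) := by
    rintro ⟨S, T⟩ hp
    have hT : T ⊆ Sᶜ := (Finset.mem_powersetCard.1 (Finset.mem_sigma.1 hp).2).1
    ext z
    simp only [Set.mem_preimage, Set.mem_singleton_iff, Set.mem_pi, Set.mem_univ, true_implies, φ,
      W, Sigma.mk.injEq, heq_eq_eq]
    constructor
    · rintro ⟨rfl, rfl⟩ l
      by_cases h1 : z l ∈ B
      · simp [h1]
      · by_cases h2 : z l ∈ C <;> simp [h1, h2]
    · intro h
      have hS : ∀ l, l ∈ S → l ∉ T := fun l hl hlT => (Finset.mem_compl.1 (hT hlT)) hl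
      have hd : ∀ x, x ∈ B → x ∉ C := fun x hx hx' => Set.disjoint_left.1 hBC hx hx'
      constructor
      · ext l
        have := h l
        by_cases h1 : l ∈ S
        · simpa [h1] using this
        · by_cases h2 : l ∈ T
          · simp only [h1, h2, if_false, if_true] at this
            simpa [h1] using fun hb => hd _ hb this
          · simp only [h1, h2, if_false] at this
            simpa [h1] using fun hb => this (Or.inl hb)
      · ext l
        have := h l
        by_cases h1 : l ∈ S
        · simp only [h1, if_true] at this
          simpa [hS l h1] using hd _ this
        · by_cases h2 : l ∈ T
          · simpa [h1, h2] using this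
          · simp only [h1, h2, if_false] at this
            simpa [h2] using fun hc => this (Or.inr hc)
  have hevent : {z : Fin n → E | countIn B z = i ∧ countIn C z = j} = ⋃ p ∈ F, φ ⁻¹' {p} := by
    ext z
    simp only [Set.mem_ofPred_eq, Set.mem_iUnion, Set.mem_preimage, Set.mem_singleton_iff,
      exists_prop, exists_eq_right']
    rw [Finset.mem_sigma, Finset.mem_powersetCard, Finset.mem_powersetCard]
    simp only [φ, Finset.subset_univ, true_and, countIn]
    constructor
    · rintro ⟨h1, h2⟩
      refine ⟨by convert h1, ?_, by convert h2⟩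
      intro l hl
      rw [Finset.mem_compl, Finset.mem_filter]
      exact fun hl' => Set.disjoint_left.1 hBC hl'.2 (Finset.mem_filter.1 hl).2
    · rintro ⟨h1, -, h2⟩
      exact ⟨by convert h1, by convert h2⟩
  have hWm : ∀ p l, MeasurableSet (W p l) := by
    intro p l
    simp only [W]
    split_ifs
    exacts [hB, hC, (hB.union hC).compl]
  have hrest : G.real (B ∪ C)ᶜ = 1 - (G.real B + G.real C) := by
    rw [probReal_compl_eq_one_sub (hB.union hC), measureReal_union hBC hC]
  have hval : ∀ p ∈ F, (Measure.pi fun _ : Fin n => G).real (φ ⁻¹' {p}) =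
      G.real B ^ i * G.real C ^ j * (1 - (G.real B + G.real C)) ^ (n - i - j) := by
    rintro p hp
    rw [hfib p hp, measureReal_def, Measure.pi_pi, ENNReal.toReal_prod]
    obtain ⟨S, T⟩ := p
    obtain ⟨h1, h2⟩ := Finset.mem_sigma.1 hp
    have hS : S.card = i := (Finset.mem_powersetCard.1 h1).2
    have hT : T ⊆ Sᶜ := (Finset.mem_powersetCard.1 h2).1
    have hTj : T.card = j := (Finset.mem_powersetCard.1 h2).2
    have hprod : ∏ l, (G (W ⟨S, T⟩ l)).toReal =
        ∏ l, if l ∈ S then G.real B else if l ∈ T then G.real C else G.real (B ∪ C)ᶜ := by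
      refine Finset.prod_congr rfl fun l _ => ?_
      simp only [W]
      split_ifs <;> rfl
    have e1 : (Finset.univ.filter fun l => l ∈ S) = S := by ext; simp
    have e2 : (Finset.univ.filter fun l => l ∉ S) = Sᶜ := by ext; simp
    have e3 : (Sᶜ.filter fun l => l ∈ T) = T := by
      ext l
      rw [Finset.mem_filter]
      exact ⟨fun h => h.2, fun h => ⟨hT h, h⟩⟩
    have e4 : (Sᶜ.filter fun l => l ∉ T) = Sᶜ \ T := by ext l; simp
    rw [hprod, Finset.prod_ite, e1, e2, Finset.prod_ite, e3, e4, Finset.prod_const,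
      Finset.prod_const, Finset.prod_const, Finset.card_sdiff_of_subset hT, Finset.card_compl,
      Fintype.card_fin, hS, hTj, hrest, mul_assoc]
  rw [hevent, measureReal_biUnion_finset (Set.pairwiseDisjoint_fiber φ _)
    fun p hp => by rw [hfib p hp]; exact MeasurableSet.univ_pi (hWm p), Finset.sum_congr rfl hval,
    Finset.sum_const, Finset.card_sigma]
  have hcard : ∑ S ∈ Finset.powersetCard i (Finset.univ : Finset (Fin n)),
      (Finset.powersetCard j Sᶜ).card = n.choose i * (n - i).choose j := by
    rw [Finset.sum_congr rfl (g := fun _ => (n - i).choose j), Finset.sum_const,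
      Finset.card_powersetCard, Finset.card_univ, Fintype.card_fin, smul_eq_mul]
    intro S hS
    rw [Finset.card_powersetCard, Finset.card_compl, Fintype.card_fin,
      (Finset.mem_powersetCard.1 hS).2]
  rw [hcard, nsmul_eq_mul]
  push_cast
  ring

lemma tendsto_pow_sub_of_tendsto_mul {x : ℕ → ℝ} {r : ℝ}
    (hx : Tendsto (fun n : ℕ => n * x n) atTop (𝓝 r)) (m : ℕ) :
    Tendsto (fun n => (1 - x n) ^ (n - m)) atTop (𝓝 (Real.exp (-r))) := by
  have h0 : Tendsto (fun n => 1 - x n) atTop (𝓝 1) := by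
    simpa using tendsto_const_nhds.sub (tendsto_zero_of_tendsto_mul_atTop hx)
  have h1 : Tendsto (fun n => (1 + -x n) ^ n) atTop (𝓝 (Real.exp (-r))) :=
    Real.tendsto_one_add_pow_exp_of_tendsto (by simpa using hx.neg)
  have h2 := h1.mul ((h0.pow m).inv₀ (by simp))
  simp only [one_pow, inv_one, mul_one] at h2
  refine h2.congr' ?_
  filter_upwards [eventually_ge_atTop m, h0.eventually_ne one_ne_zero] with n hn hne
  rw [pow_sub₀ _ hne hn, sub_eq_add_neg]

lemma tendsto_choose_sub_mul_pow {x : ℕ → ℝ} {r : ℝ}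
    (hx : Tendsto (fun n : ℕ => n * x n) atTop (𝓝 r)) (i j : ℕ) :
    Tendsto (fun n => ((n - i).choose j : ℝ) * x n ^ j) atTop (𝓝 (r ^ j / j.factorial)) := by
  have h : Tendsto (fun m : ℕ => (m : ℝ) * x (m + i)) atTop (𝓝 r) := by
    have h1 := (tendsto_add_atTop_iff_nat i).2 hx
    have h2 := (tendsto_add_atTop_iff_nat i).2 (tendsto_zero_of_tendsto_mul_atTop hx)
    have h3 := h1.sub (h2.const_mul (i : ℝ))
    rw [mul_zero, sub_zero] at h3
    refine h3.congr fun m => ?_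
    push_cast
    ring
  have h4 := (tendsto_choose_mul_pow_atTop j h).comp (tendsto_sub_atTop_nat i)
  refine h4.congr' ?_
  filter_upwards [eventually_ge_atTop i] with n hn
  simp [Nat.sub_add_cancel hn]

/-- Disjointness makes the pair of counts multinomial, and each multinomial probability tends to a
product of two Poisson ones: `exp (-(r + s))` factors and the two binomial coefficients decouple. -/
lemma tendsto_pi_countIn_lt_and_lt (k : ℕ) {B C : ℕ → Set E} (hB : ∀ n, MeasurableSet (B n))
    (hC : ∀ n, MeasurableSet (C n)) (hBC : ∀ᶠ n in atTop, Disjoint (B n) (C n)) {r s : ℝ}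
    (hr : Tendsto (fun n : ℕ => n * G.real (B n)) atTop (𝓝 r))
    (hs : Tendsto (fun n : ℕ => n * G.real (C n)) atTop (𝓝 s)) :
    Tendsto (fun n => (Measure.pi fun _ : Fin n => G).real
      {z | countIn (B n) z < k ∧ countIn (C n) z < k}) atTop
      (𝓝 (poissonBelow k r * poissonBelow k s)) := by
  have hlim : Tendsto (fun n => ∑ i ∈ Finset.range k, ∑ j ∈ Finset.range k,
      (n.choose i * G.real (B n) ^ i) * ((n - i).choose j * G.real (C n) ^ j) *
        (1 - (G.real (B n) + G.real (C n))) ^ (n - (i + j))) atTop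
      (𝓝 (∑ i ∈ Finset.range k, ∑ j ∈ Finset.range k,
        (r ^ i / i.factorial) * (s ^ j / j.factorial) * Real.exp (-(r + s)))) := by
    refine tendsto_finsetSum _ fun i _ => tendsto_finsetSum _ fun j _ => ?_
    refine ((tendsto_choose_mul_pow_atTop i hr).mul (tendsto_choose_sub_mul_pow hs i j)).mul
      (tendsto_pow_sub_of_tendsto_mul ?_ (i + j))
    simpa [mul_add] using hr.add hs
  have hval : ∑ i ∈ Finset.range k, ∑ j ∈ Finset.range k,
      (r ^ i / i.factorial) * (s ^ j / j.factorial) * Real.exp (-(r + s)) =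
      poissonBelow k r * poissonBelow k s := by
    rw [poissonBelow, poissonBelow, Finset.sum_mul_sum]
    refine Finset.sum_congr rfl fun i _ => Finset.sum_congr rfl fun j _ => ?_
    rw [neg_add, Real.exp_add]
    ring
  rw [← hval]
  refine hlim.congr' ?_
  filter_upwards [hBC] with n hn
  have hset : {z : Fin n → E | countIn (B n) z < k ∧ countIn (C n) z < k} =
      ⋃ p ∈ Finset.range k ×ˢ Finset.range k,
        (fun z : Fin n → E => (countIn (B n) z, countIn (C n) z)) ⁻¹' {p} := by
    ext z
    simp
  have hm : Measurable fun z : Fin n → E => (countIn (B n) z, countIn (C n) z) :=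
    (measurable_countIn (hB n)).prodMk (measurable_countIn (hC n))
  rw [hset, measureReal_biUnion_finset (Set.pairwiseDisjoint_fiber _ _)
    fun p _ => hm (measurableSet_singleton p), Finset.sum_product]
  refine Finset.sum_congr rfl fun i _ => Finset.sum_congr rfl fun j _ => ?_
  rw [← Nat.sub_sub, ← pi_countIn_eq_and_countIn_eq G (hB n) (hC n) hn i j]
  congr 1
  ext z
  simp

lemma poissonBelow_zero {k : ℕ} (hk : 1 ≤ k) : poissonBelow k 0 = 1 := by
  rw [poissonBelow, Finset.sum_eq_single 0]
  · simp
  · intro j _ hj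
    simp [hj]
  · intro h
    simp at h
    omega

lemma tendsto_pi_countIn_lt {k : ℕ} (hk : 1 ≤ k) {B : ℕ → Set E} (hB : ∀ n, MeasurableSet (B n))
    {r : ℝ} (hr : Tendsto (fun n : ℕ => n * G.real (B n)) atTop (𝓝 r)) :
    Tendsto (fun n => (Measure.pi fun _ : Fin n => G).real {z | countIn (B n) z < k}) atTop
      (𝓝 (poissonBelow k r)) := by
  have h := tendsto_pi_countIn_lt_and_lt G k (C := fun _ => ∅) hB (fun _ => MeasurableSet.empty)
    (Eventually.of_forall fun _ => Set.disjoint_empty _) hr (s := 0) (by simp)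
  rw [poissonBelow_zero hk, mul_one] at h
  refine h.congr fun n => ?_
  congr 1
  ext z
  simp only [countIn_empty, Set.mem_ofPred_eq, and_iff_left_iff_imp]
  omega

/-- Separates two centres from the remaining `n` points, so that one can condition on the centres.
-/
lemma measurePreserving_cons_cons (n : ℕ) :
    MeasurePreserving (fun q : (E × E) × (Fin n → E) =>
      (Fin.cons q.1.1 (Fin.cons q.1.2 q.2 : Fin (n + 1) → E) : Fin (n + 2) → E))
      ((G.prod G).prod (Measure.pi fun _ => G)) (Measure.pi fun _ => G) := by
  have hm : Measurable fun q : (E × E) × (Fin n → E) =>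
      (Fin.cons q.1.1 (Fin.cons q.1.2 q.2 : Fin (n + 1) → E) : Fin (n + 2) → E) := by
    refine measurable_pi_lambda _ fun l => ?_
    refine Fin.cases ?_ (fun l => Fin.cases ?_ (fun l => ?_) l) l
    · simpa using measurable_fst.fst
    · simpa using measurable_fst.snd
    · exact (measurable_pi_apply l).comp measurable_snd
  refine ⟨hm, (Measure.pi_eq fun s hs => ?_).symm⟩
  rw [Measure.map_apply hm (MeasurableSet.univ_pi hs)]
  have : (fun q : (E × E) × (Fin n → E) =>
      (Fin.cons q.1.1 (Fin.cons q.1.2 q.2 : Fin (n + 1) → E) : Fin (n + 2) → E)) ⁻¹'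
      Set.univ.pi s = (s 0 ×ˢ s (Fin.succ 0)) ×ˢ Set.univ.pi fun l : Fin n => s l.succ.succ := by
    ext q
    simp only [Set.mem_preimage, Set.mem_pi, Set.mem_univ, true_implies, Set.mem_prod,
      Fin.forall_fin_succ (n := n + 1), Fin.forall_fin_succ (n := n), Fin.cons_zero, Fin.cons_succ]
    tauto
  rw [this, Measure.prod_prod, Measure.prod_prod, Measure.pi_pi, Fin.prod_univ_succ,
    Fin.prod_univ_succ, mul_assoc]

lemma pi_real_eq_integral_cons_cons {n : ℕ} {S : Set (Fin (n + 2) → E)} (hS : MeasurableSet S) :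
    (Measure.pi fun _ : Fin (n + 2) => G).real S =
      ∫ p : E × E, (Measure.pi fun _ : Fin n => G).real
        {z | (Fin.cons p.1 (Fin.cons p.2 z : Fin (n + 1) → E) : Fin (n + 2) → E) ∈ S}
        ∂(G.prod G) := by
  have hmp := measurePreserving_cons_cons G n
  have hS' := hmp.measurable hS
  rw [measureReal_def, ← hmp.measure_preimage hS.nullMeasurableSet, Measure.prod_apply hS',
    ← integral_toReal (measurable_measure_prodMk_left hS').aemeasurable
      (ae_of_all _ fun _ => measure_lt_top _ _)]
  rfl

end PoissonLimit

/-! ### Limiting survival functions of one statistic and of a pair. -/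

section KNNLimit

variable {d k : ℕ} (G : Measure (EuclideanSpace ℝ (Fin d))) [IsProbabilityMeasure G]

/-- Below the distance of the two centres, neither counts the other, so only the remaining points
matter. -/
lemma nearCount_cons_cons_zero {n : ℕ} (a b : EuclideanSpace ℝ (Fin d))
    (z : Fin n → EuclideanSpace ℝ (Fin d)) {r : ℝ} (h : r < dist a b) :
    nearCount (Fin.cons a (Fin.cons b z : Fin (n + 1) → EuclideanSpace ℝ (Fin d)) :
      Fin (n + 2) → EuclideanSpace ℝ (Fin d)) 0 r = countIn (Metric.closedBall a r) z := by
  rw [nearCount_eq_sum, Fin.sum_univ_succ, Fin.sum_univ_succ, countIn, Finset.card_filter]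
  simp [dist_comm b a, h]

lemma nearCount_cons_cons_one {n : ℕ} (a b : EuclideanSpace ℝ (Fin d))
    (z : Fin n → EuclideanSpace ℝ (Fin d)) {r : ℝ} (h : r < dist a b) :
    nearCount (Fin.cons a (Fin.cons b z : Fin (n + 1) → EuclideanSpace ℝ (Fin d)) :
      Fin (n + 2) → EuclideanSpace ℝ (Fin d)) 1 r = countIn (Metric.closedBall b r) z := by
  rw [nearCount_eq_sum, Fin.sum_univ_succ, Fin.sum_univ_succ, countIn, Finset.card_filter]
  have h1 : (Fin.cons a (Fin.cons b z : Fin (n + 1) → EuclideanSpace ℝ (Fin d)) :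
      Fin (n + 2) → EuclideanSpace ℝ (Fin d)) 1 = b := rfl
  have h2 : ∀ l : Fin n, (l.succ.succ : Fin (n + 2)) ≠ 1 := fun l hl =>
    Fin.succ_ne_zero l (Fin.succ_injective _ hl)
  simp [h1, h, h2]

lemma tendsto_knnRadius (hd : 1 ≤ d) (s : ℝ) :
    Tendsto (fun n => knnRadius d k (n + 2) s) atTop (𝓝 0) := by
  have hv := unitBallVol_pos d
  have h1 : Tendsto (fun n : ℕ => k * Real.exp s / ((((n + 2 : ℕ) : ℝ) - 1) * unitBallVol d))
      atTop (𝓝 0) := by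
    refine Tendsto.const_div_atTop ?_ _
    refine Tendsto.atTop_mul_const hv ?_
    refine tendsto_atTop_mono (fun n => ?_) tendsto_natCast_atTop_atTop
    push_cast
    linarith
  have hd0 : (0 : ℝ) < (d : ℝ)⁻¹ := by
    have : (0 : ℝ) < d := by exact_mod_cast hd
    positivity
  have h2 := h1.rpow_const (p := (d : ℝ)⁻¹) (Or.inr hd0.le)
  rwa [Real.zero_rpow hd0.ne'] at h2

lemma tendsto_mul_real_closedBall {G : Measure (EuclideanSpace ℝ (Fin d))} (hd : 1 ≤ d) (hk : 1 ≤ k) {x : EuclideanSpace ℝ (Fin d)}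
    (hx : Tendsto (fun r => G (Metric.closedBall x r) / volume (Metric.closedBall x r))
      (𝓝[>] 0) (𝓝 (G.rnDeriv volume x))) (hfin : G.rnDeriv volume x ≠ ⊤) (s : ℝ) :
    Tendsto (fun n : ℕ => n * G.real (Metric.closedBall x (knnRadius d k (n + 2) s))) atTop
      (𝓝 (k * Real.exp s * pdfOf G x)) := by
  have hk0 : (0 : ℝ) < k := by exact_mod_cast hk
  have h1 : Tendsto (fun n => knnRadius d k (n + 2) s) atTop (𝓝[>] 0) := by
    refine tendsto_nhdsWithin_iff.2 ⟨tendsto_knnRadius hd s, ?_⟩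
    filter_upwards [eventually_ge_atTop k] with n hn
    exact knnRadius_pos hk (by omega) s
  have h2 := (ENNReal.tendsto_toReal hfin).comp (hx.comp h1)
  -- The sample size is `n + 2`: `n` points remain to be counted, whereas the volume is normalised
  -- by `n + 1`.
  have h3 : Tendsto (fun n : ℕ => (n : ℝ) / ((n : ℝ) + 1)) atTop (𝓝 1) :=
    tendsto_natCast_div_add_atTop 1
  have h4 := (h3.mul_const (k * Real.exp s)).mul h2
  rw [one_mul] at h4
  refine h4.congr' ?_
  filter_upwards [eventually_ge_atTop k] with n hn
  simp only [Function.comp_apply]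
  rw [volume_closedBall_knnRadius hd hk (by omega), ENNReal.toReal_div, measureReal_def]
  have : (0 : ℝ) < (n : ℝ) + 1 := by positivity
  have hc : (((n + 2 : ℕ) : ℝ) - 1) = n + 1 := by push_cast; ring
  rw [hc, ENNReal.toReal_ofReal (by positivity)]
  have := Real.exp_pos s
  field_simp

lemma ae_tendsto_closedBall :
    ∀ᵐ x ∂(volume : Measure (EuclideanSpace ℝ (Fin d))),
      Tendsto (fun r => G (Metric.closedBall x r) / volume (Metric.closedBall x r))
        (𝓝[>] 0) (𝓝 (G.rnDeriv volume x)) ∧ G.rnDeriv volume x ≠ ⊤ := by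
  filter_upwards [Besicovitch.ae_tendsto_rnDeriv G volume, Measure.rnDeriv_lt_top G volume]
    with x h1 h2 using ⟨h1, h2.ne⟩

lemma ae_prod_ne (hd : 1 ≤ d) (hG : G ≪ volume) : ∀ᵐ p ∂(G.prod G), p.1 ≠ p.2 := by
  have : Nonempty (Fin d) := ⟨⟨0, hd⟩⟩
  refine (Measure.ae_prod_iff_ae_ae (p := fun p => p.1 ≠ p.2)
    (measurableSet_eq_fun measurable_fst measurable_snd).compl).2 ?_
  refine ae_of_all _ fun x => hG.ae_le ?_
  filter_upwards [compl_mem_ae_iff.2 (measure_singleton (μ := volume) x)] with z hz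
  exact fun h => hz h.symm

lemma pi_real_lt_knnLogVol_and_eq (hd : 1 ≤ d) (hk : 1 ≤ k) (hG : G ≪ volume) {n : ℕ}
    (hn : k ≤ n) (s t : ℝ) :
    (Measure.pi fun _ : Fin (n + 2) => G).real {y | s < knnLogVol k y 0 ∧ t < knnLogVol k y 1} =
      ∫ p, (Measure.pi fun _ : Fin n => G).real {z |
        nearCount (Fin.cons p.1 (Fin.cons p.2 z : Fin (n + 1) → EuclideanSpace ℝ (Fin d)) :
          Fin (n + 2) → EuclideanSpace ℝ (Fin d)) 0 (knnRadius d k (n + 2) s) < k ∧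
        nearCount (Fin.cons p.1 (Fin.cons p.2 z : Fin (n + 1) → EuclideanSpace ℝ (Fin d)) :
          Fin (n + 2) → EuclideanSpace ℝ (Fin d)) 1 (knnRadius d k (n + 2) t) < k}
        ∂(G.prod G) := by
  have hkN : k + 1 ≤ n + 2 := by omega
  have hS : MeasurableSet {y : Fin (n + 2) → EuclideanSpace ℝ (Fin d) |
      nearCount y 0 (knnRadius d k (n + 2) s) < k ∧
      nearCount y 1 (knnRadius d k (n + 2) t) < k} :=
    (measurableSet_lt (measurable_nearCount 0 _) measurable_const).inter
      (measurableSet_lt (measurable_nearCount 1 _) measurable_const)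
  refine Eq.trans ?_ (pi_real_eq_integral_cons_cons G hS)
  refine measureReal_congr ?_
  filter_upwards [ae_knnDist_pos G hd hk hkN hG 0, ae_knnDist_pos G hd hk hkN hG 1] with y h0 h1
  exact propext (and_congr (lt_knnLogVol_iff hd hk hkN h0 s) (lt_knnLogVol_iff hd hk hkN h1 t))

lemma pi_real_lt_knnLogVol_eq (hd : 1 ≤ d) (hk : 1 ≤ k) (hG : G ≪ volume) {n : ℕ}
    (hn : k ≤ n) (s : ℝ) :
    (Measure.pi fun _ : Fin (n + 2) => G).real {y | s < knnLogVol k y 0} =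
      ∫ p, (Measure.pi fun _ : Fin n => G).real {z |
        nearCount (Fin.cons p.1 (Fin.cons p.2 z : Fin (n + 1) → EuclideanSpace ℝ (Fin d)) :
          Fin (n + 2) → EuclideanSpace ℝ (Fin d)) 0 (knnRadius d k (n + 2) s) < k}
        ∂(G.prod G) := by
  have hkN : k + 1 ≤ n + 2 := by omega
  have hS : MeasurableSet {y : Fin (n + 2) → EuclideanSpace ℝ (Fin d) |
      nearCount y 0 (knnRadius d k (n + 2) s) < k} :=
    measurableSet_lt (measurable_nearCount 0 _) measurable_const
  refine Eq.trans ?_ (pi_real_eq_integral_cons_cons G hS)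
  refine measureReal_congr ?_
  filter_upwards [ae_knnDist_pos G hd hk hkN hG 0] with y h0
  exact propext (lt_knnLogVol_iff hd hk hkN h0 s)

/-- The limiting survival function of `knnLogVol`, conditionally on the centre `x`. -/
noncomputable def knnSurvival (k : ℕ) (s : ℝ) (x : EuclideanSpace ℝ (Fin d)) : ℝ :=
  poissonBelow k (k * Real.exp s * pdfOf G x)

lemma tendsto_integral_real {F : ℕ → Type*} [∀ n, MeasurableSpace (F n)]
    {α : Type*} [MeasurableSpace α] {μ : Measure α} [IsFiniteMeasure μ]
    {P : ∀ n, Measure (F n)} [∀ n, IsProbabilityMeasure (P n)] {S : ∀ n, Set (α × F n)}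
    (hS : ∀ n, MeasurableSet (S n)) {f : α → ℝ}
    (hf : ∀ᵐ x ∂μ, Tendsto (fun n => (P n).real (Prod.mk x ⁻¹' S n)) atTop (𝓝 (f x))) :
    Tendsto (fun n => ∫ x, (P n).real (Prod.mk x ⁻¹' S n) ∂μ) atTop (𝓝 (∫ x, f x ∂μ)) := by
  refine tendsto_integral_of_dominated_convergence (fun _ => 1)
    (fun n => (measurable_measure_prodMk_left (hS n)).ennreal_toReal.aestronglyMeasurable)
    (integrable_const 1) (fun n => ae_of_all _ fun x => ?_) hf
  rw [Real.norm_of_nonneg measureReal_nonneg]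
  exact measureReal_le_one

lemma measurable_nearCount_cons_cons (n : ℕ) (i : Fin (n + 2)) (r : ℝ) :
    Measurable fun q : (EuclideanSpace ℝ (Fin d) × EuclideanSpace ℝ (Fin d)) ×
      (Fin n → EuclideanSpace ℝ (Fin d)) => nearCount (Fin.cons q.1.1
        (Fin.cons q.1.2 q.2 : Fin (n + 1) → EuclideanSpace ℝ (Fin d)) :
          Fin (n + 2) → EuclideanSpace ℝ (Fin d)) i r :=
  -- Only measurability of the concatenation is extracted; the Dirac mass is an arbitrary
  -- probability measure.
  (measurable_nearCount i r).comp (measurePreserving_cons_cons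
    (Measure.dirac (0 : EuclideanSpace ℝ (Fin d))) n).measurable

/-- For almost every pair the centres are distinct and both are Lebesgue points. The two balls are
eventually disjoint, the counts become independent Poisson variables, and integration over
independent centres keeps the product form. -/
lemma tendsto_pi_lt_knnLogVol_and (hd : 1 ≤ d) (hk : 1 ≤ k) (hG : G ≪ volume) (s t : ℝ) :
    Tendsto (fun n => (Measure.pi fun _ : Fin (n + 2) => G).real
      {y | s < knnLogVol k y 0 ∧ t < knnLogVol k y 1}) atTop
      (𝓝 ((∫ x, knnSurvival G k s x ∂G) * ∫ x, knnSurvival G k t x ∂G)) := by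
  rw [← integral_prod_mul]
  refine Tendsto.congr' (f₁ := fun n => ∫ p, (Measure.pi fun _ : Fin n => G).real
    (Prod.mk p ⁻¹' {q : (EuclideanSpace ℝ (Fin d) × EuclideanSpace ℝ (Fin d)) ×
      (Fin n → EuclideanSpace ℝ (Fin d)) |
        nearCount (Fin.cons q.1.1 (Fin.cons q.1.2 q.2 : Fin (n + 1) → EuclideanSpace ℝ (Fin d)) :
          Fin (n + 2) → EuclideanSpace ℝ (Fin d)) 0 (knnRadius d k (n + 2) s) < k ∧
        nearCount (Fin.cons q.1.1 (Fin.cons q.1.2 q.2 : Fin (n + 1) → EuclideanSpace ℝ (Fin d)) :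
          Fin (n + 2) → EuclideanSpace ℝ (Fin d)) 1 (knnRadius d k (n + 2) t) < k})
        ∂(G.prod G)) ?_ (tendsto_integral_real (fun n => ?_) ?_)
  · filter_upwards [eventually_ge_atTop k] with n hn
    exact (pi_real_lt_knnLogVol_and_eq G hd hk hG hn s t).symm
  · exact (measurableSet_lt (measurable_nearCount_cons_cons n 0 _) measurable_const).inter
      (measurableSet_lt (measurable_nearCount_cons_cons n 1 _) measurable_const)
  · have hgood := hG.ae_le (ae_tendsto_closedBall G)
    filter_upwards [ae_prod_ne G hd hG, Measure.quasiMeasurePreserving_fst.ae hgood,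
      Measure.quasiMeasurePreserving_snd.ae hgood] with p hp h1 h2
    have hdist : 0 < dist p.1 p.2 := dist_pos.2 hp
    have es := (tendsto_knnRadius (k := k) hd s).eventually (gt_mem_nhds (half_pos hdist))
    have et := (tendsto_knnRadius (k := k) hd t).eventually (gt_mem_nhds (half_pos hdist))
    have hlim := tendsto_pi_countIn_lt_and_lt G k
      (B := fun n => Metric.closedBall p.1 (knnRadius d k (n + 2) s))
      (C := fun n => Metric.closedBall p.2 (knnRadius d k (n + 2) t))
      (fun n => measurableSet_closedBall) (fun n => measurableSet_closedBall)
      (by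
        filter_upwards [es, et] with n h3 h4
        exact Metric.closedBall_disjoint_closedBall (by linarith))
      (tendsto_mul_real_closedBall hd hk h1.1 h1.2 s)
      (tendsto_mul_real_closedBall hd hk h2.1 h2.2 t)
    refine hlim.congr' ?_
    filter_upwards [es, et] with n h3 h4
    congr 1
    ext z
    simp only [Set.mem_preimage, Set.mem_ofPred_eq]
    rw [nearCount_cons_cons_zero _ _ _ (by linarith), nearCount_cons_cons_one _ _ _ (by linarith)]

lemma tendsto_pi_lt_knnLogVol (hd : 1 ≤ d) (hk : 1 ≤ k) (hG : G ≪ volume) (s : ℝ) :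
    Tendsto (fun n => (Measure.pi fun _ : Fin (n + 2) => G).real {y | s < knnLogVol k y 0}) atTop
      (𝓝 (∫ x, knnSurvival G k s x ∂G)) := by
  have hfst : ∫ x, knnSurvival G k s x ∂G = ∫ p : EuclideanSpace ℝ (Fin d) ×
      EuclideanSpace ℝ (Fin d), knnSurvival G k s p.1 ∂(G.prod G) := by
    rw [integral_fun_fst]
    simp
  rw [hfst]
  refine Tendsto.congr' (f₁ := fun n => ∫ p, (Measure.pi fun _ : Fin n => G).real
    (Prod.mk p ⁻¹' {q : (EuclideanSpace ℝ (Fin d) × EuclideanSpace ℝ (Fin d)) ×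
      (Fin n → EuclideanSpace ℝ (Fin d)) |
        nearCount (Fin.cons q.1.1 (Fin.cons q.1.2 q.2 : Fin (n + 1) → EuclideanSpace ℝ (Fin d)) :
          Fin (n + 2) → EuclideanSpace ℝ (Fin d)) 0 (knnRadius d k (n + 2) s) < k})
        ∂(G.prod G)) ?_ (tendsto_integral_real (fun n => ?_) ?_)
  · filter_upwards [eventually_ge_atTop k] with n hn
    exact (pi_real_lt_knnLogVol_eq G hd hk hG hn s).symm
  · exact measurableSet_lt (measurable_nearCount_cons_cons n 0 _) measurable_const
  · have hgood := hG.ae_le (ae_tendsto_closedBall G)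
    filter_upwards [ae_prod_ne G hd hG, Measure.quasiMeasurePreserving_fst.ae hgood] with p hp h1
    have hdist : 0 < dist p.1 p.2 := dist_pos.2 hp
    have es := (tendsto_knnRadius (k := k) hd s).eventually (gt_mem_nhds hdist)
    have hlim := tendsto_pi_countIn_lt G hk
      (B := fun n => Metric.closedBall p.1 (knnRadius d k (n + 2) s))
      (fun n => measurableSet_closedBall) (tendsto_mul_real_closedBall hd hk h1.1 h1.2 s)
    refine hlim.congr' ?_
    filter_upwards [es] with n h3
    congr 1
    ext z
    simp only [Set.mem_preimage, Set.mem_ofPred_eq]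
    rw [nearCount_cons_cons_zero _ _ _ h3]

end KNNLimit

/-! ### Mean and variance of the logarithm of a gamma variable, and Poisson-gamma duality. -/

section GammaLog

/-- This is `|v| ≤ |sinh v|` at `v = log u / 2`, because `4 * sinh v ^ 2 = u - 2 + u⁻¹`. The bound
vanishes at `u = 1`, which is what later makes the variance tend to zero. -/
lemma sq_log_le {u : ℝ} (hu : 0 < u) : Real.log u ^ 2 ≤ u - 2 + u⁻¹ := by
  have h : (Real.log u / 2) ^ 2 ≤ Real.sinh (Real.log u / 2) ^ 2 := by
    rw [sq_le_sq]
    rcases le_total 0 (Real.log u / 2) with h | h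
    · rw [abs_of_nonneg h, abs_of_nonneg (Real.sinh_nonneg_iff.2 h)]
      exact Real.self_le_sinh_iff.2 h
    · rw [abs_of_nonpos h, abs_of_nonpos (Real.sinh_nonpos_iff.2 h)]
      exact neg_le_neg (Real.sinh_le_self_iff.2 h)
  have h1 : Real.exp (Real.log u / 2) ^ 2 = u := by
    rw [← Real.exp_nat_mul, show ((2 : ℕ) : ℝ) * (Real.log u / 2) = Real.log u by push_cast; ring,
      Real.exp_log hu]
  have h2 : Real.exp (-(Real.log u / 2)) ^ 2 = u⁻¹ := by
    rw [Real.exp_neg, inv_pow, h1]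
  have h3 : Real.exp (Real.log u / 2) * Real.exp (-(Real.log u / 2)) = 1 := by
    rw [← Real.exp_add]
    simp
  rw [Real.sinh_eq] at h
  nlinarith

lemma sq_log_le_rpow {x : ℝ} (hx : 0 < x) :
    Real.log x ^ 2 ≤ 4 * (x ^ (1 / 2 : ℝ) + x ^ (-1 / 2 : ℝ)) := by
  have hp : 0 < x ^ (1 / 2 : ℝ) := Real.rpow_pos_of_pos hx _
  have h := sq_log_le hp
  rw [Real.log_rpow hx, ← Real.rpow_neg hx.le] at h
  have : (-(1 / 2) : ℝ) = -1 / 2 := by norm_num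
  rw [this] at h
  nlinarith

lemma integrableOn_pow_mul_exp_neg_mul_rpow (n : ℕ) {s : ℝ} (hs : -1 < n + s) :
    IntegrableOn (fun x : ℝ => x ^ n * Real.exp (-x) * x ^ s) (Set.Ioi 0) := by
  refine (Real.GammaIntegral_convergent (s := n + s + 1) (by linarith)).congr_fun
    (fun x hx => ?_) measurableSet_Ioi
  have hx' : (0 : ℝ) < x := hx
  simp only [add_sub_cancel_right]
  rw [Real.rpow_add hx', Real.rpow_natCast]
  ring

lemma integrableOn_pow_mul_exp_neg_mul_sq_log (n : ℕ) :
    IntegrableOn (fun x : ℝ => x ^ n * Real.exp (-x) * Real.log x ^ 2) (Set.Ioi 0) := by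
  have h := ((integrableOn_pow_mul_exp_neg_mul_rpow n (s := 1 / 2)
    (by linarith [(Nat.cast_nonneg n : (0 : ℝ) ≤ n)])).add
    (integrableOn_pow_mul_exp_neg_mul_rpow n (s := -1 / 2)
    (by linarith [(Nat.cast_nonneg n : (0 : ℝ) ≤ n)]))).const_mul 4
  refine Integrable.mono' h (by fun_prop) ?_
  filter_upwards [ae_restrict_mem measurableSet_Ioi] with x hx
  have hx' : (0 : ℝ) < x := hx
  have hw : 0 ≤ x ^ n * Real.exp (-x) := by positivity
  rw [Real.norm_of_nonneg (by positivity)]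
  refine (mul_le_mul_of_nonneg_left (sq_log_le_rpow hx') hw).trans (le_of_eq ?_)
  simp only [Pi.add_apply]
  ring

lemma integrable_gammaMeasure_nat_iff (n : ℕ) {f : ℝ → ℝ} :
    Integrable f (gammaMeasure ((n + 1 : ℕ) : ℝ) 1) ↔
      IntegrableOn (fun x => x ^ n * Real.exp (-x) * f x) (Set.Ioi 0) := by
  rw [integrable_gammaMeasure_iff (by positivity) one_pos]
  refine integrableOn_congr_fun (fun x _ => ?_) measurableSet_Ioi
  simp

lemma integral_gammaMeasure_nat (n : ℕ) (f : ℝ → ℝ) :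
    ∫ x, f x ∂(gammaMeasure ((n + 1 : ℕ) : ℝ) 1) =
      (n.factorial : ℝ)⁻¹ * ∫ x in Set.Ioi 0, x ^ n * Real.exp (-x) * f x := by
  rw [integral_gammaMeasure (by positivity) one_pos]
  simp [Real.Gamma_nat_eq_factorial]

instance isProbabilityMeasure_gammaMeasure_nat (n : ℕ) :
    IsProbabilityMeasure (gammaMeasure ((n + 1 : ℕ) : ℝ) 1) :=
  isProbabilityMeasure_gammaMeasure (by positivity) one_pos

lemma memLp_log_gammaMeasure (n : ℕ) :
    MemLp Real.log 2 (gammaMeasure ((n + 1 : ℕ) : ℝ) 1) := by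
  rw [memLp_two_iff_integrable_sq Real.measurable_log.aestronglyMeasurable,
    integrable_gammaMeasure_nat_iff]
  exact integrableOn_pow_mul_exp_neg_mul_sq_log n

lemma integrable_log_gammaMeasure (n : ℕ) :
    Integrable Real.log (gammaMeasure ((n + 1 : ℕ) : ℝ) 1) :=
  (memLp_log_gammaMeasure n).integrable one_le_two

/-- Differentiating the Gamma integral under the integral sign produces the logarithm; the result is
compared with the known derivative of `Complex.Gamma` at `n + 1`. -/
lemma integral_log_gammaMeasure (n : ℕ) :
    ∫ x, Real.log x ∂(gammaMeasure ((n + 1 : ℕ) : ℝ) 1) =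
      harmonic n - Real.eulerMascheroniConstant := by
  have hre : (0 : ℝ) < ((n : ℂ) + 1).re := by
    simp
    positivity
  have h1 := (Complex.hasDerivAt_GammaIntegral hre).congr_of_eventuallyEq
    (f₁ := Complex.Gamma) (by
      have : IsOpen {s : ℂ | 0 < s.re} := Complex.continuous_re.isOpen_preimage _ isOpen_Ioi
      filter_upwards [this.mem_nhds hre] with a ha using Complex.Gamma_eq_integral ha)
  have h2 := h1.unique (Complex.hasDerivAt_Gamma_nat n)
  have h3 : ∫ t : ℝ in Set.Ioi 0, (t : ℂ) ^ ((n : ℂ) + 1 - 1) *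
      ((Real.log t : ℂ) * Real.exp (-t)) =
      ((∫ t : ℝ in Set.Ioi 0, t ^ n * Real.exp (-t) * Real.log t : ℝ) : ℂ) := by
    rw [← integral_complex_ofReal]
    refine setIntegral_congr_fun measurableSet_Ioi fun t _ => ?_
    simp only [add_sub_cancel_right, Complex.cpow_natCast]
    push_cast
    ring
  rw [h3] at h2
  have h4 : ∫ t : ℝ in Set.Ioi 0, t ^ n * Real.exp (-t) * Real.log t =
      n.factorial * (-Real.eulerMascheroniConstant + harmonic n) := by exact_mod_cast h2
  rw [integral_gammaMeasure_nat, h4, ← mul_assoc, inv_mul_cancel₀ (by positivity)]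
  ring

lemma tendsto_sq_log_mul_pow_mul_exp_neg (n : ℕ) :
    Tendsto (fun x : ℝ => Real.log x ^ 2 * (x ^ (n + 1) * Real.exp (-x))) atTop (𝓝 0) := by
  have h := (Real.tendsto_pow_mul_exp_neg_atTop_nhds_zero (n + 1 + 2))
  refine squeeze_zero' (g := fun x : ℝ => x ^ (n + 1 + 2) * Real.exp (-x)) ?_ ?_ h
  · filter_upwards [eventually_ge_atTop 1] with x hx
    positivity
  · filter_upwards [eventually_ge_atTop 1] with x hx
    have h0 : 0 ≤ Real.log x := Real.log_nonneg hx
    have h1 : Real.log x ≤ x := (Real.log_le_sub_one_of_pos (by linarith)).trans (by linarith)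
    calc Real.log x ^ 2 * (x ^ (n + 1) * Real.exp (-x))
        ≤ x ^ 2 * (x ^ (n + 1) * Real.exp (-x)) := by gcongr
      _ = _ := by ring

lemma continuousWithinAt_sq_log_mul_pow_mul_exp_neg (n : ℕ) :
    ContinuousWithinAt (fun x : ℝ => Real.log x ^ 2 * (x ^ (n + 1) * Real.exp (-x)))
      (Set.Ici 0) 0 := by
  rw [ContinuousWithinAt]
  simp only [Real.log_zero, ne_eq, OfNat.ofNat_ne_zero, not_false_eq_true, zero_pow, zero_mul]
  have hc : Tendsto (fun x : ℝ => 4 * (x * x ^ (1 / 2 : ℝ) + x ^ (1 / 2 : ℝ)) *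
      (x ^ n * Real.exp (-x))) (𝓝[Set.Ici 0] 0) (𝓝 0) := by
    have h : Continuous fun x : ℝ => 4 * (x * x ^ (1 / 2 : ℝ) + x ^ (1 / 2 : ℝ)) *
        (x ^ n * Real.exp (-x)) := by
      have := Real.continuous_rpow_const (q := 1 / 2) (by norm_num)
      fun_prop
    have h0 := h.tendsto 0
    rw [show (4 : ℝ) * (0 * 0 ^ (1 / 2 : ℝ) + 0 ^ (1 / 2 : ℝ)) * (0 ^ n * Real.exp (-0)) = 0 by
      rw [Real.zero_rpow (by norm_num)]; ring] at h0
    exact h0.mono_left nhdsWithin_le_nhds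
  refine squeeze_zero' ?_ ?_ hc
  · filter_upwards [self_mem_nhdsWithin] with x hx
    have : (0 : ℝ) ≤ x := hx
    positivity
  · filter_upwards [self_mem_nhdsWithin] with x hx
    have hx0 : (0 : ℝ) ≤ x := hx
    rcases hx0.eq_or_lt with rfl | hx'
    · simp
    · have h1 : x * x ^ (-1 / 2 : ℝ) = x ^ (1 / 2 : ℝ) := by
        rw [← Real.rpow_one_add' hx0 (by norm_num)]
        norm_num
      calc Real.log x ^ 2 * (x ^ (n + 1) * Real.exp (-x))
          ≤ 4 * (x ^ (1 / 2 : ℝ) + x ^ (-1 / 2 : ℝ)) * (x ^ (n + 1) * Real.exp (-x)) := by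
            gcongr
            exact sq_log_le_rpow hx'
        _ = 4 * (x * x ^ (1 / 2 : ℝ) + x * x ^ (-1 / 2 : ℝ)) * (x ^ n * Real.exp (-x)) := by ring
        _ = _ := by rw [h1]

/-- Integration by parts: the derivative of `log x ^ 2 * x ^ (n + 1) * exp (-x)` has integral zero
over the half-line, both boundary values being zero. -/
lemma integral_sq_log_gammaMeasure_succ (n : ℕ) :
    ∫ x, Real.log x ^ 2 ∂(gammaMeasure ((n + 2 : ℕ) : ℝ) 1) =
      ∫ x, Real.log x ^ 2 ∂(gammaMeasure ((n + 1 : ℕ) : ℝ) 1) +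
        2 / (n + 1) * ∫ x, Real.log x ∂(gammaMeasure ((n + 1 : ℕ) : ℝ) 1) := by
  have i0 := integrableOn_pow_mul_exp_neg_mul_sq_log n
  have i1 := integrableOn_pow_mul_exp_neg_mul_sq_log (n + 1)
  have i2 := (integrable_gammaMeasure_nat_iff n).1 (integrable_log_gammaMeasure n)
  have j1 : Integrable (fun x => 2 * (x ^ n * Real.exp (-x) * Real.log x) +
      ((n : ℝ) + 1) * (x ^ n * Real.exp (-x) * Real.log x ^ 2))
      (volume.restrict (Set.Ioi (0 : ℝ))) := (i2.const_mul 2).add (i0.const_mul _)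
  have j2 : IntegrableOn (fun x => 2 * (x ^ n * Real.exp (-x) * Real.log x) +
      ((n : ℝ) + 1) * (x ^ n * Real.exp (-x) * Real.log x ^ 2) -
      x ^ (n + 1) * Real.exp (-x) * Real.log x ^ 2) (Set.Ioi 0) := Integrable.sub j1 i1
  have h := integral_Ioi_of_hasDerivAt_of_tendsto
    (continuousWithinAt_sq_log_mul_pow_mul_exp_neg n)
    (f' := fun x => 2 * (x ^ n * Real.exp (-x) * Real.log x) +
      (n + 1) * (x ^ n * Real.exp (-x) * Real.log x ^ 2) -
      x ^ (n + 1) * Real.exp (-x) * Real.log x ^ 2)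
    (fun x hx => by
      have hx' : (0 : ℝ) < x := hx
      have h1 := (Real.hasDerivAt_log hx'.ne').pow 2
      have h2 := (hasDerivAt_pow (n + 1) x).mul ((hasDerivAt_id x).neg.exp)
      refine (h1.mul h2).congr_deriv ?_
      simp only [id, Pi.mul_apply, Pi.pow_apply, Nat.cast_ofNat,
        Nat.add_one_sub_one, Pi.neg_apply]
      push_cast
      field_simp
      ring)
    j2 (tendsto_sq_log_mul_pow_mul_exp_neg n)
  rw [integral_sub j1 i1, integral_add (i2.const_mul 2) (i0.const_mul _), integral_const_mul,
    integral_const_mul] at h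
  simp only [Real.log_zero, ne_eq, OfNat.ofNat_ne_zero, not_false_eq_true, zero_pow, zero_mul,
    sub_zero] at h
  rw [integral_gammaMeasure_nat (n + 1), integral_gammaMeasure_nat n, integral_gammaMeasure_nat n]
  rw [Nat.factorial_succ]
  push_cast
  have hf : (n.factorial : ℝ) ≠ 0 := by positivity
  have hn : (n : ℝ) + 1 ≠ 0 := by positivity
  field_simp
  linarith

lemma variance_log_gammaMeasure_eq (n : ℕ) :
    Var[Real.log; gammaMeasure ((n + 1 : ℕ) : ℝ) 1] =
      ∫ x, Real.log x ^ 2 ∂(gammaMeasure ((n + 1 : ℕ) : ℝ) 1) -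
        (∫ x, Real.log x ∂(gammaMeasure ((n + 1 : ℕ) : ℝ) 1)) ^ 2 := by
  rw [variance_eq_sub (memLp_log_gammaMeasure n)]
  simp

lemma variance_log_gammaMeasure_sub (n : ℕ) :
    Var[Real.log; gammaMeasure ((n + 1 : ℕ) : ℝ) 1] -
      Var[Real.log; gammaMeasure ((n + 2 : ℕ) : ℝ) 1] = 1 / ((n : ℝ) + 1) ^ 2 := by
  have h := variance_log_gammaMeasure_eq (n + 1)
  rw [integral_sq_log_gammaMeasure_succ, integral_log_gammaMeasure (n + 1), harmonic_succ] at h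
  rw [variance_log_gammaMeasure_eq n, h, integral_log_gammaMeasure n]
  push_cast
  field_simp
  ring

lemma integral_pow_gammaMeasure_nat (n m : ℕ) :
    ∫ x in Set.Ioi (0 : ℝ), x ^ n * Real.exp (-x) * x ^ m = (n + m).factorial := by
  rw [← Real.Gamma_nat_eq_factorial, Real.Gamma_eq_integral (by positivity)]
  refine setIntegral_congr_fun measurableSet_Ioi fun x _ => ?_
  simp only [add_sub_cancel_right]
  rw [Real.rpow_natCast, pow_add]
  ring

lemma ae_pos_gammaMeasure (a r : ℝ) : ∀ᵐ x ∂(gammaMeasure a r), 0 < x := by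
  have hm : Measurable (gammaPDF a r) := (measurable_gammaPDFReal a r).ennreal_ofReal
  rw [gammaMeasure, ae_withDensity_iff hm]
  filter_upwards [compl_mem_ae_iff.2 (measure_singleton (μ := volume) (0 : ℝ))] with x hx h
  by_contra! hle
  rcases hle.lt_or_eq with h1 | h1
  · exact h (gammaPDF_of_neg h1)
  · exact hx h1

/-- The variance is at most the second moment about `log (n + 2)`. By `sq_log_le` this is bounded
through the means `n + 2` of `x` and `1 / (n + 1)` of `x⁻¹`, giving `1 - 2 + (n + 2) / (n + 1)`. -/
lemma variance_log_gammaMeasure_le (n : ℕ) :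
    Var[Real.log; gammaMeasure ((n + 2 : ℕ) : ℝ) 1] ≤ 1 / ((n : ℝ) + 1) := by
  set γ := gammaMeasure ((n + 2 : ℕ) : ℝ) 1 with hγ
  have hprob : IsProbabilityMeasure γ := isProbabilityMeasure_gammaMeasure_nat (n + 1)
  have hpos : ∀ᵐ x ∂γ, 0 < x := ae_pos_gammaMeasure _ _
  have hk : (0 : ℝ) < n + 2 := by positivity
  have hi1 : Integrable (fun x : ℝ => x) γ := by
    rw [hγ, integrable_gammaMeasure_nat_iff (n + 1)]
    simpa using integrableOn_pow_mul_exp_neg_mul_rpow (n + 1) (s := 1)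
      (by linarith [(Nat.cast_nonneg (n + 1) : (0 : ℝ) ≤ (n + 1 : ℕ))])
  have hi2 : Integrable (fun x : ℝ => x⁻¹) γ := by
    rw [hγ, integrable_gammaMeasure_nat_iff (n + 1)]
    simpa [Real.rpow_neg_one] using integrableOn_pow_mul_exp_neg_mul_rpow (n + 1) (s := -1)
      (by push_cast; linarith [(Nat.cast_nonneg n : (0 : ℝ) ≤ n)])
  have he1 : ∫ x, x ∂γ = n + 2 := by
    rw [hγ, integral_gammaMeasure_nat (n + 1)]
    have := integral_pow_gammaMeasure_nat (n + 1) 1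
    simp only [pow_one] at this
    rw [this, Nat.factorial_succ (n + 1)]
    push_cast
    have hf : ((n + 1).factorial : ℝ) ≠ 0 := by positivity
    field_simp
    ring
  have he2 : ∫ x, x⁻¹ ∂γ = 1 / (n + 1) := by
    rw [hγ, integral_gammaMeasure_nat (n + 1)]
    have h1 : ∫ x in Set.Ioi (0 : ℝ), x ^ (n + 1) * Real.exp (-x) * x⁻¹ = n.factorial := by
      rw [← Nat.add_zero n, ← integral_pow_gammaMeasure_nat n 0]
      refine setIntegral_congr_fun measurableSet_Ioi fun x hx => ?_
      have hx' : x ≠ 0 := ne_of_gt hx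
      simp only [pow_zero, mul_one, Nat.add_zero]
      field_simp
      ring
    rw [h1, Nat.factorial_succ]
    push_cast
    have hf : (n.factorial : ℝ) ≠ 0 := by positivity
    field_simp
  calc Var[Real.log; γ] = Var[fun x => Real.log x - Real.log (n + 2); γ] :=
        (variance_sub_const Real.measurable_log.aestronglyMeasurable _).symm
    _ ≤ ∫ x, (Real.log x - Real.log (n + 2)) ^ 2 ∂γ :=
        variance_le_expectation_sq (Real.measurable_log.sub_const _).aestronglyMeasurable
    _ ≤ ∫ x, (x * ((n : ℝ) + 2)⁻¹ - 2 + x⁻¹ * (n + 2)) ∂γ := by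
        refine integral_mono_ae
          (((memLp_log_gammaMeasure (n + 1)).sub (memLp_const _)).integrable_sq)
          (((hi1.mul_const _).sub (integrable_const _)).add (hi2.mul_const _)) ?_
        filter_upwards [hpos] with x hx
        have := sq_log_le (u := x / (n + 2)) (by positivity)
        rw [Real.log_div hx.ne' hk.ne', inv_div] at this
        refine this.trans (le_of_eq ?_)
        field_simp
    _ = 1 / (n + 1) := by
        have j : Integrable (fun x : ℝ => x * ((n : ℝ) + 2)⁻¹ - 2) γ :=
          (hi1.mul_const _).sub (integrable_const _)
        rw [integral_add j (hi2.mul_const _), integral_sub (hi1.mul_const _)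
          (integrable_const _), integral_mul_const, integral_mul_const, he1, he2]
        simp
        field_simp
        ring

/-- The differences `variance_log_gammaMeasure_sub` telescope, and the remainder tends to zero. -/
lemma variance_log_gammaMeasure {k : ℕ} (hk : 1 ≤ k) :
    Var[Real.log; gammaMeasure (k : ℝ) 1] = ∑' j : ℕ, 1 / ((k : ℝ) + j) ^ 2 := by
  obtain ⟨n, rfl⟩ : ∃ n, k = n + 1 := ⟨k - 1, by omega⟩
  have hpartial : ∀ m, ∑ j ∈ Finset.range m, 1 / (((n + 1 : ℕ) : ℝ) + j) ^ 2 =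
      Var[Real.log; gammaMeasure ((n + 1 : ℕ) : ℝ) 1] -
        Var[Real.log; gammaMeasure ((n + m + 1 : ℕ) : ℝ) 1] := by
    intro m
    induction m with
    | zero => simp
    | succ m ih =>
      have := variance_log_gammaMeasure_sub (n + m)
      rw [Finset.sum_range_succ, ih, show n + (m + 1) + 1 = n + m + 2 by ring]
      have h2 : (((n + 1 : ℕ) : ℝ) + m) = (((n + m : ℕ) : ℝ) + 1) := by
        push_cast
        ring
      rw [h2, ← this]
      ring
  have hzero : Tendsto (fun m => Var[Real.log; gammaMeasure ((n + m + 1 : ℕ) : ℝ) 1]) atTop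
      (𝓝 0) := by
    rw [← tendsto_add_atTop_iff_nat 1]
    refine squeeze_zero (g := fun m : ℕ => 1 / ((m : ℝ) + 1)) (fun m => variance_nonneg _ _)
      (fun m => ?_) tendsto_one_div_add_atTop_nhds_zero_nat
    refine (variance_log_gammaMeasure_le (n + m)).trans ?_
    push_cast
    gcongr
    linarith [(Nat.cast_nonneg n : (0 : ℝ) ≤ n)]
  refine (HasSum.tsum_eq ?_).symm
  rw [hasSum_iff_tendsto_nat_of_nonneg (fun j => by positivity)]
  simp_rw [hpartial]
  simpa using tendsto_const_nhds.sub hzero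

lemma hasDerivAt_poissonBelow (n : ℕ) (x : ℝ) :
    HasDerivAt (poissonBelow (n + 1)) (-(x ^ n * Real.exp (-x) / n.factorial)) x := by
  have he : HasDerivAt (fun x => Real.exp (-x)) (-Real.exp (-x)) x := by
    simpa using (hasDerivAt_id x).neg.exp
  induction n with
  | zero =>
    have : poissonBelow (0 + 1) = fun x => Real.exp (-x) := by
      ext x
      simp [poissonBelow]
    rw [this]
    simpa using he
  | succ n ih =>
    have : poissonBelow (n + 1 + 1) = fun x => poissonBelow (n + 1) x +
        Real.exp (-x) * (x ^ (n + 1) / (n + 1).factorial) := by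
      ext x
      rw [poissonBelow, Finset.sum_range_succ]
      rfl
    rw [this]
    refine (ih.add (he.mul ((hasDerivAt_pow (n + 1) x).div_const _))).congr_deriv ?_
    rw [Nat.factorial_succ]
    push_cast
    have hf : (n.factorial : ℝ) ≠ 0 := by positivity
    field_simp
    ring

lemma tendsto_poissonBelow_atTop (k : ℕ) : Tendsto (poissonBelow k) atTop (𝓝 0) := by
  have : Tendsto (fun x => ∑ j ∈ Finset.range k, Real.exp (-x) * (x ^ j / j.factorial)) atTop
      (𝓝 (∑ j ∈ Finset.range k, 0 / (j.factorial : ℝ))) := by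
    refine tendsto_finsetSum _ fun j _ => ?_
    refine ((Real.tendsto_pow_mul_exp_neg_atTop_nhds_zero j).div_const _).congr fun x => ?_
    ring
  rw [show (0 : ℝ) = ∑ j ∈ Finset.range k, 0 / (j.factorial : ℝ) by simp]
  exact this

/-- Poisson-gamma duality: the derivative of `poissonBelow k` telescopes to minus the gamma(k, 1)
density, and `poissonBelow k` vanishes at infinity. -/
lemma gammaMeasure_real_Ioi {k : ℕ} (hk : 1 ≤ k) {r : ℝ} (hr : 0 ≤ r) :
    (gammaMeasure (k : ℝ) 1).real (Set.Ioi r) = poissonBelow k r := by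
  obtain ⟨n, rfl⟩ : ∃ n, k = n + 1 := ⟨k - 1, by omega⟩
  have h := integral_Ioi_of_hasDerivAt_of_nonpos' (a := r) (g := poissonBelow (n + 1))
    (g' := fun x => -(x ^ n * Real.exp (-x) / n.factorial))
    (fun x _ => hasDerivAt_poissonBelow n x) (fun x hx => by
      have : 0 < x := hr.trans_lt hx
      have : 0 ≤ x ^ n * Real.exp (-x) / n.factorial := by positivity
      linarith) (tendsto_poissonBelow_atTop _)
  rw [integral_neg, zero_sub, neg_inj] at h
  rw [← integral_indicator_one measurableSet_Ioi, integral_gammaMeasure_nat, ← h,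
    ← integral_const_mul]
  have hind : ∀ x : ℝ, (n.factorial : ℝ)⁻¹ * (x ^ n * Real.exp (-x) *
      (Set.Ioi r).indicator 1 x) =
      (Set.Ioi r).indicator (fun x => x ^ n * Real.exp (-x) / n.factorial) x := by
    intro x
    by_cases hx : x ∈ Set.Ioi r
    · simp only [hx, Set.indicator_of_mem, Pi.one_apply]
      ring
    · simp [hx]
  simp_rw [hind]
  rw [setIntegral_indicator measurableSet_Ioi, Set.inter_eq_right.2 (Set.Ioi_subset_Ioi hr)]

end GammaLog

/-! ### Second moments of Dirichlet weights. -/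

section Dirichlet

lemma integral_exp_neg_mul_gammaMeasure {a u : ℝ} (ha : 0 < a) (hu : 0 < u) :
    ∫ x, Real.exp (-(u * x)) ∂(gammaMeasure a 1) = (1 / (1 + u)) ^ a := by
  rw [integral_gammaMeasure ha one_pos]
  have h := Real.integral_rpow_mul_exp_neg_mul_Ioi ha (show 0 < 1 + u by linarith)
  have h2 : ∫ x in Set.Ioi (0 : ℝ), x ^ (a - 1) * Real.exp (-(1 * x)) * Real.exp (-(u * x)) =
      (1 / (1 + u)) ^ a * Real.Gamma a := by
    rw [← h]
    refine setIntegral_congr_fun measurableSet_Ioi fun x _ => ?_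
    rw [mul_assoc, ← Real.exp_add]
    ring_nf
  have hΓ := (Real.Gamma_pos_of_pos ha).ne'
  rw [h2, Real.one_rpow]
  field_simp

lemma integral_sq_mul_exp_neg_mul_gammaMeasure {a u : ℝ} (ha : 0 < a) (hu : 0 < u) :
    ∫ x, x ^ 2 * Real.exp (-(u * x)) ∂(gammaMeasure a 1) =
      a * (a + 1) * (1 / (1 + u)) ^ 2 * (1 / (1 + u)) ^ a := by
  rw [integral_gammaMeasure ha one_pos]
  have h := Real.integral_rpow_mul_exp_neg_mul_Ioi (show 0 < a + 2 by linarith)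
    (show 0 < 1 + u by linarith)
  have h2 : ∫ x in Set.Ioi (0 : ℝ), x ^ (a - 1) * Real.exp (-(1 * x)) *
      (x ^ 2 * Real.exp (-(u * x))) = (1 / (1 + u)) ^ (a + 2) * Real.Gamma (a + 2) := by
    rw [← h]
    refine setIntegral_congr_fun measurableSet_Ioi fun x hx => ?_
    have hx' : (0 : ℝ) < x := hx
    rw [show a + 2 - 1 = (a - 1) + (2 : ℕ) by push_cast; ring, Real.rpow_add_natCast hx'.ne',
      show -((1 + u) * x) = -(1 * x) + -(u * x) by ring, Real.exp_add]
    ring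
  have hΓ := (Real.Gamma_pos_of_pos ha).ne'
  have hΓ2 : Real.Gamma (a + 2) = (a + 1) * (a * Real.Gamma a) := by
    rw [show a + 2 = (a + 1) + 1 by ring, Real.Gamma_add_one (by linarith),
      Real.Gamma_add_one ha.ne']
  have hu' : 0 < 1 / (1 + u) := by positivity
  rw [h2, hΓ2, Real.one_rpow, Real.rpow_add hu', Real.rpow_two]
  field_simp

/-- Since `u = (1 + u) - 1`, the integrand is `(1 + u) ^ (-a - 1) - (1 + u) ^ (-a - 2)`, with an
explicit primitive. -/
lemma integral_Ioi_mul_one_add_rpow {a : ℝ} (ha : 0 < a) :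
    ∫ u in Set.Ioi (0 : ℝ), u * ((1 / (1 + u)) ^ 2 * (1 / (1 + u)) ^ a) = 1 / (a * (a + 1)) := by
  have hlim : ∀ b : ℝ, 0 < b → Tendsto (fun u : ℝ => (1 + u) ^ (-b)) atTop (𝓝 0) := fun b hb =>
    (tendsto_rpow_neg_atTop hb).comp (tendsto_atTop_add_const_left _ 1 tendsto_id)
  have hder : ∀ b u : ℝ, 0 ≤ u →
      HasDerivAt (fun u : ℝ => (1 + u) ^ (-b)) (-b * (1 + u) ^ (-b - 1)) u := by
    intro b u hu
    have h := ((hasDerivAt_id u).const_add 1).rpow_const (p := -b) (Or.inl (by simp; linarith))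
    simpa using h
  have hsum := ((hlim a ha).const_mul (-1 / a)).add
    ((hlim (a + 1) (by linarith)).const_mul (1 / (a + 1)))
  rw [mul_zero, mul_zero, add_zero] at hsum
  have h := integral_Ioi_of_hasDerivAt_of_nonneg' (a := (0 : ℝ))
    (g := fun u => (-1 / a) * (1 + u) ^ (-a) + (1 / (a + 1)) * (1 + u) ^ (-(a + 1)))
    (g' := fun u => u * ((1 / (1 + u)) ^ 2 * (1 / (1 + u)) ^ a)) (l := 0)
    (fun u hu => by
      have hu0 : (0 : ℝ) ≤ u := hu
      have hp : 0 < 1 + u := by linarith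
      refine (((hder a u hu0).const_mul (-1 / a)).add
        ((hder (a + 1) u hu0).const_mul (1 / (a + 1)))).congr_deriv ?_
      have e1 : (1 / (1 + u)) ^ a = (1 + u) ^ (-a) := by
        rw [one_div, Real.inv_rpow hp.le, Real.rpow_neg hp.le]
      have e2 : (1 + u) ^ (-a - 1) = (1 + u) ^ (-a) / (1 + u) := by
        rw [Real.rpow_sub hp, Real.rpow_one]
      have e3 : (1 + u) ^ (-(a + 1) - 1) = (1 + u) ^ (-a) / (1 + u) ^ 2 := by
        rw [show -(a + 1) - 1 = -a - 2 by ring, Real.rpow_sub hp, Real.rpow_two]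
      rw [e1, e2, e3]
      field_simp
      ring)
    (fun u hu => by
      have hu0 : (0 : ℝ) < u := hu
      positivity)
    hsum
  rw [h]
  simp
  field_simp
  ring

variable {ι : Type*} [Fintype ι]

lemma measurable_normalize : Measurable fun (x : ι → ℝ) i => x i / ∑ j, x j :=
  measurable_pi_lambda _ fun i => (measurable_pi_apply i).div
    (Finset.measurable_sum _ fun j _ => measurable_pi_apply j)

variable {α : ι → ℝ}

lemma isProbabilityMeasure_pi_gammaMeasure (hα : ∀ i, 0 < α i) :
    IsProbabilityMeasure (Measure.pi fun i => gammaMeasure (α i) 1) := by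
  have : ∀ i, IsProbabilityMeasure (gammaMeasure (α i) 1) := fun i =>
    isProbabilityMeasure_gammaMeasure (hα i) one_pos
  infer_instance

lemma isProbabilityMeasure_dirichletLaw (hα : ∀ i, 0 < α i) :
    IsProbabilityMeasure (dirichletLaw α) := by
  have := isProbabilityMeasure_pi_gammaMeasure hα
  exact Measure.isProbabilityMeasure_map measurable_normalize.aemeasurable

lemma ae_pos_pi_gammaMeasure (hα : ∀ i, 0 < α i) :
    ∀ᵐ x ∂(Measure.pi fun i => gammaMeasure (α i) 1), ∀ i, 0 < x i := by
  have : ∀ i, IsProbabilityMeasure (gammaMeasure (α i) 1) := fun i =>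
    isProbabilityMeasure_gammaMeasure (hα i) one_pos
  rw [ae_all_iff]
  intro i
  exact (measurePreserving_eval (fun i => gammaMeasure (α i) 1) i).quasiMeasurePreserving.ae
    (ae_pos_gammaMeasure (α i) 1)

lemma ae_dirichletLaw [Nonempty ι] (hα : ∀ i, 0 < α i) :
    ∀ᵐ w ∂(dirichletLaw α), (∀ i, 0 ≤ w i ∧ w i ≤ 1) ∧ ∑ i, w i = 1 := by
  have hm : MeasurableSet {w : ι → ℝ | (∀ i, 0 ≤ w i ∧ w i ≤ 1) ∧ ∑ i, w i = 1} := by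
    have h : {w : ι → ℝ | (∀ i, 0 ≤ w i ∧ w i ≤ 1) ∧ ∑ i, w i = 1} =
        (Set.univ.pi fun _ => Set.Icc 0 1) ∩ {w | ∑ i, w i = 1} := by
      ext w
      simp only [Set.mem_ofPred_eq, Set.mem_inter_iff, Set.mem_pi, Set.mem_univ, true_implies,
        Set.mem_Icc]
    rw [h]
    exact (MeasurableSet.univ_pi fun _ => measurableSet_Icc).inter (measurableSet_eq_fun
      (Finset.measurable_sum _ fun j _ => measurable_pi_apply j) measurable_const)
  rw [dirichletLaw, ae_map_iff measurable_normalize.aemeasurable hm]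
  filter_upwards [ae_pos_pi_gammaMeasure hα] with x hx
  have hS : 0 < ∑ j, x j := Finset.sum_pos (fun j _ => hx j) Finset.univ_nonempty
  refine ⟨fun i => ⟨(div_pos (hx i) hS).le, ?_⟩, ?_⟩
  · rw [div_le_one hS]
    exact Finset.single_le_sum (f := x) (fun j _ => (hx j).le) (Finset.mem_univ i)
  · rw [← Finset.sum_div, div_self hS.ne']

lemma integral_sq_mul_exp_neg_sum (hα : ∀ i, 0 < α i) (i : ι) {u : ℝ} (hu : 0 < u) :
    ∫ x, x i ^ 2 * Real.exp (-(u * ∑ j, x j)) ∂(Measure.pi fun i => gammaMeasure (α i) 1) =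
      α i * (α i + 1) * ((1 / (1 + u)) ^ 2 * (1 / (1 + u)) ^ (∑ j, α j)) := by
  classical
  have : ∀ i, IsProbabilityMeasure (gammaMeasure (α i) 1) := fun i =>
    isProbabilityMeasure_gammaMeasure (hα i) one_pos
  have h1 : ∀ x : ι → ℝ, x i ^ 2 * Real.exp (-(u * ∑ j, x j)) =
      ∏ j, (if j = i then x j ^ 2 else 1) * Real.exp (-(u * x j)) := by
    intro x
    rw [Finset.prod_mul_distrib, Finset.prod_ite_eq' Finset.univ i, ← Real.exp_sum,
      Finset.sum_neg_distrib, Finset.mul_sum]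
    simp
  have h2 : ∀ j, ∫ x, (if j = i then x ^ 2 else 1) * Real.exp (-(u * x))
      ∂(gammaMeasure (α j) 1) =
      (if j = i then α j * (α j + 1) * (1 / (1 + u)) ^ 2 else 1) * (1 / (1 + u)) ^ (α j) := by
    intro j
    by_cases hj : j = i
    · simp only [hj, if_true]
      exact integral_sq_mul_exp_neg_mul_gammaMeasure (hα i) hu
    · simp only [hj, if_false, one_mul]
      exact integral_exp_neg_mul_gammaMeasure (hα j) hu
  simp_rw [h1]
  rw [integral_fintype_prod_eq_prod
    (f := fun j x => (if j = i then x ^ 2 else 1) * Real.exp (-(u * x))), Finset.prod_congr rfl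
    fun j _ => h2 j, Finset.prod_mul_distrib, Finset.prod_ite_eq' Finset.univ i,
    Real.rpow_sum_of_pos (by positivity)]
  simp
  ring

/-- The normalising sum `S` is removed by `1 / S ^ 2 = ∫ u * exp (-u * S)` over `u > 0`. After
Fubini the expectation factors over the independent gamma variables, leaving a one-dimensional
integral in `u`. -/
lemma integral_sq_dirichletLaw (hα : ∀ i, 0 < α i) (i : ι) :
    ∫ w, w i ^ 2 ∂(dirichletLaw α) =
      α i * (α i + 1) / ((∑ j, α j) * (∑ j, α j + 1)) := by
  have : Nonempty ι := ⟨i⟩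
  have hprob := isProbabilityMeasure_pi_gammaMeasure hα
  have ha : 0 < ∑ j, α j := Finset.sum_pos (fun j _ => hα j) Finset.univ_nonempty
  have hsum : Measurable fun x : ι → ℝ => ∑ j, x j :=
    Finset.measurable_sum _ fun j _ => measurable_pi_apply j
  set P := Measure.pi fun i => gammaMeasure (α i) 1 with hP
  have hlap : ∀ S : ℝ, 0 < S → ∫ u in Set.Ioi (0 : ℝ), u * Real.exp (-(u * S)) = 1 / S ^ 2 := by
    intro S hS
    have h := Real.integral_rpow_mul_exp_neg_mul_Ioi two_pos hS
    rw [Real.Gamma_two, mul_one, Real.rpow_two, one_div, inv_pow, ← one_div] at h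
    rw [← h]
    refine setIntegral_congr_fun measurableSet_Ioi fun u _ => ?_
    rw [show (2 : ℝ) - 1 = 1 by norm_num, Real.rpow_one, mul_comm S u]
  have hlapi : ∀ S : ℝ, 0 < S →
      IntegrableOn (fun u : ℝ => u * Real.exp (-(u * S))) (Set.Ioi 0) := by
    intro S hS
    -- Were the function not integrable, its integral would have the default value `0`, against the
    -- positive value in `hlap`.
    by_contra h
    have h1 := hlap S hS
    rw [integral_undef h] at h1
    have : 0 < 1 / S ^ 2 := by positivity
    linarith
  have hm : Measurable fun q : (ι → ℝ) × ℝ =>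
      q.1 i ^ 2 * (q.2 * Real.exp (-(q.2 * ∑ j, q.1 j))) := by
    have h1 : Measurable fun q : (ι → ℝ) × ℝ => ∑ j, q.1 j := hsum.comp measurable_fst
    have h2 : Measurable fun q : (ι → ℝ) × ℝ => q.1 i :=
      (measurable_pi_apply i).comp measurable_fst
    exact (h2.pow_const 2).mul (measurable_snd.mul (measurable_snd.mul h1).neg.exp)
  have hsq : ∀ᵐ x ∂P, ∫ u in Set.Ioi (0 : ℝ), x i ^ 2 * (u * Real.exp (-(u * ∑ j, x j))) =
      (x i / ∑ j, x j) ^ 2 := by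
    filter_upwards [ae_pos_pi_gammaMeasure hα] with x hx
    have hS : 0 < ∑ j, x j := Finset.sum_pos (fun j _ => hx j) Finset.univ_nonempty
    rw [integral_const_mul, hlap _ hS, div_pow]
    ring
  have hint : Integrable (fun q : (ι → ℝ) × ℝ =>
      q.1 i ^ 2 * (q.2 * Real.exp (-(q.2 * ∑ j, q.1 j))))
      (P.prod (volume.restrict (Set.Ioi 0))) := by
    rw [integrable_prod_iff hm.aestronglyMeasurable]
    constructor
    · filter_upwards [ae_pos_pi_gammaMeasure hα] with x hx
      have hS : 0 < ∑ j, x j := Finset.sum_pos (fun j _ => hx j) Finset.univ_nonempty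
      exact (hlapi _ hS).const_mul _
    · have hle : ∀ᵐ x ∂P, (∫ u in Set.Ioi (0 : ℝ),
          ‖x i ^ 2 * (u * Real.exp (-(u * ∑ j, x j)))‖) = (x i / ∑ j, x j) ^ 2 := by
        filter_upwards [hsq] with x hx
        rw [← hx]
        refine setIntegral_congr_fun measurableSet_Ioi fun u hu => ?_
        have hu0 : (0 : ℝ) < u := hu
        exact Real.norm_of_nonneg (by positivity)
      refine Integrable.congr ?_ (hle.mono fun x hx => hx.symm)
      refine Integrable.of_bound
        (((measurable_pi_apply i).div hsum).pow_const 2).aestronglyMeasurable 1 ?_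
      filter_upwards [ae_pos_pi_gammaMeasure hα] with x hx
      have hS : 0 < ∑ j, x j := Finset.sum_pos (fun j _ => hx j) Finset.univ_nonempty
      have h0 : 0 ≤ x i / ∑ j, x j := (div_pos (hx i) hS).le
      have h1 : x i / ∑ j, x j ≤ 1 := by
        rw [div_le_one hS]
        exact Finset.single_le_sum (f := x) (fun j _ => (hx j).le) (Finset.mem_univ i)
      rw [Real.norm_of_nonneg (by positivity)]
      exact pow_le_one₀ h0 h1
  calc ∫ w, w i ^ 2 ∂(dirichletLaw α) = ∫ x, (x i / ∑ j, x j) ^ 2 ∂P := by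
        rw [dirichletLaw, integral_map measurable_normalize.aemeasurable
          ((measurable_pi_apply i).pow_const 2).aestronglyMeasurable]
    _ = ∫ x, (∫ u in Set.Ioi (0 : ℝ), x i ^ 2 * (u * Real.exp (-(u * ∑ j, x j)))) ∂P :=
        integral_congr_ae (hsq.mono fun x hx => hx.symm)
    _ = ∫ u in Set.Ioi (0 : ℝ), ∫ x, x i ^ 2 * (u * Real.exp (-(u * ∑ j, x j))) ∂P :=
        integral_integral_swap hint
    _ = ∫ u in Set.Ioi (0 : ℝ), α i * (α i + 1) *
          (u * ((1 / (1 + u)) ^ 2 * (1 / (1 + u)) ^ (∑ j, α j))) := by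
        refine setIntegral_congr_fun measurableSet_Ioi fun u hu => ?_
        have h : ∀ x : ι → ℝ, x i ^ 2 * (u * Real.exp (-(u * ∑ j, x j))) =
            u * (x i ^ 2 * Real.exp (-(u * ∑ j, x j))) := fun x => by ring
        simp_rw [h]
        rw [integral_const_mul, integral_sq_mul_exp_neg_sum hα i hu]
        ring
    _ = _ := by
        rw [integral_const_mul, integral_Ioi_mul_one_add_rpow ha]
        ring

lemma sum_integral_sq_dirichletLaw {N : ℕ} (hN : 1 ≤ N) {a : ℝ} (ha : 0 < a) :
    ∑ i, ∫ w, w i ^ 2 ∂(dirichletLaw fun _ : Fin N => a / N) = (a / N + 1) / (a + 1) := by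
  have hN0 : (0 : ℝ) < N := by exact_mod_cast hN
  have hs : ∑ _j : Fin N, a / (N : ℝ) = a := by
    rw [Finset.sum_const, Finset.card_univ, Fintype.card_fin, nsmul_eq_mul]
    field_simp
  simp_rw [integral_sq_dirichletLaw (fun _ : Fin N => div_pos ha hN0), hs]
  rw [Finset.sum_const, Finset.card_univ, Fintype.card_fin, nsmul_eq_mul]
  field_simp

end Dirichlet

/-! ### The limit variable and its first two moments. -/

section LimitLaw

variable {d k : ℕ} (G : Measure (EuclideanSpace ℝ (Fin d))) [IsProbabilityMeasure G]

/-- The limit variable `log (z / (k g(x)))` of the statistics `knnLogVol`, for `z` of law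
`gamma(k, 1)` and `x` of law `G`. -/
noncomputable def limitLogVol (k : ℕ) (G : Measure (EuclideanSpace ℝ (Fin d)))
    (q : ℝ × EuclideanSpace ℝ (Fin d)) : ℝ :=
  (Real.log q.1 - Real.log k) + -Real.log (pdfOf G q.2)

lemma measurable_limitLogVol (G : Measure (EuclideanSpace ℝ (Fin d))) :
    Measurable (limitLogVol k G) :=
  (measurable_fst.log.sub_const _).add ((measurable_pdfOf G).comp measurable_snd).log.neg

lemma isProbabilityMeasure_gammaMeasure_natCast (hk : 1 ≤ k) :
    IsProbabilityMeasure (gammaMeasure (k : ℝ) 1) :=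
  isProbabilityMeasure_gammaMeasure (by exact_mod_cast hk) one_pos

lemma memLp_log_gammaMeasure_of_le (hk : 1 ≤ k) : MemLp Real.log 2 (gammaMeasure (k : ℝ) 1) := by
  obtain ⟨n, rfl⟩ : ∃ n, k = n + 1 := ⟨k - 1, by omega⟩
  exact memLp_log_gammaMeasure n

lemma integral_log_gammaMeasure_of_le (hk : 1 ≤ k) :
    ∫ x, Real.log x ∂(gammaMeasure (k : ℝ) 1) =
      harmonic (k - 1) - Real.eulerMascheroniConstant := by
  obtain ⟨n, rfl⟩ : ∃ n, k = n + 1 := ⟨k - 1, by omega⟩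
  exact integral_log_gammaMeasure n

lemma ae_pdfOf_pos (hG : G ≪ volume) : ∀ᵐ x ∂G, 0 < pdfOf G x := by
  filter_upwards [Measure.rnDeriv_pos hG, hG.ae_le (Measure.rnDeriv_lt_top G volume)] with x h1 h2
  exact ENNReal.toReal_pos h1.ne' h2.ne

/-- For almost every `x` the density is positive, and `s < log (z / (k * g x))` becomes `k * exp s *
g x < z`, whose gamma probability is a Poisson one by duality. -/
lemma real_lt_limitLogVol (hk : 1 ≤ k) (hG : G ≪ volume) (s : ℝ) :
    ((gammaMeasure (k : ℝ) 1).prod G).real {q | s < limitLogVol k G q} =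
      ∫ x, knnSurvival G k s x ∂G := by
  have := isProbabilityMeasure_gammaMeasure_natCast hk
  have hk0 : (0 : ℝ) < k := by exact_mod_cast hk
  have hS : MeasurableSet {q | s < limitLogVol k G q} :=
    measurableSet_lt measurable_const (measurable_limitLogVol G)
  rw [measureReal_def, Measure.prod_apply_symm hS,
    ← integral_toReal (measurable_measure_prodMk_right hS).aemeasurable
      (ae_of_all _ fun _ => measure_lt_top _ _)]
  refine integral_congr_ae ?_
  filter_upwards [ae_pdfOf_pos G hG] with x hx
  rw [knnSurvival, ← gammaMeasure_real_Ioi hk (by positivity)]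
  refine measureReal_congr ?_
  filter_upwards [ae_pos_gammaMeasure (k : ℝ) 1] with z hz
  refine propext ?_
  change s < (Real.log z - Real.log k) + -Real.log (pdfOf G x) ↔ k * Real.exp s * pdfOf G x < z
  rw [← Real.log_lt_log_iff (by positivity) hz, Real.log_mul (by positivity) hx.ne',
    Real.log_mul hk0.ne' (Real.exp_pos s).ne', Real.log_exp]
  constructor <;> intro h <;> linarith

lemma integrable_limitLogVol (hk : 1 ≤ k)
    (hlog : Integrable (fun x => Real.log (pdfOf G x)) G) :
    Integrable (limitLogVol k G) ((gammaMeasure (k : ℝ) 1).prod G) := by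
  have := isProbabilityMeasure_gammaMeasure_natCast hk
  have h1 := (memLp_log_gammaMeasure_of_le hk).integrable one_le_two
  exact ((h1.sub (integrable_const (Real.log k))).comp_fst G).add (hlog.neg.comp_snd _)

lemma memLp_limitLogVol (hk : 1 ≤ k)
    (hlog : MemLp (fun x => Real.log (pdfOf G x)) 2 G) :
    MemLp (limitLogVol k G) 2 ((gammaMeasure (k : ℝ) 1).prod G) := by
  have := isProbabilityMeasure_gammaMeasure_natCast hk
  have h1 := (memLp_log_gammaMeasure_of_le hk).sub (memLp_const (Real.log k))
  exact (h1.comp_fst G).add (hlog.neg.comp_snd _)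

lemma integral_log_pdfOf (hG : G ≪ volume) : ∫ x, Real.log (pdfOf G x) ∂G = -entropyOf G := by
  rw [entropyOf, neg_neg, ← integral_rnDeriv_smul hG]
  rfl

lemma integral_limitLogVol (hk : 1 ≤ k) (hG : G ≪ volume)
    (hlog : Integrable (fun x => Real.log (pdfOf G x)) G) :
    ∫ q, limitLogVol k G q ∂((gammaMeasure (k : ℝ) 1).prod G) =
      harmonic (k - 1) - Real.eulerMascheroniConstant - Real.log k + entropyOf G := by
  have := isProbabilityMeasure_gammaMeasure_natCast hk
  have h1 := (memLp_log_gammaMeasure_of_le hk).integrable one_le_two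
  have h2 : Integrable (fun x => Real.log x - Real.log k) (gammaMeasure (k : ℝ) 1) :=
    h1.sub (integrable_const _)
  have h3 : Integrable (fun x => -Real.log (pdfOf G x)) G := hlog.neg
  unfold limitLogVol
  rw [integral_add (h2.comp_fst G) (h3.comp_snd _), integral_fun_fst (fun x => Real.log x -
    Real.log k), integral_fun_snd (fun x => -Real.log (pdfOf G x)),
    integral_sub h1 (integrable_const _), integral_neg, integral_log_pdfOf G hG,
    integral_log_gammaMeasure_of_le hk]
  simp

lemma variance_limitLogVol (hk : 1 ≤ k)
    (hlog : MemLp (fun x => Real.log (pdfOf G x)) 2 G) :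
    Var[limitLogVol k G; (gammaMeasure (k : ℝ) 1).prod G] =
      ∑' j : ℕ, 1 / ((k : ℝ) + j) ^ 2 + Var[fun x => Real.log (pdfOf G x); G] := by
  have := isProbabilityMeasure_gammaMeasure_natCast hk
  have h1 : MemLp (fun x => Real.log x - Real.log k) 2 (gammaMeasure (k : ℝ) 1) :=
    (memLp_log_gammaMeasure_of_le hk).sub (memLp_const _)
  have h2 : MemLp (fun x => -Real.log (pdfOf G x)) 2 G := hlog.neg
  have h := variance_add_prod h1 h2
  rw [variance_fun_neg, variance_sub_const Real.measurable_log.aestronglyMeasurable,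
    variance_log_gammaMeasure hk] at h
  exact h

end LimitLaw

/-! ### Convergence of the first, second and mixed moments of the statistics. -/

section MomentLimits

variable {d k : ℕ} {G : Measure (EuclideanSpace ℝ (Fin d))} [IsProbabilityMeasure G]

lemma lintegral_tailMeasure_one_ne_top (hlog : Integrable (fun x => Real.log (pdfOf G x)) G)
    (hnorm : Integrable (fun x => Real.log (1 + ‖x‖)) G) :
    ∫⁻ x, ENNReal.ofReal x ∂(tailMeasure k G) ≠ ⊤ := by
  simpa using lintegral_tailMeasure_ne_top (k := k) G (p := 1) one_ne_zero
    (by simpa using memLp_one_iff_integrable.2 hlog)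
    (by simpa using memLp_one_iff_integrable.2 hnorm)

lemma integrable_knnLogVol {N : ℕ} (hd : 1 ≤ d) (hk : 1 ≤ k) (hkN : k + 1 ≤ N)
    (hG : G ≪ volume) (hlog : Integrable (fun x => Real.log (pdfOf G x)) G)
    (hnorm : Integrable (fun x => Real.log (1 + ‖x‖)) G) (i : Fin N) :
    Integrable (fun y => knnLogVol k y i) (Measure.pi fun _ : Fin N => G) := by
  have := isFiniteMeasure_tailMeasure (k := k) G
  exact integrable_of_tail (measurable_knnLogVol hk hkN i)
    (lintegral_tailMeasure_one_ne_top hlog hnorm)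
    fun t ht => pi_tail_le_tailMeasure G hd hk hkN hG i ht

lemma memLp_knnLogVol {N : ℕ} (hd : 1 ≤ d) (hk : 1 ≤ k) (hkN : k + 1 ≤ N)
    (hG : G ≪ volume) (hlog : MemLp (fun x => Real.log (pdfOf G x)) 2 G)
    (hnorm : MemLp (fun x => Real.log (1 + ‖x‖)) 2 G) (i : Fin N) :
    MemLp (fun y => knnLogVol k y i) 2 (Measure.pi fun _ : Fin N => G) := by
  have := isFiniteMeasure_tailMeasure (k := k) G
  exact memLp_two_of_tail (measurable_knnLogVol hk hkN i)
    (lintegral_tailMeasure_ne_top G two_ne_zero hlog hnorm)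
    fun t ht => pi_tail_le_tailMeasure G hd hk hkN hG i ht

lemma eventually_measurable_and_tail (hd : 1 ≤ d) (hk : 1 ≤ k) (hG : G ≪ volume)
    (i : ∀ n : ℕ, Fin (n + 2)) :
    ∀ᶠ n in atTop, Measurable (fun y : Fin (n + 2) → EuclideanSpace ℝ (Fin d) =>
        knnLogVol k y (i n)) ∧
      ∀ t, 0 ≤ t → (Measure.pi fun _ : Fin (n + 2) => G)
        {y | t < knnLogVol k y (i n) ∨ knnLogVol k y (i n) ≤ -t} ≤
          tailMeasure k G (Set.Ici t) := by
  filter_upwards [eventually_ge_atTop k] with n hn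
  exact ⟨measurable_knnLogVol hk (by omega) (i n),
    fun t ht => pi_tail_le_tailMeasure G hd hk (by omega) hG (i n) ht⟩

lemma tendsto_pi_lt_knnLogVol_limit (hd : 1 ≤ d) (hk : 1 ≤ k) (hG : G ≪ volume) (s : ℝ) :
    Tendsto (fun n => (Measure.pi fun _ : Fin (n + 2) => G).real {y | s < knnLogVol k y 0}) atTop
      (𝓝 (((gammaMeasure (k : ℝ) 1).prod G).real {q | s < limitLogVol k G q})) := by
  rw [real_lt_limitLogVol G hk hG]
  exact tendsto_pi_lt_knnLogVol G hd hk hG s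

lemma tendsto_integral_knnLogVol (hd : 1 ≤ d) (hk : 1 ≤ k) (hG : G ≪ volume)
    (hlog : Integrable (fun x => Real.log (pdfOf G x)) G)
    (hnorm : Integrable (fun x => Real.log (1 + ‖x‖)) G) :
    Tendsto (fun n => ∫ y, knnLogVol k y 0 ∂(Measure.pi fun _ : Fin (n + 2) => G)) atTop
      (𝓝 (∫ q, limitLogVol k G q ∂((gammaMeasure (k : ℝ) 1).prod G))) := by
  have := isProbabilityMeasure_gammaMeasure_natCast hk
  have := isFiniteMeasure_tailMeasure (k := k) G
  exact tendsto_integral_of_tail (lintegral_tailMeasure_one_ne_top hlog hnorm)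
    (measurable_limitLogVol G) (integrable_limitLogVol G hk hlog)
    (eventually_measurable_and_tail hd hk hG fun _ => 0)
    (tendsto_pi_lt_knnLogVol_limit hd hk hG)

lemma tendsto_integral_sq_knnLogVol (hd : 1 ≤ d) (hk : 1 ≤ k) (hG : G ≪ volume)
    (hlog : MemLp (fun x => Real.log (pdfOf G x)) 2 G)
    (hnorm : MemLp (fun x => Real.log (1 + ‖x‖)) 2 G) :
    Tendsto (fun n => ∫ y, knnLogVol k y 0 * knnLogVol k y 0
      ∂(Measure.pi fun _ : Fin (n + 2) => G)) atTop
      (𝓝 (∫ q, limitLogVol k G q * limitLogVol k G q ∂((gammaMeasure (k : ℝ) 1).prod G))) := by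
  have := isProbabilityMeasure_gammaMeasure_natCast hk
  have := isFiniteMeasure_tailMeasure (k := k) G
  have hlim := tendsto_pi_lt_knnLogVol_limit hd hk hG
  refine tendsto_integral_mul_of_tail (lintegral_tailMeasure_ne_top G two_ne_zero hlog hnorm)
    (measurable_limitLogVol G) (memLp_limitLogVol G hk hlog)
    (measurable_limitLogVol G) (memLp_limitLogVol G hk hlog)
    (eventually_measurable_and_tail hd hk hG fun _ => 0)
    (eventually_measurable_and_tail hd hk hG fun _ => 0) hlim hlim fun s t => ?_
  -- With both variables equal, the joint survival function is the marginal one at the larger level.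
  simp_rw [← max_lt_iff]
  exact hlim (max s t)

lemma tendsto_integral_mul_knnLogVol (hd : 1 ≤ d) (hk : 1 ≤ k) (hG : G ≪ volume)
    (hlog : MemLp (fun x => Real.log (pdfOf G x)) 2 G)
    (hnorm : MemLp (fun x => Real.log (1 + ‖x‖)) 2 G) :
    Tendsto (fun n => ∫ y, knnLogVol k y 0 * knnLogVol k y 1
      ∂(Measure.pi fun _ : Fin (n + 2) => G)) atTop
      (𝓝 ((∫ q, limitLogVol k G q ∂((gammaMeasure (k : ℝ) 1).prod G)) ^ 2)) := by
  have := isProbabilityMeasure_gammaMeasure_natCast hk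
  have := isFiniteMeasure_tailMeasure (k := k) G
  set P := (gammaMeasure (k : ℝ) 1).prod G with hP
  have hlim := tendsto_pi_lt_knnLogVol_limit hd hk hG
  have hX := memLp_limitLogVol G hk hlog
  have hmX := measurable_limitLogVol (k := k) G
  have hset : ∀ s, MeasurableSet {q | s < limitLogVol k G q} := fun s =>
    measurableSet_lt measurable_const hmX
  have hfst : ∀ s, (P.prod P).real {p | s < limitLogVol k G p.1} =
      P.real {q | s < limitLogVol k G q} := fun s =>
    (measurePreserving_fst (μ := P) (ν := P)).measureReal_preimage (hset s).nullMeasurableSet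
  have hsnd : ∀ s, (P.prod P).real {p | s < limitLogVol k G p.2} =
      P.real {q | s < limitLogVol k G q} := fun s =>
    (measurePreserving_snd (μ := P) (ν := P)).measureReal_preimage (hset s).nullMeasurableSet
  -- The limit of the pair is realised as two independent copies of the limit variable on the
  -- product space, so the limiting mixed moment is the square of a mean.
  have h := tendsto_integral_mul_of_tail (μ := P.prod P)
    (P := fun n => Measure.pi fun _ : Fin (n + 2) => G)
    (X := fun n y => knnLogVol k y 0) (Y := fun n y => knnLogVol k y 1)
    (X' := fun p => limitLogVol k G p.1) (Y' := fun p => limitLogVol k G p.2)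
    (lintegral_tailMeasure_ne_top (k := k) G two_ne_zero hlog hnorm)
    (hmX.comp measurable_fst) (hX.comp_fst P) (hmX.comp measurable_snd) (hX.comp_snd P)
    (eventually_measurable_and_tail hd hk hG fun _ => 0)
    (eventually_measurable_and_tail hd hk hG fun _ => 1)
    (fun s => by rw [hfst]; exact hlim s)
    (fun s => by
      rw [hsnd]
      refine (hlim s).congr' ?_
      filter_upwards [eventually_ge_atTop k] with n hn
      rw [measureReal_def, measureReal_def, pi_lt_knnLogVol_eq G 0 1 s hk (by omega)])
    (fun s t => by
      have he : (P.prod P).real {p | s < limitLogVol k G p.1 ∧ t < limitLogVol k G p.2} =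
          P.real {q | s < limitLogVol k G q} * P.real {q | t < limitLogVol k G q} := by
        rw [← measureReal_prod_prod]
        rfl
      rw [he, hP, real_lt_limitLogVol G hk hG, real_lt_limitLogVol G hk hG]
      exact tendsto_pi_lt_knnLogVol_and G hd hk hG s t)
  rw [integral_prod_mul, ← pow_two] at h
  exact h

end MomentLimits

/-! ### Exchangeability and the moments of randomly weighted sums. -/

section WeightedSum

variable {d k : ℕ} {G : Measure (EuclideanSpace ℝ (Fin d))} [IsProbabilityMeasure G]

lemma integral_knnLogVol_mul_perm {N : ℕ} (hk : 1 ≤ k) (hkN : k + 1 ≤ N)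
    (σ : Equiv.Perm (Fin N)) (i j : Fin N) :
    ∫ y, knnLogVol k y (σ i) * knnLogVol k y (σ j) ∂(Measure.pi fun _ : Fin N => G) =
      ∫ y, knnLogVol k y i * knnLogVol k y j ∂(Measure.pi fun _ : Fin N => G) := by
  have hmp := measurePreserving_pi_perm G σ
  have hm : Measurable fun y : Fin N → EuclideanSpace ℝ (Fin d) =>
      knnLogVol k y i * knnLogVol k y j :=
    (measurable_knnLogVol hk hkN i).mul (measurable_knnLogVol hk hkN j)
  conv_rhs => rw [← hmp.map_eq, integral_map hmp.measurable.aemeasurable hm.aestronglyMeasurable]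
  simp only [knnLogVol_comp_perm]

lemma integral_knnLogVol_eq {N : ℕ} (hk : 1 ≤ k) (hkN : k + 1 ≤ N) (i j : Fin N) :
    ∫ y, knnLogVol k y i ∂(Measure.pi fun _ : Fin N => G) =
      ∫ y, knnLogVol k y j ∂(Measure.pi fun _ : Fin N => G) := by
  have hmp := measurePreserving_pi_perm G (Equiv.swap i j)
  have hm := measurable_knnLogVol (d := d) hk hkN j
  conv_rhs => rw [← hmp.map_eq, integral_map hmp.measurable.aemeasurable hm.aestronglyMeasurable]
  simp only [knnLogVol_comp_perm, Equiv.swap_apply_right]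

lemma integral_knnLogVol_mul_eq {n : ℕ} (hk : 1 ≤ k) (hkn : k ≤ n + 1) (i j : Fin (n + 2)) :
    ∫ y, knnLogVol k y i * knnLogVol k y j ∂(Measure.pi fun _ : Fin (n + 2) => G) =
      if i = j then ∫ y, knnLogVol k y 0 * knnLogVol k y 0 ∂(Measure.pi fun _ : Fin (n + 2) => G)
      else ∫ y, knnLogVol k y 0 * knnLogVol k y 1 ∂(Measure.pi fun _ : Fin (n + 2) => G) := by
  have hkN : k + 1 ≤ n + 2 := by omega
  split_ifs with h
  · subst h
    have := integral_knnLogVol_mul_perm (G := G) hk hkN (Equiv.swap 0 i) 0 0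
    simpa using this
  · have h0 : Equiv.swap 0 i j ≠ 0 := by
      intro h'
      rw [Equiv.swap_apply_eq_iff, Equiv.swap_apply_left] at h'
      exact h h'.symm
    -- This permutation sends `0` to `i` and `1` to `j`: the inner swap fixes `0` and moves `1` to
    -- the preimage of `j` under the outer one.
    have := integral_knnLogVol_mul_perm (G := G) hk hkN
      (Equiv.swap 0 i * Equiv.swap 1 (Equiv.swap 0 i j)) 0 1
    rwa [Equiv.Perm.mul_apply, Equiv.Perm.mul_apply, Equiv.swap_apply_left,
      Equiv.swap_apply_of_ne_of_ne (by simp) h0.symm, Equiv.swap_apply_left,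
      Equiv.swap_apply_self] at this

lemma measurable_priorEntropy {N : ℕ} (hk : 1 ≤ k) (hkN : k + 1 ≤ N) :
    Measurable fun q : (Fin N → ℝ) × (Fin N → EuclideanSpace ℝ (Fin d)) =>
      priorEntropy k q.1 q.2 := by
  unfold priorEntropy
  refine (((Finset.measurable_sum _ fun i _ => ?_).sub_const _).add_const _).add_const _
  exact ((measurable_pi_apply i).comp measurable_fst).mul
    ((measurable_knnLogVol hk hkN i).comp measurable_snd)

variable {N : ℕ}

lemma memLp_top_weight {D : Measure (Fin N → ℝ)} (hD : ∀ᵐ w ∂D, (∀ i, 0 ≤ w i ∧ w i ≤ 1) ∧ ∑ i, w i = 1) (i : Fin N) :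
    MemLp (fun w : Fin N → ℝ => w i) ⊤ D := by
  refine memLp_top_of_bound (measurable_pi_apply i).aestronglyMeasurable 1 ?_
  filter_upwards [hD] with w hw
  rw [Real.norm_of_nonneg (hw.1 i).1]
  exact (hw.1 i).2

variable {D : Measure (Fin N → ℝ)} [IsProbabilityMeasure D]

lemma integrable_weight_mul (hD : ∀ᵐ w ∂D, (∀ i, 0 ≤ w i ∧ w i ≤ 1) ∧ ∑ i, w i = 1)
    (i j : Fin N) : Integrable (fun w : Fin N → ℝ => w i * w j) D :=
  ((memLp_top_weight hD i).mono_exponent (p := 2) le_top).integrable_mul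
    ((memLp_top_weight hD j).mono_exponent (p := 2) le_top)

lemma integrable_weight (hD : ∀ᵐ w ∂D, (∀ i, 0 ≤ w i ∧ w i ≤ 1) ∧ ∑ i, w i = 1)
    (i : Fin N) : Integrable (fun w : Fin N → ℝ => w i) D :=
  (memLp_top_weight hD i).integrable le_top

lemma sum_integral_weight (hD : ∀ᵐ w ∂D, (∀ i, 0 ≤ w i ∧ w i ≤ 1) ∧ ∑ i, w i = 1) :
    ∑ i, ∫ w, w i ∂D = 1 := by
  rw [← integral_finsetSum _ fun i _ => integrable_weight hD i]
  rw [integral_congr_ae (g := fun _ => (1 : ℝ)) (hD.mono fun w hw => hw.2)]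
  simp

lemma sum_sum_integral_weight_mul
    (hD : ∀ᵐ w ∂D, (∀ i, 0 ≤ w i ∧ w i ≤ 1) ∧ ∑ i, w i = 1) :
    ∑ i, ∑ j, ∫ w, w i * w j ∂D = 1 := by
  have h : ∀ i, ∑ j, ∫ w, w i * w j ∂D = ∫ w, w i ∂D := by
    intro i
    rw [← integral_finsetSum _ fun j _ => integrable_weight_mul hD i j]
    refine integral_congr_ae (hD.mono fun w hw => ?_)
    simp only
    rw [← Finset.mul_sum, hw.2, mul_one]
  rw [Finset.sum_congr rfl fun i _ => h i, sum_integral_weight hD]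

variable {E : Type*} [MeasurableSpace E] {P : Measure E} [IsProbabilityMeasure P]
  {T : Fin N → E → ℝ}

lemma integrable_sum_weight_mul {P : Measure E} [SFinite P]
    (hD : ∀ᵐ w ∂D, (∀ i, 0 ≤ w i ∧ w i ≤ 1) ∧ ∑ i, w i = 1)
    (hT : ∀ i, Integrable (T i) P) :
    Integrable (fun q : (Fin N → ℝ) × E => ∑ i, q.1 i * T i q.2) (D.prod P) :=
  integrable_finsetSum _ fun i _ => (integrable_weight hD i).mul_prod (hT i)

lemma integral_sum_weight_mul (hD : ∀ᵐ w ∂D, (∀ i, 0 ≤ w i ∧ w i ≤ 1) ∧ ∑ i, w i = 1)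
    (hT : ∀ i, Integrable (T i) P) {m : ℝ} (hm : ∀ i, ∫ y, T i y ∂P = m) :
    ∫ q : (Fin N → ℝ) × E, ∑ i, q.1 i * T i q.2 ∂(D.prod P) = m := by
  rw [integral_finsetSum _ fun i _ => (integrable_weight hD i).mul_prod (hT i)]
  have h : ∀ i, ∫ q : (Fin N → ℝ) × E, q.1 i * T i q.2 ∂(D.prod P) = (∫ w, w i ∂D) * m := by
    intro i
    rw [← hm i]
    exact integral_prod_mul (fun w : Fin N → ℝ => w i) (T i)
  rw [Finset.sum_congr rfl fun i _ => h i, ← Finset.sum_mul, sum_integral_weight hD, one_mul]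

lemma memLp_sum_weight_mul (hD : ∀ᵐ w ∂D, (∀ i, 0 ≤ w i ∧ w i ≤ 1) ∧ ∑ i, w i = 1)
    (hT : ∀ i, MemLp (T i) 2 P) :
    MemLp (fun q : (Fin N → ℝ) × E => ∑ i, q.1 i * T i q.2) 2 (D.prod P) := by
  refine memLp_finsetSum _ fun i _ => ?_
  have hm : AEStronglyMeasurable (fun q : (Fin N → ℝ) × E => q.1 i * T i q.2) (D.prod P) :=
    ((memLp_top_weight hD i).comp_fst P).1.mul ((hT i).comp_snd D).1
  rw [memLp_two_iff_integrable_sq hm]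
  simp_rw [mul_pow]
  have h1 := integrable_weight_mul hD i i
  simp_rw [← pow_two] at h1
  exact h1.mul_prod (hT i).integrable_sq

/-- The diagonal has total weight `∑ E[w i ^ 2]`; since the weights sum to one, the off-diagonal
terms carry the complement. -/
lemma integral_sq_sum_weight_mul (hD : ∀ᵐ w ∂D, (∀ i, 0 ≤ w i ∧ w i ≤ 1) ∧ ∑ i, w i = 1)
    (hT : ∀ i, MemLp (T i) 2 P) {b c : ℝ}
    (hbc : ∀ i j, ∫ y, T i y * T j y ∂P = if i = j then b else c) :
    ∫ q : (Fin N → ℝ) × E, (∑ i, q.1 i * T i q.2) ^ 2 ∂(D.prod P) =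
      (∑ i, ∫ w, w i ^ 2 ∂D) * b + (1 - ∑ i, ∫ w, w i ^ 2 ∂D) * c := by
  have hint : ∀ i j, Integrable (fun q : (Fin N → ℝ) × E => (q.1 i * q.1 j) * (T i q.2 * T j q.2))
      (D.prod P) := fun i j =>
    (integrable_weight_mul hD i j).mul_prod ((hT i).integrable_mul (hT j))
  have hexp : ∀ q : (Fin N → ℝ) × E, (∑ i, q.1 i * T i q.2) ^ 2 =
      ∑ i, ∑ j, (q.1 i * q.1 j) * (T i q.2 * T j q.2) := by
    intro q
    rw [pow_two, Finset.sum_mul_sum]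
    exact Finset.sum_congr rfl fun i _ => Finset.sum_congr rfl fun j _ => by ring
  -- The moment `if i = j then b else c` is written as `c` plus a diagonal correction `b - c`, so
  -- that the full double sum of weights appears.
  have hval : ∀ i j, ∫ q : (Fin N → ℝ) × E, (q.1 i * q.1 j) * (T i q.2 * T j q.2) ∂(D.prod P) =
      (∫ w, w i * w j ∂D) * c + if i = j then (∫ w, w i ^ 2 ∂D) * (b - c) else 0 := by
    intro i j
    rw [integral_prod_mul (fun w : Fin N → ℝ => w i * w j) (fun y => T i y * T j y), hbc]
    by_cases h : i = j
    · subst h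
      simp only [if_true, pow_two]
      ring
    · simp [h]
  simp_rw [hexp]
  rw [integral_finsetSum _ fun i _ => integrable_finsetSum _ fun j _ => hint i j]
  have hrow : ∀ i, ∫ q : (Fin N → ℝ) × E, ∑ j, (q.1 i * q.1 j) * (T i q.2 * T j q.2)
      ∂(D.prod P) = (∑ j, ∫ w, w i * w j ∂D) * c + (∫ w, w i ^ 2 ∂D) * (b - c) := by
    intro i
    rw [integral_finsetSum _ fun j _ => hint i j, Finset.sum_congr rfl fun j _ => hval i j,
      Finset.sum_add_distrib, Finset.sum_mul]
    simp
  rw [Finset.sum_congr rfl fun i _ => hrow i, Finset.sum_add_distrib, ← Finset.sum_mul,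
    ← Finset.sum_mul, sum_sum_integral_weight_mul hD]
  ring

end WeightedSum

/-! ### Integrability and mean of the prior entropy. -/

section PriorEntropy

variable {Ω : Type*} [MeasurableSpace Ω] {μ : Measure Ω} {d k : ℕ}
  {G : Measure (EuclideanSpace ℝ (Fin d))} [IsProbabilityMeasure G] {N : ℕ} {a : ℝ}
  {J : Ω → Fin N → ℝ} {Y : Ω → Fin N → EuclideanSpace ℝ (Fin d)}

lemma priorEntropy_eq (w : Fin N → ℝ) (y : Fin N → EuclideanSpace ℝ (Fin d)) :
    priorEntropy k w y = ∑ i, w i * knnLogVol k y i +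
      (-(harmonic (k - 1) : ℝ) + Real.eulerMascheroniConstant + Real.log k) := by
  rw [priorEntropy]
  ring

lemma integrable_priorEntropy (hd : 1 ≤ d) (hk : 1 ≤ k) (hkN : k + 1 ≤ N) (hG : G ≪ volume)
    (hlog : Integrable (fun x => Real.log (pdfOf G x)) G)
    (hnorm : Integrable (fun x => Real.log (1 + ‖x‖)) G) (ha : 0 < a)
    (hJY : HasLaw (fun ω => (J ω, Y ω))
      ((dirichletLaw fun _ : Fin N => a / N).prod (Measure.pi fun _ => G)) μ) :
    Integrable (fun ω => priorEntropy k (J ω) (Y ω)) μ ∧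
      ∫ ω, priorEntropy k (J ω) (Y ω) ∂μ =
        ∫ y, knnLogVol k y ⟨0, by omega⟩ ∂(Measure.pi fun _ : Fin N => G) +
          (-(harmonic (k - 1) : ℝ) + Real.eulerMascheroniConstant + Real.log k) := by
  have hN0 : (0 : ℝ) < N := by exact_mod_cast (by omega : 0 < N)
  have hα : ∀ _ : Fin N, 0 < a / (N : ℝ) := fun _ => div_pos ha hN0
  have : Nonempty (Fin N) := ⟨⟨0, by omega⟩⟩
  have := isProbabilityMeasure_dirichletLaw hα
  have hD := ae_dirichletLaw hα
  have hT := fun i => integrable_knnLogVol (G := G) hd hk hkN hG hlog hnorm i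
  have hm := measurable_priorEntropy (d := d) hk hkN
  have hsum := integrable_sum_weight_mul hD hT
  have hint : Integrable (fun q : (Fin N → ℝ) × (Fin N → EuclideanSpace ℝ (Fin d)) =>
      priorEntropy k q.1 q.2)
      ((dirichletLaw fun _ : Fin N => a / N).prod (Measure.pi fun _ => G)) := by
    simp_rw [priorEntropy_eq]
    exact hsum.add (integrable_const _)
  constructor
  · rw [← hJY.map_eq] at hint
    exact hint.comp_aemeasurable hJY.aemeasurable
  · have h1 := hJY.integral_comp hm.aestronglyMeasurable
    refine h1.trans ?_
    simp_rw [priorEntropy_eq]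
    rw [integral_add hsum (integrable_const _), integral_sum_weight_mul hD hT
      fun i => integral_knnLogVol_eq hk hkN i ⟨0, by omega⟩]
    simp

lemma memLp_priorEntropy (hd : 1 ≤ d) (hk : 1 ≤ k) (hkN : k + 1 ≤ N) (hG : G ≪ volume)
    (hlog : MemLp (fun x => Real.log (pdfOf G x)) 2 G)
    (hnorm : MemLp (fun x => Real.log (1 + ‖x‖)) 2 G) (ha : 0 < a)
    (hJY : HasLaw (fun ω => (J ω, Y ω))
      ((dirichletLaw fun _ : Fin N => a / N).prod (Measure.pi fun _ => G)) μ) :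
    MemLp (fun ω => priorEntropy k (J ω) (Y ω)) 2 μ := by
  have hN0 : (0 : ℝ) < N := by exact_mod_cast (by omega : 0 < N)
  have hα : ∀ _ : Fin N, 0 < a / (N : ℝ) := fun _ => div_pos ha hN0
  have : Nonempty (Fin N) := ⟨⟨0, by omega⟩⟩
  have := isProbabilityMeasure_dirichletLaw hα
  have hsum := memLp_sum_weight_mul (ae_dirichletLaw hα)
    fun i => memLp_knnLogVol (G := G) hd hk hkN hG hlog hnorm i
  have hint : MemLp (fun q : (Fin N → ℝ) × (Fin N → EuclideanSpace ℝ (Fin d)) =>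
      priorEntropy k q.1 q.2) 2
      ((dirichletLaw fun _ : Fin N => a / N).prod (Measure.pi fun _ => G)) := by
    simp_rw [priorEntropy_eq]
    exact hsum.add (memLp_const _)
  rw [← hJY.map_eq] at hint
  exact hint.comp_of_map hJY.aemeasurable

end PriorEntropy

/-! ### Exact variance of the prior entropy at finite sample size. -/

section Variance

variable {Ω : Type*} [MeasurableSpace Ω] {μ : Measure Ω} {d k : ℕ}
  {G : Measure (EuclideanSpace ℝ (Fin d))} [IsProbabilityMeasure G] {n : ℕ} {a : ℝ}
  {J : Ω → Fin (n + 2) → ℝ} {Y : Ω → Fin (n + 2) → EuclideanSpace ℝ (Fin d)}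

lemma variance_priorEntropy (hd : 1 ≤ d) (hk : 1 ≤ k) (hkn : k ≤ n + 1) (hG : G ≪ volume)
    (hlog : MemLp (fun x => Real.log (pdfOf G x)) 2 G)
    (hnorm : MemLp (fun x => Real.log (1 + ‖x‖)) 2 G) (ha : 0 < a)
    (hJY : HasLaw (fun ω => (J ω, Y ω))
      ((dirichletLaw fun _ : Fin (n + 2) => a / ((n + 2 : ℕ) : ℝ)).prod
        (Measure.pi fun _ => G)) μ) :
    Var[fun ω => priorEntropy k (J ω) (Y ω); μ] =
      (a / ((n + 2 : ℕ) : ℝ) + 1) / (a + 1) *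
        ∫ y, knnLogVol k y 0 * knnLogVol k y 0 ∂(Measure.pi fun _ : Fin (n + 2) => G) +
      (1 - (a / ((n + 2 : ℕ) : ℝ) + 1) / (a + 1)) *
        ∫ y, knnLogVol k y 0 * knnLogVol k y 1 ∂(Measure.pi fun _ : Fin (n + 2) => G) -
      (∫ y, knnLogVol k y 0 ∂(Measure.pi fun _ : Fin (n + 2) => G)) ^ 2 := by
  have hkN : k + 1 ≤ n + 2 := by omega
  have hα : ∀ _ : Fin (n + 2), 0 < a / ((n + 2 : ℕ) : ℝ) := fun _ => by positivity
  have := isProbabilityMeasure_dirichletLaw hα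
  have hD := ae_dirichletLaw hα
  have hT := fun i => memLp_knnLogVol (G := G) hd hk hkN hG hlog hnorm i
  have hm := measurable_priorEntropy (d := d) hk hkN
  have hsum := memLp_sum_weight_mul hD hT
  have h1 : Var[fun ω => priorEntropy k (J ω) (Y ω); μ] =
      Var[fun q : (Fin (n + 2) → ℝ) × (Fin (n + 2) → EuclideanSpace ℝ (Fin d)) =>
        priorEntropy k q.1 q.2; (dirichletLaw fun _ : Fin (n + 2) => a / ((n + 2 : ℕ) : ℝ)).prod
          (Measure.pi fun _ => G)] := by
    rw [← hJY.map_eq, variance_map hm.aemeasurable hJY.aemeasurable]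
    rfl
  rw [h1]
  simp_rw [priorEntropy_eq]
  rw [variance_add_const hsum.1, variance_eq_sub hsum]
  simp only [Pi.pow_apply]
  rw [integral_sq_sum_weight_mul hD hT (integral_knnLogVol_mul_eq hk hkn),
    integral_sum_weight_mul hD (fun i => (hT i).integrable one_le_two)
      (fun i => integral_knnLogVol_eq hk hkN i 0), sum_integral_sq_dirichletLaw (by omega) ha]

end Variance

/-! ### Assembly of the limits. -/

theorem lemma1 {Ω : Type*} [MeasurableSpace Ω] (μ : Measure Ω) [IsProbabilityMeasure μ]
    (d k : ℕ) (hd : 1 ≤ d) (hk : 1 ≤ k)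
    (G : Measure (EuclideanSpace ℝ (Fin d))) [IsProbabilityMeasure G]
    (hG : G ≪ volume)
    (hlog : Integrable (fun x => Real.log (pdfOf G x)) G)
    (hnorm : Integrable (fun x => Real.log (1 + ‖x‖)) G)
    (Y : ℕ → Ω → EuclideanSpace ℝ (Fin d))
    (hYlaw : ∀ i, HasLaw (Y i) G μ)
    (hYindep : iIndepFun Y μ)
    (J : ℝ → (N : ℕ) → Ω → Fin N → ℝ)
    (hJlaw : ∀ a : ℝ, 0 < a → ∀ N : ℕ, 1 ≤ N →
      HasLaw (J a N) (dirichletLaw fun _ : Fin N => a / N) μ)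
    (hJY : ∀ a : ℝ, 0 < a → ∀ N : ℕ, 1 ≤ N →
      IndepFun (J a N) (fun ω (i : Fin N) => Y i ω) μ) :
    (∀ a : ℝ, 0 < a →
      (∀ N : ℕ, k + 1 ≤ N →
        Integrable (fun ω => priorEntropy k (J a N ω) (fun i : Fin N => Y i ω)) μ) ∧
      Tendsto (fun N : ℕ => ∫ ω, priorEntropy k (J a N ω) (fun i : Fin N => Y i ω) ∂μ)
        atTop (𝓝 (entropyOf G))) ∧
    (MemLp (fun x => Real.log (pdfOf G x)) 2 G → MemLp (fun x => Real.log (1 + ‖x‖)) 2 G →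
      (∀ a : ℝ, 0 < a →
        (∀ N : ℕ, k + 1 ≤ N →
          MemLp (fun ω => priorEntropy k (J a N ω) (fun i : Fin N => Y i ω)) 2 μ) ∧
        Tendsto
          (fun N : ℕ => variance (fun ω => priorEntropy k (J a N ω) (fun i : Fin N => Y i ω)) μ)
          atTop
          (𝓝 (((∑' j : ℕ, 1 / ((k : ℝ) + j) ^ 2)
            + variance (fun x => Real.log (pdfOf G x)) G) / (a + 1)))) ∧
      Tendsto
        (fun a : ℝ => ((∑' j : ℕ, 1 / ((k : ℝ) + j) ^ 2)
          + variance (fun x => Real.log (pdfOf G x)) G) / (a + 1))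
        atTop (𝓝 0) ∧
      Tendsto
        (fun p : ℕ × ℝ =>
          variance (fun ω => priorEntropy k (J p.2 p.1 ω) (fun i : Fin p.1 => Y i ω)) μ)
        (atTop ×ˢ atTop) (𝓝 0)) := by
  have hlaw : ∀ a : ℝ, 0 < a → ∀ N : ℕ, 1 ≤ N →
      HasLaw (fun ω => (J a N ω, fun i : Fin N => Y i ω))
        ((dirichletLaw fun _ : Fin N => a / N).prod (Measure.pi fun _ => G)) μ := by
    intro a ha N hN
    have hY : HasLaw (fun ω (i : Fin N) => Y i ω) (Measure.pi fun _ => G) μ :=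
      (hYindep.precomp Fin.val_injective).hasLaw_pi fun i => hYlaw i
    have hN0 : (0 : ℝ) < N := by exact_mod_cast hN
    have : IsProbabilityMeasure (dirichletLaw fun _ : Fin N => a / N) :=
      isProbabilityMeasure_dirichletLaw fun _ => div_pos ha hN0
    exact (indepFun_iff_hasLaw_prodMk_prod (hJlaw a ha N hN) hY).1 (hJY a ha N hN)
  refine ⟨fun a ha => ⟨fun N hN => (integrable_priorEntropy hd hk hN hG hlog hnorm ha
    (hlaw a ha N (by omega))).1, ?_⟩, fun hlog2 hnorm2 => ?_⟩
  -- The moment limits are stated along `N = n + 2`, where the indices `0` and `1` exist.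
  · rw [← tendsto_add_atTop_iff_nat 2]
    have h := (tendsto_integral_knnLogVol hd hk hG hlog hnorm).add_const
      (-(harmonic (k - 1) : ℝ) + Real.eulerMascheroniConstant + Real.log k)
    rw [integral_limitLogVol G hk hG hlog, show (harmonic (k - 1) : ℝ) -
      Real.eulerMascheroniConstant - Real.log k + entropyOf G +
      (-(harmonic (k - 1) : ℝ) + Real.eulerMascheroniConstant + Real.log k) = entropyOf G by
        ring] at h
    refine h.congr' ?_
    filter_upwards [eventually_ge_atTop k] with n hn
    exact (integrable_priorEntropy hd hk (by omega) hG hlog hnorm ha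
      (hlaw a ha (n + 2) (by omega))).2.symm
  · have hm := tendsto_integral_knnLogVol hd hk hG hlog hnorm
    have hb := tendsto_integral_sq_knnLogVol hd hk hG hlog2 hnorm2
    have hc := tendsto_integral_mul_knnLogVol hd hk hG hlog2 hnorm2
    have hprob := isProbabilityMeasure_gammaMeasure_natCast hk
    have hvar := variance_limitLogVol G hk hlog2
    rw [variance_eq_sub (memLp_limitLogVol G hk hlog2)] at hvar
    simp only [pow_two, Pi.mul_apply] at hvar
    simp only [← pow_two (∫ q, limitLogVol k G q ∂((gammaMeasure (k : ℝ) 1).prod G))] at hvar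
    refine ⟨fun a ha => ⟨fun N hN => memLp_priorEntropy hd hk hN hG hlog2 hnorm2 ha
      (hlaw a ha N (by omega)), ?_⟩, ?_, ?_⟩
    · rw [← tendsto_add_atTop_iff_nat 2]
      have hA : Tendsto (fun n : ℕ => (a / ((n + 2 : ℕ) : ℝ) + 1) / (a + 1)) atTop
          (𝓝 ((0 + 1) / (a + 1))) :=
        (((tendsto_add_atTop_iff_nat 2).2 (tendsto_const_div_atTop_nhds_zero_nat a)).add_const
          1).div_const _
      have h := ((hA.mul hb).add ((hA.const_sub 1).mul hc)).sub (hm.pow 2)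
      refine (h.congr' ?_).trans (le_of_eq ?_)
      · filter_upwards [eventually_ge_atTop k] with n hn
        exact (variance_priorEntropy hd hk (by omega) hG hlog2 hnorm2 ha
          (hlaw a ha (n + 2) (by omega))).symm
      · congr 1
        -- With diagonal weight `1 / (a + 1)`, the squared means combine to `-m² / (a + 1)`, leaving
        -- the limit variance divided by `a + 1`.
        simp only [pow_two] at hvar ⊢
        rw [← hvar]
        field_simp
        ring
    · exact tendsto_const_nhds.div_atTop (tendsto_atTop_add_const_right _ 1 tendsto_id)
    · have hfst : Tendsto (fun p : ℕ × ℝ => p.1 - 2) (atTop ×ˢ atTop) atTop :=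
        (tendsto_sub_atTop_nat 2).comp tendsto_fst
      -- The diagonal weight is at most `1 / N + 1 / a`. The three moments do not involve `a`, so in
      -- the joint limit only `m² - m² = 0` survives.
      have hA : Tendsto (fun p : ℕ × ℝ => (p.2 / (p.1 : ℝ) + 1) / (p.2 + 1)) (atTop ×ˢ atTop)
          (𝓝 0) := by
        have h1 : Tendsto (fun p : ℕ × ℝ => 1 / (p.1 : ℝ) + 1 / p.2) (atTop ×ˢ atTop)
            (𝓝 (0 + 0)) :=
          (tendsto_one_div_atTop_nhds_zero_nat.comp tendsto_fst).add
            ((tendsto_const_nhds.div_atTop tendsto_id).comp tendsto_snd)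
        rw [add_zero] at h1
        have hev : ∀ᶠ p : ℕ × ℝ in atTop ×ˢ atTop, 1 ≤ p.1 ∧ 0 < p.2 :=
          (eventually_ge_atTop 1).prod_mk (eventually_gt_atTop 0)
        refine squeeze_zero' ?_ ?_ h1
        · filter_upwards [hev] with p hp
          have := hp.2
          positivity
        · filter_upwards [hev] with p hp
          have h2 := hp.2
          have h3 : (0 : ℝ) < p.1 := by exact_mod_cast hp.1
          rw [add_div]
          refine add_le_add ?_ ?_
          · rw [div_div, div_le_div_iff₀ (by positivity) h3]
            nlinarith
          · exact one_div_le_one_div_of_le h2 (by linarith)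
      have h := ((hA.mul (hb.comp hfst)).add ((hA.const_sub 1).mul (hc.comp hfst))).sub
        ((hm.comp hfst).pow 2)
      simp only [zero_mul, sub_zero, one_mul, zero_add, sub_self] at h
      refine h.congr' ?_
      have hev : ∀ᶠ p : ℕ × ℝ in atTop ×ˢ atTop, k + 2 ≤ p.1 ∧ 0 < p.2 :=
        (eventually_ge_atTop (k + 2)).prod_mk (eventually_gt_atTop 0)
      filter_upwards [hev] with p hp
      obtain ⟨N, a⟩ := p
      obtain ⟨n, rfl⟩ : ∃ n, N = n + 2 := ⟨N - 2, by omega⟩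
      exact (variance_priorEntropy hd hk (by omega) hG hlog2 hnorm2 hp.2
        (hlaw a hp.2 (n + 2) (by omega))).symm
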